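/- Let $n\ge 0$, let $p>1$, and let $V:\mathbb R^n\to\mathbb R$ be an even, strictly convex function that is $p$-homogeneous ($V(rx)=r^pV(x)$ for $r>0$) and of class $C^2$ on $\mathbb R^n\setminus\{0\}$ (in particular, this covers $V\in C^2(\mathbb R^n)$). Assume that $V$ is unconditional, i.e. $V(\pm x_1,\dots,\pm x_n)=V(x_1,\dots,x_n)$ for every choice of signs, and that the function $$x=(x_1,\dots,x_n)\mapsto V\bigl(x_1^{1/p},\dots,x_n^{1/p}\bigr)$$ is concave on $\mathbb R^n_+=\{x: x_i\ge 0\ \text{for all } i\}$. Then $\int e^{-V}dx$ is positive and finite, so that $d\mu=\frac{e^{-V}dx}{\int e^{-V}dx}$ is a probability measure, and the inequality $$\operatorname{Var}_\mu f\le\Bigl(1-\frac1p\Bigr)\int_{\mathbb R^n}\bigl\langle (D^2V)^{-1}\nabla f,\nabla f\bigr\rangle\,d\mu \qquad (*)$$ holds for every unconditional $f\in C^1(\mathbb R^n)$. Let $V^*(y)=\sup_x(\langle x,y\rangle-V(x))$ be the Legendre transform of $V$. Assume, in addition, that for every coordinate hyperplane $H$ with unit normal $e$ and for every $x'\in H$,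 the function $t\mapsto\det D^2V^*(x'+te)$ is decreasing (non-increasing) on $[0,+\infty)$, where $\det D^2V^*$ is given the value $+\infty$ at the points where $V^*$ is not twice differentiable. Then $(*)$ holds for every even $f\in C^1(\mathbb R^n)$. Here $(*)$ is an inequality in $[0,+\infty]$: its left side is $+\infty$ if $f\notin L^2(\mu)$, and at points where $D^2V(x)$ is not invertible, $\langle (D^2V(x))^{-1}\xi,\xi\rangle$ means $\langle\eta,\xi\rangle$ for any $\eta$ with $D^2V(x)\eta=\xi$, and $+\infty$ if there is no such $\eta$. -/

import Mathlib

open MeasureTheory ProbabilityTheory Set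
open scoped ENNReal RealInnerProductSpace

noncomputable section

namespace StrongBL

/-- `ℝⁿ` with its Euclidean structure. -/
abbrev Rn (n : ℕ) : Type := EuclideanSpace ℝ (Fin n)

/-- `f` is unconditional: `f (±x₁, …, ±xₙ) = f (x₁, …, xₙ)` for every choice of the signs. -/
def IsUnconditional {n : ℕ} (f : Rn n → ℝ) : Prop :=
  ∀ s : Fin n → ℝ, (∀ i, s i = 1 ∨ s i = -1) →
    ∀ x : Rn n, f (WithLp.toLp 2 fun i => s i * x i) = f x

/-- `V` is (positively) `p`-homogeneous. -/
def IsHomogeneousOfDegree {n : ℕ} (p : ℝ) (V : Rn n → ℝ) : Prop :=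
  ∀ r : ℝ, 0 < r → ∀ x : Rn n, V (r • x) = r ^ p * V x

/-- The closed orthant `ℝⁿ₊ = {x | xᵢ ≥ 0 for all i}`. -/
def orthant (n : ℕ) : Set (Rn n) := {x | ∀ i, 0 ≤ x i}

/-- The coordinatewise power `x ↦ (x₁ ^ s, …, xₙ ^ s)`, used on the closed orthant. -/
def coordPow {n : ℕ} (s : ℝ) (x : Rn n) : Rn n := WithLp.toLp 2 fun i => x i ^ s

/-- The Hessian `D²V(x)`, as the derivative of the gradient field of `V`. -/
def hess {n : ℕ} (V : Rn n → ℝ) (x : Rn n) : Rn n →L[ℝ] Rn n := fderiv ℝ (gradient V) x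

/-- The Legendre transform `V*(y) = sup_x (⟨x, y⟩ - V x)`. It is used only for functions `V` of
superlinear growth, for which the supremum is finite. -/
def legendre {n : ℕ} (V : Rn n → ℝ) (y : Rn n) : ℝ := ⨆ x : Rn n, (⟪x, y⟫ - V x)

open Classical in
/-- `det D²U(y)` for a differentiable convex function `U`, as an extended nonnegative number:
it is `+∞` at the points where `U` is not twice differentiable. -/
def detHess {n : ℕ} (U : Rn n → ℝ) (y : Rn n) : ℝ≥0∞ :=
  if DifferentiableAt ℝ (gradient U) y then ENNReal.ofReal (hess U y).det else ⊤

/-- The quadratic form `⟨A⁻¹ ξ, ξ⟩` of the inverse of a symmetric positive semidefinite operator: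
the value `⟨η, ξ⟩` at a solution `η` of `A η = ξ` (it does not depend on the solution), and `+∞`
if there is no solution. For invertible `A` this is literally `⟨A⁻¹ ξ, ξ⟩`, see
`invForm_of_equiv`. -/
def invForm {n : ℕ} (A : Rn n →L[ℝ] Rn n) (ξ : Rn n) : ℝ≥0∞ :=
  ⨅ (η : Rn n) (_ : A η = ξ), ENNReal.ofReal ⟪η, ξ⟫

theorem invForm_of_equiv {n : ℕ} (A : Rn n ≃L[ℝ] Rn n) (ξ : Rn n) :
    invForm (A : Rn n →L[ℝ] Rn n) ξ = ENNReal.ofReal ⟪A.symm ξ, ξ⟫ := by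
  apply le_antisymm
  · exact iInf₂_le (A.symm ξ) (by simp)
  · refine le_iInf₂ fun η hη => ?_
    have h : η = A.symm ξ := by rw [← hη]; simp
    rw [h]

/-- The measure `dμ = e^{-V} dx / ∫ e^{-V} dx`. -/
def gibbs {n : ℕ} (V : Rn n → ℝ) : Measure (Rn n) :=
  (∫⁻ x : Rn n, ENNReal.ofReal (Real.exp (-V x)))⁻¹ •
    (volume : Measure (Rn n)).withDensity fun x => ENNReal.ofReal (Real.exp (-V x))

/-- `Var_μ f ≤ (1 - 1/p) ∫ ⟨(D²V)⁻¹ ∇f, ∇f⟩ dμ` for `μ = e^{-V} dx / ∫ e^{-V} dx`, as an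
inequality in `[0, ∞]`; the variance is `+∞` if `f` is not square integrable. -/
def StrongBrascampLieb {n : ℕ} (p : ℝ) (V f : Rn n → ℝ) : Prop :=
  evariance f (gibbs V) ≤
    ENNReal.ofReal (1 - 1 / p) * ∫⁻ x, invForm (hess V x) (gradient f x) ∂(gibbs V)

end StrongBL

end

/-!
The Brascamp–Lieb inequality `Var f ≤ ∫ ⟨(D²W)⁻¹ ∇f, ∇f⟩` tensorizes, so it passes from the line to
cubes, and then to `ℝⁿ` by exhaustion.

Let `f` be unconditional. In the coordinates `x = e^t` on the open orthant, the density `e^{-V} dx`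
becomes `e^{-W} dt` with `W t = V (e^t) - ∑ tᵢ`. Concavity of `V (x^{1/p})` says that
`⟨D²V v, v⟩ ≤ (p - 1) ∑ ∂ᵢV vᵢ² / xᵢ`, so `(1 - 1/p) D²W ≥ X D²V X` with `X = diag x`. Since the
gradient in `t` is `X ∇f`, the Brascamp–Lieb inequality for `W` is the claim for `V`.

Reflections in the coordinate hyperplanes split an even `f` into parts with a parity in every
coordinate, and energies of different parts add up. A part that is not unconditional is odd in two
coordinates `i ≠ j`. Along the lines parallel to `eⱼ` the Brascamp–Lieb inequality holds with
constant `1`. Since `V (∇V* z) = V* z / (p - 1)`, the same inequality along the lines parallel to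
`eᵢ` in the dual variable `z = ∇V x`, where the monotonicity of `det D²V*` takes care of the
Jacobian, holds with constant `p - 1`. For a positive definite `A` and `⟨d, e⟩ = 0`,
`⟨A⁻¹ ξ, ξ⟩ ≥ ⟨ξ, d⟩² / ⟨A d, d⟩ + ⟨ξ, A⁻¹ e⟩² / ⟨A⁻¹ e, e⟩`,
so the two one-dimensional inequalities add up, to the constant `1 / (1 + 1 / (p - 1)) = 1 - 1/p`.
-/

noncomputable section

namespace StrongBL

open Filter Topology

/-! ### The Brascamp–Lieb inequality on the line -/

section OneDimensional

variable {h h' ψ ψ' ψ'' q : ℝ → ℝ} {a b : ℝ}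

theorem nonneg_of_forall_two_mul_sub_sq_mul_le {x y c : ℝ}
    (hc : ∀ l : ℝ, 2 * l * x - l ^ 2 * y ≤ c) : 0 ≤ y := by
  by_contra! hy
  have hdiscrim := discrim_le_zero (a := y) (b := -2 * x) (c := c) fun l => by linarith [hc l]
  rw [discrim] at hdiscrim
  nlinarith [hc 0, hc 1, hc (-1), sq_nonneg x]

theorem lintegral_setLIntegral_Iio_mul {μ : Measure ℝ} [SFinite μ] {Q G : ℝ → ℝ≥0∞}
    (hQ : AEMeasurable Q μ) (hG : AEMeasurable G μ) :
    ∫⁻ x, (∫⁻ s in Iio x, Q s ∂μ) * G x ∂μ = ∫⁻ s, Q s * ∫⁻ x in Ioi s, G x ∂μ ∂μ := by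
  have hmeas : MeasurableSet {z : ℝ × ℝ | z.2 < z.1} :=
    measurableSet_lt measurable_snd measurable_fst
  calc ∫⁻ x, (∫⁻ s in Iio x, Q s ∂μ) * G x ∂μ
      = ∫⁻ x, ∫⁻ s, {z : ℝ × ℝ | z.2 < z.1}.indicator (fun z => Q z.2 * G z.1) (x, s) ∂μ ∂μ := by
        refine lintegral_congr fun x => ?_
        rw [← lintegral_mul_const'' _ hQ.restrict, ← lintegral_indicator measurableSet_Iio]
        rfl
    _ = ∫⁻ s, ∫⁻ x, {z : ℝ × ℝ | z.2 < z.1}.indicator (fun z => Q z.2 * G z.1) (x, s) ∂μ ∂μ :=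
        lintegral_lintegral_swap ((hQ.comp_snd.mul hG.comp_fst).indicator hmeas)
    _ = ∫⁻ s, Q s * ∫⁻ x in Ioi s, G x ∂μ ∂μ := by
        refine lintegral_congr fun s => ?_
        rw [← lintegral_const_mul'' _ hG.restrict, ← lintegral_indicator measurableSet_Ioi]
        rfl

theorem setLIntegral_Ioc_deriv_mul_exp_neg_le (hab : a ≤ b)
    (hψ : ∀ t ∈ Icc a b, HasDerivAt ψ (ψ' t) t) (hψ' : ContinuousOn ψ' (Icc a b))
    (hpos : ∀ t ∈ Icc a b, 0 ≤ ψ' t) :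
    ∫⁻ x in Ioc a b, ENNReal.ofReal (ψ' x * Real.exp (-ψ x)) ≤
      ENNReal.ofReal (Real.exp (-ψ a)) := by
  have hcont : ContinuousOn (fun x => ψ' x * Real.exp (-ψ x)) (Icc a b) :=
    hψ'.mul (Real.continuous_exp.comp_continuousOn (HasDerivAt.continuousOn hψ).neg)
  have hint : ∫ x in a..b, ψ' x * Real.exp (-ψ x) = Real.exp (-ψ a) - Real.exp (-ψ b) := by
    rw [← uIcc_of_le hab] at hψ hcont
    rw [intervalIntegral.integral_eq_sub_of_hasDerivAt (f := fun x => -Real.exp (-ψ x))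
      (fun x hx => ((hψ x hx).fun_neg.exp.neg).congr_deriv (by ring)) hcont.intervalIntegrable]
    ring
  rw [← ofReal_integral_eq_lintegral_ofReal, ← intervalIntegral.integral_of_le hab, hint]
  · exact ENNReal.ofReal_le_ofReal (by linarith [Real.exp_pos (-ψ b)])
  · exact (hcont.integrableOn_compact isCompact_Icc).mono_set Ioc_subset_Icc_self
  · refine (ae_restrict_mem measurableSet_Ioc).mono fun x hx => ?_
    exact mul_nonneg (hpos x (Ioc_subset_Icc_self hx)) (Real.exp_pos _).le

theorem sq_sub_le_integral_mul (hab : a ≤ b)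
    (hh : ∀ t ∈ Icc a b, HasDerivAt h (h' t) t) (hψ' : ∀ t ∈ Icc a b, HasDerivAt ψ' (ψ'' t) t)
    (ch : ContinuousOn h' (Icc a b)) (cψ : ContinuousOn ψ'' (Icc a b))
    (cq : ContinuousOn q (Icc a b))
    (hq : ∀ t ∈ Icc a b, ∀ l : ℝ, 2 * l * h' t - l ^ 2 * ψ'' t ≤ q t) :
    (h b - h a) ^ 2 ≤ (∫ t in a..b, q t) * (ψ' b - ψ' a) := by
  rw [← uIcc_of_le hab] at hh hψ' ch cψ cq
  have key : ∀ l : ℝ, 2 * l * (h b - h a) - l ^ 2 * (ψ' b - ψ' a) ≤ ∫ t in a..b, q t := by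
    intro l
    have hcont : ContinuousOn (fun t => 2 * l * h' t - l ^ 2 * ψ'' t) (uIcc a b) := by fun_prop
    calc 2 * l * (h b - h a) - l ^ 2 * (ψ' b - ψ' a)
        = (2 * l * h b - l ^ 2 * ψ' b) - (2 * l * h a - l ^ 2 * ψ' a) := by ring
      _ = ∫ t in a..b, (2 * l * h' t - l ^ 2 * ψ'' t) :=
          (intervalIntegral.integral_eq_sub_of_hasDerivAt
            (f := fun t => 2 * l * h t - l ^ 2 * ψ' t)
            (fun t ht => ((hh t ht).const_mul _).sub ((hψ' t ht).const_mul _))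
            hcont.intervalIntegrable).symm
      _ ≤ ∫ t in a..b, q t :=
          intervalIntegral.integral_mono_on hab hcont.intervalIntegrable cq.intervalIntegrable
            fun t ht => hq t ht l
  have hdiscrim := discrim_le_zero (a := ψ' b - ψ' a) (b := -2 * (h b - h a))
    (c := ∫ t in a..b, q t) fun l => by linarith [key l]
  rw [discrim] at hdiscrim
  nlinarith

theorem ofReal_sq_le_setLIntegral_mul_of_tendsto_zero (hab : a < b)
    (h0 : Tendsto h (𝓝[>] a) (𝓝 0))
    (hh : ∀ t ∈ Ioc a b, HasDerivAt h (h' t) t) (hψ' : ∀ t ∈ Ioc a b, HasDerivAt ψ' (ψ'' t) t)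
    (ch : ContinuousOn h' (Ioc a b)) (cψ : ContinuousOn ψ'' (Ioc a b))
    (cq : ContinuousOn q (Ioc a b)) (hpos : ∀ t ∈ Ioc a b, 0 ≤ ψ' t)
    (hq : ∀ t ∈ Ioc a b, ∀ l : ℝ, 2 * l * h' t - l ^ 2 * ψ'' t ≤ q t) :
    ENNReal.ofReal (h b ^ 2) ≤
      (∫⁻ t in Ioo a b, ENNReal.ofReal (q t)) * ENNReal.ofReal (ψ' b) := by
  have q0 : ∀ t ∈ Ioc a b, 0 ≤ q t := fun t ht => by simpa using hq t ht 0
  have hlim : Tendsto (fun s => ENNReal.ofReal ((h b - h s) ^ 2)) (𝓝[>] a)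
      (𝓝 (ENNReal.ofReal (h b ^ 2))) := by
    simpa using ENNReal.tendsto_ofReal ((tendsto_const_nhds (x := h b)).sub h0 |>.pow 2)
  refine le_of_tendsto hlim ?_
  filter_upwards [Ioo_mem_nhdsGT hab] with s hs
  have hsub : Icc s b ⊆ Ioc a b := Icc_subset_Ioc hs.1 le_rfl
  have hint : 0 ≤ ∫ t in s..b, q t :=
    intervalIntegral.integral_nonneg hs.2.le fun t ht => q0 t (hsub ht)
  have hsq : (h b - h s) ^ 2 ≤ (∫ t in s..b, q t) * ψ' b :=
    (sq_sub_le_integral_mul hs.2.le (fun t ht => hh t (hsub ht)) (fun t ht => hψ' t (hsub ht))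
      (ch.mono hsub) (cψ.mono hsub) (cq.mono hsub) fun t ht => hq t (hsub ht)).trans
      (mul_le_mul_of_nonneg_left (by linarith [hpos s (hsub ⟨le_rfl, hs.2.le⟩)]) hint)
  refine (ENNReal.ofReal_le_ofReal hsq).trans ?_
  rw [ENNReal.ofReal_mul hint]
  gcongr
  rw [intervalIntegral.integral_of_le hs.2.le, integral_Ioc_eq_integral_Ioo,
    ofReal_integral_eq_lintegral_ofReal]
  · exact lintegral_mono_set (Ioo_subset_Ioo_left hs.1.le)
  · exact ((cq.mono hsub).integrableOn_compact isCompact_Icc).mono_set Ioo_subset_Icc_self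
  · exact (ae_restrict_mem measurableSet_Ioo).mono fun t ht => q0 t (hsub (Ioo_subset_Icc_self ht))

theorem brascampLieb_Ioc_of_tendsto_zero (h0 : Tendsto h (𝓝[>] a) (𝓝 0))
    (hh : ∀ t ∈ Ioc a b, HasDerivAt h (h' t) t) (hψ : ∀ t ∈ Ioc a b, HasDerivAt ψ (ψ' t) t)
    (hψ' : ∀ t ∈ Ioc a b, HasDerivAt ψ' (ψ'' t) t)
    (ch : ContinuousOn h' (Ioc a b)) (cψ : ContinuousOn ψ'' (Ioc a b))
    (cq : ContinuousOn q (Ioc a b)) (hpos : ∀ t ∈ Ioc a b, 0 ≤ ψ' t)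
    (hq : ∀ t ∈ Ioc a b, ∀ l : ℝ, 2 * l * h' t - l ^ 2 * ψ'' t ≤ q t) :
    ∫⁻ t in Ioc a b, ENNReal.ofReal (h t ^ 2 * Real.exp (-ψ t)) ≤
      ∫⁻ t in Ioc a b, ENNReal.ofReal (q t * Real.exp (-ψ t)) := by
  set μ : Measure ℝ := volume.restrict (Ioc a b)
  set Q : ℝ → ℝ≥0∞ := fun s => ENNReal.ofReal (q s)
  set G : ℝ → ℝ≥0∞ := fun x => ENNReal.ofReal (ψ' x * Real.exp (-ψ x))
  have cψ' : ContinuousOn ψ' (Ioc a b) := HasDerivAt.continuousOn hψ'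
  have hQ : AEMeasurable Q μ := (cq.aemeasurable measurableSet_Ioc).ennreal_ofReal
  have hG : AEMeasurable G μ := ((cψ'.mul (Real.continuous_exp.comp_continuousOn
    (HasDerivAt.continuousOn hψ).neg)).aemeasurable measurableSet_Ioc).ennreal_ofReal
  calc ∫⁻ x in Ioc a b, ENNReal.ofReal (h x ^ 2 * Real.exp (-ψ x))
      ≤ ∫⁻ x, (∫⁻ s in Iio x, Q s ∂μ) * G x ∂μ := by
        refine setLIntegral_mono' measurableSet_Ioc fun x hx => ?_
        have hsub : Ioc a x ⊆ Ioc a b := Ioc_subset_Ioc_right hx.2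
        have hset : Iio x ∩ Ioc a b = Ioo a x := by
          ext s; exact ⟨fun hs => ⟨hs.2.1, hs.1⟩, fun hs => ⟨hs.2, hs.1, hs.2.le.trans hx.2⟩⟩
        have hGx : G x = ENNReal.ofReal (ψ' x) * ENNReal.ofReal (Real.exp (-ψ x)) :=
          ENNReal.ofReal_mul (hpos x hx)
        rw [Measure.restrict_restrict measurableSet_Iio, hset, ENNReal.ofReal_mul (sq_nonneg _),
          hGx, ← mul_assoc]
        gcongr
        exact ofReal_sq_le_setLIntegral_mul_of_tendsto_zero hx.1 h0 (fun t ht => hh t (hsub ht))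
          (fun t ht => hψ' t (hsub ht)) (ch.mono hsub) (cψ.mono hsub) (cq.mono hsub)
          (fun t ht => hpos t (hsub ht)) fun t ht => hq t (hsub ht)
    _ = ∫⁻ s, Q s * ∫⁻ x in Ioi s, G x ∂μ ∂μ := lintegral_setLIntegral_Iio_mul hQ hG
    _ ≤ ∫⁻ s in Ioc a b, ENNReal.ofReal (q s * Real.exp (-ψ s)) := by
        refine setLIntegral_mono' measurableSet_Ioc fun s hs => ?_
        have hsub : Icc s b ⊆ Ioc a b := Icc_subset_Ioc hs.1 le_rfl
        have hset : Ioi s ∩ Ioc a b = Ioc s b := by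
          ext x; exact ⟨fun hx => ⟨hx.1, hx.2.2⟩, fun hx => ⟨hx.1, hs.1.trans hx.1, hx.2⟩⟩
        rw [Measure.restrict_restrict measurableSet_Ioi, hset,
          ENNReal.ofReal_mul (by simpa using hq s hs 0)]
        gcongr
        exact setLIntegral_Ioc_deriv_mul_exp_neg_le hs.2 (fun t ht => hψ t (hsub ht))
          (cψ'.mono hsub) fun t ht => hpos t (hsub ht)

theorem brascampLieb_Ioc_of_forall_le (hh : ∀ t, HasDerivAt h (h' t) t)
    (hψ : ∀ t, HasDerivAt ψ (ψ' t) t) (hψ' : ∀ t, HasDerivAt ψ' (ψ'' t) t)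
    (ch : Continuous h') (cψ : Continuous ψ'') (cq : Continuous q)
    (hq : ∀ t l : ℝ, 2 * l * h' t - l ^ 2 * ψ'' t ≤ q t) (hmin : ∀ t ∈ Icc a b, ψ a ≤ ψ t) :
    ∫⁻ t in Ioc a b, ENNReal.ofReal ((h t - h a) ^ 2 * Real.exp (-ψ t)) ≤
      ∫⁻ t in Ioc a b, ENNReal.ofReal (q t * Real.exp (-ψ t)) := by
  have hmono : Monotone ψ' := monotone_of_deriv_nonneg (fun t => (hψ' t).differentiableAt)
    fun t => (hψ' t).deriv ▸ nonneg_of_forall_two_mul_sub_sq_mul_le (hq t)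
  refine brascampLieb_Ioc_of_tendsto_zero (h := fun t => h t - h a) (h' := h') ?_
    (fun t _ => (hh t).sub_const _) (fun t _ => hψ t) (fun t _ => hψ' t)
    ch.continuousOn cψ.continuousOn cq.continuousOn (fun t ht => ?_) fun t _ => hq t
  · have hlim := ((hh a).continuousAt.tendsto.sub_const (h a)).mono_left
      (nhdsWithin_le_nhds (s := Ioi a))
    rwa [sub_self] at hlim
  · obtain ⟨ξ, hξ, hslope⟩ := exists_hasDerivAt_eq_slope ψ ψ' ht.1
      (HasDerivAt.continuousOn fun x _ => hψ x) fun x _ => hψ x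
    have hξ' : 0 ≤ ψ' ξ :=
      hslope ▸ div_nonneg (sub_nonneg.2 (hmin t (Ioc_subset_Icc_self ht))) (sub_pos.2 ht.1).le
    exact hξ'.trans (hmono hξ.2.le)

theorem setLIntegral_Icc_comp_neg (F : ℝ → ℝ≥0∞) (a b : ℝ) :
    ∫⁻ t in Icc (-b) (-a), F (-t) = ∫⁻ t in Icc a b, F t := by
  rw [← (Measure.measurePreserving_neg (volume : Measure ℝ)).setLIntegral_comp_preimage_emb
    (MeasurableEquiv.neg ℝ).measurableEmbedding F (Icc a b)]
  simp

theorem setLIntegral_Icc_eq_add (F : ℝ → ℝ≥0∞) {c : ℝ} (hc : c ∈ Icc a b) :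
    ∫⁻ t in Icc a b, F t = (∫⁻ t in Icc a c, F t) + ∫⁻ t in Ioc c b, F t := by
  rw [← Icc_union_Ioc_eq_Icc hc.1 hc.2, lintegral_union measurableSet_Ioc]
  exact Set.disjoint_left.2 fun t ht ht' => ht.2.not_gt ht'.1

theorem setLIntegral_Icc_sq_sub_mul_exp_neg_le (hh : ∀ t, HasDerivAt h (h' t) t)
    (hψ : ∀ t, HasDerivAt ψ (ψ' t) t) (hψ' : ∀ t, HasDerivAt ψ' (ψ'' t) t)
    (ch : Continuous h') (cψ : Continuous ψ'') (cq : Continuous q)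
    (hq : ∀ t l : ℝ, 2 * l * h' t - l ^ 2 * ψ'' t ≤ q t) {c : ℝ} (hc : c ∈ Icc a b)
    (hmin : IsMinOn ψ (Icc a b) c) :
    ∫⁻ t in Icc a b, ENNReal.ofReal ((h t - h c) ^ 2 * Real.exp (-ψ t)) ≤
      ∫⁻ t in Icc a b, ENNReal.ofReal (q t * Real.exp (-ψ t)) := by
  rw [setLIntegral_Icc_eq_add _ hc, setLIntegral_Icc_eq_add _ hc]
  refine add_le_add ?_ (brascampLieb_Ioc_of_forall_le hh hψ hψ' ch cψ cq hq
    fun t ht => hmin (Icc_subset_Icc_left hc.1 ht))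
  rw [← setLIntegral_Icc_comp_neg _ a c, ← setLIntegral_Icc_comp_neg _ a c]
  simp only [setLIntegral_congr (Ioc_ae_eq_Icc (α := ℝ)).symm]
  have := brascampLieb_Ioc_of_forall_le (h := fun t => h (-t)) (h' := fun t => -h' (-t))
    (ψ := fun t => ψ (-t)) (ψ' := fun t => -ψ' (-t)) (ψ'' := fun t => ψ'' (-t))
    (q := fun t => q (-t)) (a := -c) (b := -a)
    (fun t => ((hh (-t)).scomp t (hasDerivAt_neg t)).congr_deriv (by simp))
    (fun t => ((hψ (-t)).scomp t (hasDerivAt_neg t)).congr_deriv (by simp))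
    (fun t => ((hψ' (-t)).scomp t (hasDerivAt_neg t)).neg.congr_deriv (by simp))
    (by fun_prop) (by fun_prop) (by fun_prop) (fun t l => by linarith [hq (-t) (-l)])
    fun t ht => by
      rw [neg_neg]
      exact hmin ⟨by linarith [ht.2], by linarith [ht.1, hc.2]⟩
  simpa only [neg_neg] using this

end OneDimensional

theorem integral_sub_mul_add_mul {α : Type*} [MeasurableSpace α] {μ : Measure α}
    {f g h : α → ℝ} (hf : Integrable f μ) (hg : Integrable g μ) (hh : Integrable h μ) (c d : ℝ) :
    ∫ x, (f x - c * g x + d * h x) ∂μ = ∫ x, f x ∂μ - c * ∫ x, g x ∂μ + d * ∫ x, h x ∂μ := by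
  rw [integral_add (f := fun x => f x - c * g x) (hf.sub (hg.const_mul c)) (hh.const_mul d),
    integral_sub hf (hg.const_mul c), integral_const_mul, integral_const_mul]

theorem integral_sq_sub_mul_eq {α : Type*} [MeasurableSpace α] {μ : Measure α}
    {f w : α → ℝ} (hw : Integrable w μ) (hfw : Integrable (fun x => f x * w x) μ)
    (hf2w : Integrable (fun x => f x ^ 2 * w x) μ) (c : ℝ) :
    ∫ x, (f x - c) ^ 2 * w x ∂μ =
      ∫ x, f x ^ 2 * w x ∂μ - 2 * c * ∫ x, f x * w x ∂μ + c ^ 2 * ∫ x, w x ∂μ := by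
  rw [← integral_sub_mul_add_mul hf2w hfw hw]
  exact integral_congr_ae (.of_forall fun x => by ring)

theorem brascampLieb_Icc {a b : ℝ} (hab : a ≤ b) {h h' ψ ψ' ψ'' q : ℝ → ℝ}
    (hh : ∀ t, HasDerivAt h (h' t) t) (hψ : ∀ t, HasDerivAt ψ (ψ' t) t)
    (hψ' : ∀ t, HasDerivAt ψ' (ψ'' t) t) (ch : Continuous h') (cψ : Continuous ψ'')
    (cq : Continuous q) (hq : ∀ t l : ℝ, 2 * l * h' t - l ^ 2 * ψ'' t ≤ q t) :
    (∫ t in Icc a b, Real.exp (-ψ t)) * (∫ t in Icc a b, h t ^ 2 * Real.exp (-ψ t))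
      - (∫ t in Icc a b, h t * Real.exp (-ψ t)) ^ 2 ≤
    (∫ t in Icc a b, q t * Real.exp (-ψ t)) * ∫ t in Icc a b, Real.exp (-ψ t) := by
  have ch0 : Continuous h := continuous_iff_continuousAt.2 fun t => (hh t).continuousAt
  have cψ0 : Continuous ψ := continuous_iff_continuousAt.2 fun t => (hψ t).continuousAt
  have q0 : ∀ t, 0 ≤ q t := fun t => by simpa using hq t 0
  have integ : ∀ g : ℝ → ℝ, Continuous g → Integrable g (volume.restrict (Icc a b)) :=
    fun g hg => hg.continuousOn.integrableOn_compact isCompact_Icc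
  obtain ⟨c, hc, hmin⟩ := isCompact_Icc.exists_isMinOn (nonempty_Icc.2 hab) cψ0.continuousOn
  have hsq : ∫ t in Icc a b, (h t - h c) ^ 2 * Real.exp (-ψ t) ≤
      ∫ t in Icc a b, q t * Real.exp (-ψ t) := by
    have hle := setLIntegral_Icc_sq_sub_mul_exp_neg_le hh hψ hψ' ch cψ cq hq hc hmin
    rwa [← ofReal_integral_eq_lintegral_ofReal (integ _ (by fun_prop))
        (.of_forall fun t => by positivity),
      ← ofReal_integral_eq_lintegral_ofReal (integ _ (by fun_prop))
        (.of_forall fun t => mul_nonneg (q0 t) (Real.exp_pos _).le),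
      ENNReal.ofReal_le_ofReal_iff
        (integral_nonneg fun t => mul_nonneg (q0 t) (Real.exp_pos _).le)] at hle
  rw [integral_sq_sub_mul_eq (integ _ (by fun_prop)) (integ _ (by fun_prop))
    (integ _ (by fun_prop))] at hsq
  have hZ : 0 ≤ ∫ t in Icc a b, Real.exp (-ψ t) := integral_nonneg fun t => (Real.exp_pos _).le
  nlinarith [mul_le_mul_of_nonneg_left hsq hZ,
    sq_nonneg ((∫ t in Icc a b, h t * Real.exp (-ψ t)) - h c * ∫ t in Icc a b, Real.exp (-ψ t))]

theorem measure_le_of_forall_Ioc_le {ν₁ ν₂ : Measure ℝ} {a : ℝ}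
    (h : ∀ b, a < b → ν₁ (Ioc a b) ≤ ν₂ (Ioc a b)) {L : Set ℝ} (hL : L ⊆ Ioi a)
    (hlow : ∀ x ∈ L, Ioc a x ⊆ L) : ν₁ L ≤ ν₂ L := by
  by_cases hmax : ∃ b, IsGreatest L b
  · obtain ⟨b, hb, hub⟩ := hmax
    have hLb : L = Ioc a b := Subset.antisymm (fun x hx => ⟨hL hx, hub hx⟩) (hlow b hb)
    rw [hLb]
    exact h b (hL hb)
  have hunion : L = ⋃ r ∈ {r : ℚ | (r : ℝ) ∈ L}, Ioc a (r : ℝ) := by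
    refine Subset.antisymm (fun x hx => ?_) (iUnion₂_subset fun r hr => hlow r hr)
    obtain ⟨y, hy, hxy⟩ : ∃ y ∈ L, x < y := by
      by_contra! hle
      exact hmax ⟨x, hx, hle⟩
    obtain ⟨r, hxr, hry⟩ := exists_rat_btwn hxy
    exact mem_biUnion (hlow y hy ⟨(hL hx).trans hxr, hry.le⟩) ⟨hL hx, hxr.le⟩
  have hdir : DirectedOn (Function.onFun (· ⊆ ·) fun r : ℚ => Ioc a (r : ℝ))
      {r : ℚ | (r : ℝ) ∈ L} := by
    intro r hr s hs
    rcases le_total r s with hrs | hsr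
    · exact ⟨s, hs, Ioc_subset_Ioc_right (by exact_mod_cast hrs), subset_rfl⟩
    · exact ⟨r, hr, subset_rfl, Ioc_subset_Ioc_right (by exact_mod_cast hsr)⟩
  rw [hunion, measure_biUnion_eq_iSup (to_countable _) hdir,
    measure_biUnion_eq_iSup (to_countable _) hdir]
  exact iSup₂_mono fun r hr => h r (hL hr)

theorem setLIntegral_Ioi_mul_le_of_antitoneOn {F₁ F₂ : ℝ → ℝ≥0∞} {r : ℝ → ℝ} {a : ℝ}
    (hF₁ : AEMeasurable F₁ (volume.restrict (Ioi a)))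
    (hF₂ : AEMeasurable F₂ (volume.restrict (Ioi a)))
    (hr : AntitoneOn r (Ioi a)) (hr0 : ∀ t, a < t → 0 ≤ r t)
    (h : ∀ b, a < b → ∫⁻ t in Ioc a b, F₁ t ≤ ∫⁻ t in Ioc a b, F₂ t) :
    ∫⁻ t in Ioi a, F₁ t * ENNReal.ofReal (r t) ≤ ∫⁻ t in Ioi a, F₂ t * ENNReal.ofReal (r t) := by
  have hrm : AEMeasurable r (volume.restrict (Ioi a)) :=
    aemeasurable_restrict_of_antitoneOn measurableSet_Ioi hr
  have layer : ∀ F : ℝ → ℝ≥0∞, AEMeasurable F (volume.restrict (Ioi a)) →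
      ∫⁻ t in Ioi a, F t * ENNReal.ofReal (r t) =
      ∫⁻ l in Ioi (0 : ℝ), ((volume.restrict (Ioi a)).withDensity F) ({t | l < r t} ∩ Ioi a) := by
    intro F hF
    have hac := withDensity_absolutelyContinuous (volume.restrict (Ioi a)) F
    have hmem : ∀ᵐ t ∂(volume.restrict (Ioi a)).withDensity F, t ∈ Ioi a :=
      hac.ae_le (ae_restrict_mem measurableSet_Ioi)
    have hcake := lintegral_eq_lintegral_meas_lt ((volume.restrict (Ioi a)).withDensity F)
      (f := r) (hmem.mono fun t ht => hr0 t ht) (hrm.mono_ac hac)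
    rw [lintegral_withDensity_eq_lintegral_mul₀ hF hrm.ennreal_ofReal] at hcake
    refine hcake.trans (lintegral_congr fun l => measure_congr ?_)
    filter_upwards [hmem] with t ht
    exact propext ⟨fun hl => ⟨hl, ht⟩, fun hl => hl.1⟩
  rw [layer F₁ hF₁, layer F₂ hF₂]
  refine lintegral_mono fun l => measure_le_of_forall_Ioc_le (fun b hb => ?_) inter_subset_right ?_
  · simpa only [withDensity_apply _ measurableSet_Ioc, Measure.restrict_restrict measurableSet_Ioc,
      inter_eq_left.mpr (Ioc_subset_Ioi_self : Ioc a b ⊆ Ioi a)] using h b hb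
  · rintro x ⟨hx, hxa⟩ y hy
    exact ⟨lt_of_lt_of_le hx (hr hy.1 hxa hy.2), hy.1⟩

theorem brascampLieb_Ioi_of_antitoneOn {h h' ψ ψ' ψ'' r : ℝ → ℝ} {a : ℝ}
    (h0 : Tendsto h (𝓝[>] a) (𝓝 0)) (hh : ∀ t ∈ Ioi a, HasDerivAt h (h' t) t)
    (hψ : ∀ t ∈ Ioi a, HasDerivAt ψ (ψ' t) t) (hψ' : ∀ t ∈ Ioi a, HasDerivAt ψ' (ψ'' t) t)
    (ch : ContinuousOn h' (Ioi a)) (cψ : ContinuousOn ψ'' (Ioi a))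
    (hmono : ∀ t ∈ Ioi a, 0 ≤ ψ' t) (hconv : ∀ t ∈ Ioi a, 0 < ψ'' t)
    (hr : AntitoneOn r (Ioi a)) (hr0 : ∀ t ∈ Ioi a, 0 ≤ r t) :
    ∫⁻ t in Ioi a, ENNReal.ofReal (h t ^ 2 * Real.exp (-ψ t)) * ENNReal.ofReal (r t) ≤
      ∫⁻ t in Ioi a,
        ENNReal.ofReal (h' t ^ 2 / ψ'' t * Real.exp (-ψ t)) * ENNReal.ofReal (r t) := by
  have cexp : ContinuousOn (fun t => Real.exp (-ψ t)) (Ioi a) :=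
    Real.continuous_exp.comp_continuousOn (HasDerivAt.continuousOn hψ).neg
  have cq : ContinuousOn (fun t => h' t ^ 2 / ψ'' t) (Ioi a) :=
    (ch.pow 2).div cψ fun t ht => (hconv t ht).ne'
  refine setLIntegral_Ioi_mul_le_of_antitoneOn
    ((((HasDerivAt.continuousOn hh).pow 2).mul cexp).aemeasurable measurableSet_Ioi).ennreal_ofReal
    ((cq.mul cexp).aemeasurable measurableSet_Ioi).ennreal_ofReal hr hr0 fun b _ => ?_
  have hsub : Ioc a b ⊆ Ioi a := Ioc_subset_Ioi_self
  refine brascampLieb_Ioc_of_tendsto_zero h0 (fun t ht => hh t (hsub ht))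
    (fun t ht => hψ t (hsub ht)) (fun t ht => hψ' t (hsub ht)) (ch.mono hsub) (cψ.mono hsub)
    (cq.mono hsub) (fun t ht => hmono t (hsub ht)) fun t ht l => ?_
  rw [le_div_iff₀ (hconv t (hsub ht))]
  nlinarith [sq_nonneg (h' t - l * ψ'' t)]

/-! ### Products, cubes and `ℝⁿ` -/

/-- The Brascamp–Lieb inequality for all the densities `e^{-W}`, `W ∈ C²`, with respect to `ν`, in
covariance form. The form `⟨(D²W)⁻¹ ∇f, ∇f⟩` is replaced by an arbitrary continuous majorant `q` of
`sup_u (2 ⟨∇f, u⟩ - ⟨D²W u, u⟩)`, whose existence forces `W` to be convex; in this form the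
inequality is stable under products. -/
def BrascampLiebFor {E : Type*} [NormedAddCommGroup E] [NormedSpace ℝ E] [MeasurableSpace E]
    (ν : Measure E) : Prop :=
  ∀ W f q : E → ℝ, ContDiff ℝ 2 W → ContDiff ℝ 1 f → Continuous q →
    (∀ x u, 2 * fderiv ℝ f x u - fderiv ℝ (fderiv ℝ W) x u u ≤ q x) →
    (∫ x, Real.exp (-W x) ∂ν) * (∫ x, f x ^ 2 * Real.exp (-W x) ∂ν)
      - (∫ x, f x * Real.exp (-W x) ∂ν) ^ 2 ≤
    (∫ x, q x * Real.exp (-W x) ∂ν) * ∫ x, Real.exp (-W x) ∂ν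

theorem fderiv_fderiv_apply {E F : Type*} [NormedAddCommGroup E] [NormedSpace ℝ E]
    [NormedAddCommGroup F] [NormedSpace ℝ F] {W : E → F} {x : E}
    (hW : DifferentiableAt ℝ (fderiv ℝ W) x) (u v : E) :
    fderiv ℝ (fun y => fderiv ℝ W y v) x u = fderiv ℝ (fderiv ℝ W) x u v := by
  rw [fderiv_clm_apply hW (differentiableAt_const v)]
  simp

section PartialDerivative

variable {E : Type*} [NormedAddCommGroup E] [NormedSpace ℝ E]

/-- The partial derivative of a function on `ℝ × E` in its first variable. -/
def fstDeriv (g : ℝ × E → ℝ) (z : ℝ × E) : ℝ := fderiv ℝ g z (1, 0)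

theorem contDiff_fstDeriv {g : ℝ × E → ℝ} (hg : ContDiff ℝ 2 g) : ContDiff ℝ 1 (fstDeriv g) :=
  (hg.fderiv_right (by norm_num)).clm_apply contDiff_const

theorem continuous_fstDeriv {g : ℝ × E → ℝ} (hg : ContDiff ℝ 1 g) : Continuous (fstDeriv g) :=
  (hg.continuous_fderiv (by norm_num)).clm_apply continuous_const

theorem hasDerivAt_fstDeriv {g : ℝ × E → ℝ} (hg : Differentiable ℝ g) (t : ℝ) (x : E) :
    HasDerivAt (fun s => g (s, x)) (fstDeriv g (t, x)) t :=
  (hg (t, x)).hasFDerivAt.comp_hasDerivAt t ((hasDerivAt_id t).prodMk (hasDerivAt_const t x))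

theorem fderiv_comp_prodMk {g : ℝ × E → ℝ} (hg : Differentiable ℝ g) (t : ℝ) (x u : E) :
    fderiv ℝ (fun y => g (t, y)) x u = fderiv ℝ g (t, x) (0, u) :=
  congr($(((hg (t, x)).hasFDerivAt.comp x (hasFDerivAt_prodMk_right t x)).fderiv) u)

theorem fderiv_fderiv_comp_prodMk {W : ℝ × E → ℝ} (hW : ContDiff ℝ 2 W) (t : ℝ) (x u v : E) :
    fderiv ℝ (fderiv ℝ fun y => W (t, y)) x u v =
      fderiv ℝ (fderiv ℝ W) (t, x) (0, u) (0, v) := by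
  have hW' : Differentiable ℝ (fderiv ℝ W) :=
    (hW.fderiv_right (m := 1) (by norm_num)).differentiable (by norm_num)
  have hslice : ContDiff ℝ 2 fun y => W (t, y) := hW.comp (by fun_prop)
  rw [← fderiv_fderiv_apply
      ((hslice.fderiv_right (m := 1) (by norm_num)).differentiable (by norm_num) x),
    ← fderiv_fderiv_apply (hW' _)]
  simp_rw [fderiv_comp_prodMk (hW.differentiable (by norm_num))]
  exact fderiv_comp_prodMk (hW'.clm_apply (differentiable_const _)) t x u

theorem fderiv_fderiv_add_smul {W : ℝ × E → ℝ} (hW : ContDiff ℝ 2 W) (z : ℝ × E) (l : ℝ) (u : E) :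
    fderiv ℝ (fderiv ℝ W) z (l, u) (l, u) = l ^ 2 * fstDeriv (fstDeriv W) z +
      2 * l * fderiv ℝ (fstDeriv W) z (0, u) + fderiv ℝ (fderiv ℝ W) z (0, u) (0, u) := by
  have hW' : DifferentiableAt ℝ (fderiv ℝ W) z :=
    (hW.fderiv_right (m := 1) (by norm_num)).differentiable (by norm_num) z
  have hfst : ∀ v, fderiv ℝ (fstDeriv W) z v = fderiv ℝ (fderiv ℝ W) z v (1, 0) := fun v =>
    fderiv_fderiv_apply hW' v _
  have hsymm : fderiv ℝ (fderiv ℝ W) z (1, 0) (0, u) = fderiv ℝ (fderiv ℝ W) z (0, u) (1, 0) :=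
    hW.contDiffAt.isSymmSndFDerivAt (by simp) (1, 0) (0, u)
  have hdecomp : ((l, u) : ℝ × E) = l • (1, 0) + (0, u) := by simp
  rw [hdecomp, show fstDeriv (fstDeriv W) z = _ from hfst _, hfst]
  simp only [map_add, map_smul, add_apply, smul_apply,
    smul_eq_mul, hsymm]
  ring

end PartialDerivative

section Marginal

variable {E : Type*} [NormedAddCommGroup E] [MeasurableSpace E]

/-- The marginal `t ↦ ∫ g(t, x) e^{-W(t, x)} dν(x)` of the weighted function `g e^{-W}`. -/
def marginal (ν : Measure E) (W g : ℝ × E → ℝ) (t : ℝ) : ℝ :=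
  ∫ x, g (t, x) * Real.exp (-W (t, x)) ∂ν

variable [BorelSpace E] {ν : Measure E} [IsFiniteMeasure ν] {K : Set E}

theorem integrable_of_continuous_of_compact (hK : IsCompact K) (hν : ν Kᶜ = 0) {g : E → ℝ}
    (hg : Continuous g) : Integrable g ν := by
  have := hg.continuousOn.integrableOn_compact (μ := ν) hK
  rwa [IntegrableOn, Measure.restrict_eq_self_of_ae_mem (mem_ae_iff.2 hν)] at this

theorem integrable_marginal (hK : IsCompact K) (hν : ν Kᶜ = 0) {W g : ℝ × E → ℝ}
    (hW : Continuous W) (hg : Continuous g) (t : ℝ) :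
    Integrable (fun x => g (t, x) * Real.exp (-W (t, x))) ν :=
  integrable_of_continuous_of_compact hK hν (by fun_prop)

theorem marginal_sub (hK : IsCompact K) (hν : ν Kᶜ = 0) {W f g : ℝ × E → ℝ} (hW : Continuous W)
    (hf : Continuous f) (hg : Continuous g) (t : ℝ) :
    marginal ν W (fun z => f z - g z) t = marginal ν W f t - marginal ν W g t := by
  simp only [marginal, sub_mul]
  exact integral_sub (integrable_marginal hK hν hW hf t) (integrable_marginal hK hν hW hg t)

theorem marginal_sub_mul_add_mul (hK : IsCompact K) (hν : ν Kᶜ = 0) {W f g h : ℝ × E → ℝ}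
    (hW : Continuous W) (hf : Continuous f) (hg : Continuous g) (hh : Continuous h)
    (t c d : ℝ) :
    marginal ν W (fun z => f z - c * g z + d * h z) t =
      marginal ν W f t - c * marginal ν W g t + d * marginal ν W h t := by
  simp only [marginal, add_mul, sub_mul, mul_assoc]
  exact integral_sub_mul_add_mul (integrable_marginal hK hν hW hf t)
    (integrable_marginal hK hν hW hg t) (integrable_marginal hK hν hW hh t) c d

theorem marginal_one_pos [NeZero ν] (hK : IsCompact K) (hν : ν Kᶜ = 0) {W : ℝ × E → ℝ}
    (hW : Continuous W) (t : ℝ) : 0 < marginal ν W (fun _ => 1) t := by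
  simpa only [marginal, one_mul] using
    integral_exp_pos (integrable_of_continuous_of_compact hK hν (by fun_prop))

theorem continuous_marginal (hK : IsCompact K) (hν : ν Kᶜ = 0) {W g : ℝ × E → ℝ}
    (hW : Continuous W) (hg : Continuous g) : Continuous (marginal ν W g) := by
  have := continuous_parametric_integral_of_continuous (μ := ν)
    (f := fun t x => g (t, x) * Real.exp (-W (t, x))) (by fun_prop) hK
  rwa [Measure.restrict_eq_self_of_ae_mem (mem_ae_iff.2 hν)] at this

theorem integral_prod_mul_exp_neg_eq_integral_marginal {μ : Measure ℝ} [IsFiniteMeasure μ]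
    {L : Set ℝ} (hL : IsCompact L) (hμ : μ Lᶜ = 0) (hK : IsCompact K) (hν : ν Kᶜ = 0)
    [SecondCountableTopology E] {W g : ℝ × E → ℝ} (hW : Continuous W) (hg : Continuous g) :
    ∫ z, g z * Real.exp (-W z) ∂(μ.prod ν) = ∫ t, marginal ν W g t ∂μ := by
  refine integral_prod _
    (integrable_of_continuous_of_compact (hL.prod hK) ?_ (by fun_prop))
  rw [Set.compl_prod_eq_union, measure_union_null_iff, Measure.prod_prod, Measure.prod_prod, hμ,
    hν, zero_mul, mul_zero, and_self]

end Marginal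

section Product

variable {E : Type*} [NormedAddCommGroup E] [NormedSpace ℝ E] [MeasurableSpace E]
  {ν : Measure E} {W f q : ℝ × E → ℝ}

theorem BrascampLiebFor.marginal_le (hBL : BrascampLiebFor ν) (hW : ContDiff ℝ 2 W)
    (hf : ContDiff ℝ 1 f) (hq : Continuous q)
    (hmaj : ∀ z u, 2 * fderiv ℝ f z u - fderiv ℝ (fderiv ℝ W) z u u ≤ q z) (t l : ℝ) :
    marginal ν W (fun _ => 1) t * marginal ν W (fun z => (f z - l * fstDeriv W z) ^ 2) t
      - marginal ν W (fun z => f z - l * fstDeriv W z) t ^ 2 ≤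
    marginal ν W (fun z => q z - 2 * l * fstDeriv f z + l ^ 2 * fstDeriv (fstDeriv W) z) t
      * marginal ν W (fun _ => 1) t := by
  have hg : ContDiff ℝ 1 fun z => f z - l * fstDeriv W z :=
    hf.sub (contDiff_const.mul (contDiff_fstDeriv hW))
  have cf' := continuous_fstDeriv hf
  have cW'' := continuous_fstDeriv (contDiff_fstDeriv hW)
  have hBL' := hBL (fun x => W (t, x)) (fun x => f (t, x) - l * fstDeriv W (t, x))
    (fun x => q (t, x) - 2 * l * fstDeriv f (t, x) + l ^ 2 * fstDeriv (fstDeriv W) (t, x))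
    (hW.comp (by fun_prop)) (hg.comp (by fun_prop)) (by fun_prop) fun x u => ?_
  · simpa only [marginal, one_mul] using hBL'
  have hmaj' := hmaj (t, x) (l, u)
  have hlu : fderiv ℝ f (t, x) (l, u) = l * fstDeriv f (t, x) + fderiv ℝ f (t, x) (0, u) := by
    rw [fstDeriv, ← smul_eq_mul, ← map_smul, ← map_add]
    simp
  rw [fderiv_fderiv_add_smul hW, hlu] at hmaj'
  rw [fderiv_comp_prodMk (hg.differentiable (by norm_num)), fderiv_fderiv_comp_prodMk hW,
    fderiv_fun_sub (hf.differentiable (by norm_num) _)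
      (((contDiff_fstDeriv hW).differentiable (by norm_num) _).const_mul l),
    fderiv_const_mul ((contDiff_fstDeriv hW).differentiable (by norm_num) _)]
  simp only [sub_apply, smul_apply, smul_eq_mul]
  linarith

variable [BorelSpace E] [IsFiniteMeasure ν] {K : Set E}

theorem hasDerivAt_marginal (hK : IsCompact K) (hν : ν Kᶜ = 0)
    (hW : ContDiff ℝ 1 W) (hf : ContDiff ℝ 1 f) (t : ℝ) :
    HasDerivAt (marginal ν W f)
      (marginal ν W (fun z => fstDeriv f z - f z * fstDeriv W z) t) t := by
  have cW : Continuous W := hW.continuous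
  have cf : Continuous f := hf.continuous
  have cdf : Continuous (fun z => fstDeriv f z - f z * fstDeriv W z) :=
    (continuous_fstDeriv hf).sub (cf.mul (continuous_fstDeriv hW))
  have hdiff : ∀ s x, HasDerivAt (fun s => f (s, x) * Real.exp (-W (s, x)))
      ((fstDeriv f (s, x) - f (s, x) * fstDeriv W (s, x)) * Real.exp (-W (s, x))) s := fun s x =>
    ((hasDerivAt_fstDeriv (hf.differentiable (by norm_num)) s x).mul
      (hasDerivAt_fstDeriv (hW.differentiable (by norm_num)) s x).fun_neg.exp).congr_deriv
      (by ring)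
  obtain ⟨M, hM⟩ := ((isCompact_Icc (a := t - 1) (b := t + 1)).prod hK).bddAbove_image
    (f := fun z => ‖(fstDeriv f z - f z * fstDeriv W z) * Real.exp (-W z)‖) (by fun_prop)
  refine (hasDerivAt_integral_of_dominated_loc_of_deriv_le (bound := fun _ => M)
    (Icc_mem_nhds (by linarith : t - 1 < t) (by linarith : t < t + 1))
    (.of_forall fun s => (integrable_marginal hK hν cW cf s).aestronglyMeasurable)
    (integrable_marginal hK hν cW cf t)
    (integrable_marginal hK hν cW cdf t).aestronglyMeasurable ?_ (integrable_const _)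
    (.of_forall fun x s _ => hdiff s x)).2
  filter_upwards [mem_ae_iff.2 hν] with x hx s hs
  exact hM (mem_image_of_mem _ (show (s, x) ∈ _ ×ˢ _ from ⟨hs, hx⟩))

theorem BrascampLiebFor.two_mul_marginal_sub_le (hK : IsCompact K) (hν : ν Kᶜ = 0)
    (hBL : BrascampLiebFor ν) (hW : ContDiff ℝ 2 W) (hf : ContDiff ℝ 1 f) (hq : Continuous q)
    (hmaj : ∀ z u, 2 * fderiv ℝ f z u - fderiv ℝ (fderiv ℝ W) z u u ≤ q z) (t l : ℝ) :
    2 * l * (marginal ν W (fun _ => 1) t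
          * marginal ν W (fun z => fstDeriv f z - f z * fstDeriv W z) t
        + marginal ν W f t * marginal ν W (fstDeriv W) t)
      - l ^ 2 * (marginal ν W (fun _ => 1) t
          * marginal ν W (fun z => fstDeriv (fstDeriv W) z - fstDeriv W z * fstDeriv W z) t
        + marginal ν W (fstDeriv W) t ^ 2) ≤
    marginal ν W (fun _ => 1) t * (marginal ν W q t - marginal ν W (fun z => f z ^ 2) t)
      + marginal ν W f t ^ 2 := by
  have cW : Continuous W := hW.continuous
  have cf : Continuous f := hf.continuous
  have cf' := continuous_fstDeriv hf
  have cW' := (contDiff_fstDeriv hW).continuous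
  have cW'' := continuous_fstDeriv (contDiff_fstDeriv hW)
  have hle := hBL.marginal_le hW hf hq hmaj t l
  have hsq : (fun z => (f z - l * fstDeriv W z) ^ 2) = fun z => f z ^ 2
      - 2 * l * (f z * fstDeriv W z) + l ^ 2 * (fstDeriv W z * fstDeriv W z) := by
    funext z; ring
  have hlin : (fun z => f z - l * fstDeriv W z) = fun z => f z - l * fstDeriv W z + 0 * 1 := by
    funext z; ring
  rw [hsq, hlin, marginal_sub_mul_add_mul hK hν cW (by fun_prop) (by fun_prop) (by fun_prop),
    marginal_sub_mul_add_mul hK hν cW cf cW' continuous_const,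
    marginal_sub_mul_add_mul hK hν cW hq cf' cW''] at hle
  rw [marginal_sub hK hν cW cf' (by fun_prop), marginal_sub hK hν cW cW'' (by fun_prop)]
  linarith

/-- The covariance inequality for the pair `(Z, F)` is the one-dimensional inequality for the
potential `-log Z` and the function `F / Z`. -/
theorem brascampLieb_Icc_div {a b : ℝ} (hab : a ≤ b) {Z M M' F F' G Q : ℝ → ℝ}
    (hZ : ∀ t, 0 < Z t) (dZ : ∀ t, HasDerivAt Z (-M t) t) (dM : ∀ t, HasDerivAt M (M' t) t)
    (dF : ∀ t, HasDerivAt F (F' t) t) (cM' : Continuous M') (cF' : Continuous F')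
    (cG : Continuous G) (cQ : Continuous Q)
    (hle : ∀ t l : ℝ, 2 * l * (Z t * F' t + F t * M t) - l ^ 2 * (Z t * M' t + M t ^ 2) ≤
      Z t * (Q t - G t) + F t ^ 2) :
    (∫ t in Icc a b, Z t) * (∫ t in Icc a b, G t) - (∫ t in Icc a b, F t) ^ 2 ≤
      (∫ t in Icc a b, Q t) * ∫ t in Icc a b, Z t := by
  have cZ : Continuous Z := continuous_iff_continuousAt.2 fun t => (dZ t).continuousAt
  have cM : Continuous M := continuous_iff_continuousAt.2 fun t => (dM t).continuousAt
  have cF : Continuous F := continuous_iff_continuousAt.2 fun t => (dF t).continuousAt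
  have hZ0 : ∀ t, Z t ≠ 0 := fun t => (hZ t).ne'
  have hZ2 : ∀ t, Z t ^ 2 ≠ 0 := fun t => pow_ne_zero 2 (hZ0 t)
  have hBL := brascampLieb_Icc hab (h := fun t => F t / Z t)
    (h' := fun t => (Z t * F' t + F t * M t) / Z t ^ 2) (ψ := fun t => -Real.log (Z t))
    (ψ' := fun t => M t / Z t) (ψ'' := fun t => (Z t * M' t + M t ^ 2) / Z t ^ 2)
    (q := fun t => (Z t * (Q t - G t) + F t ^ 2) / Z t ^ 2)
    (fun t => ((dF t).div (dZ t) (hZ0 t)).congr_deriv (by ring))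
    (fun t => ((dZ t).log (hZ0 t)).fun_neg.congr_deriv (by ring))
    (fun t => ((dM t).div (dZ t) (hZ0 t)).congr_deriv (by ring))
    (by fun_prop (disch := exact hZ2)) (by fun_prop (disch := exact hZ2))
    (by fun_prop (disch := exact hZ2)) fun t l => by
      rw [← mul_div_assoc, ← mul_div_assoc, ← sub_div]
      exact div_le_div_of_nonneg_right (hle t l) (sq_nonneg _)
  have hexp : ∀ t, Real.exp (- -Real.log (Z t)) = Z t := fun t => by
    rw [neg_neg, Real.exp_log (hZ t)]
  have hF2 : ∀ t, (F t / Z t) ^ 2 * Z t = F t ^ 2 / Z t := fun t => by field_simp [hZ0 t]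
  have hF1 : ∀ t, F t / Z t * Z t = F t := fun t => div_mul_cancel₀ _ (hZ0 t)
  have hQ : ∀ t, (Z t * (Q t - G t) + F t ^ 2) / Z t ^ 2 * Z t = Q t - G t + F t ^ 2 / Z t :=
    fun t => by field_simp [hZ0 t]
  simp only [hexp, hF2, hF1, hQ] at hBL
  have integ : ∀ g : ℝ → ℝ, Continuous g → Integrable g (volume.restrict (Icc a b)) :=
    fun g hg => hg.continuousOn.integrableOn_compact isCompact_Icc
  rw [integral_add (integ (fun t => Q t - G t) (cQ.sub cG))
      (integ (fun t => F t ^ 2 / Z t) ((cF.pow 2).div₀ cZ hZ0)),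
    integral_sub (integ _ cQ) (integ _ cG)] at hBL
  linarith

theorem BrascampLiebFor.prod [SecondCountableTopology E] (hK : IsCompact K) (hν : ν Kᶜ = 0)
    (hBL : BrascampLiebFor ν) {a b : ℝ} (hab : a ≤ b) :
    BrascampLiebFor (((volume : Measure ℝ).restrict (Icc a b)).prod ν) := by
  intro W f q hW hf hq hmaj
  rcases eq_or_ne ν 0 with rfl | hν0
  · simp
  have : NeZero ν := ⟨hν0⟩
  have hW1 : ContDiff ℝ 1 W := hW.of_le (by norm_num)
  have hW' : ContDiff ℝ 1 (fstDeriv W) := contDiff_fstDeriv hW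
  have cW : Continuous W := hW.continuous
  have cf : Continuous f := hf.continuous
  have cf' := continuous_fstDeriv hf
  have cW' := hW'.continuous
  have cW'' := continuous_fstDeriv hW'
  have hmain := brascampLieb_Icc_div hab (marginal_one_pos hK hν cW)
    (fun t => (hasDerivAt_marginal hK hν hW1 contDiff_const t).congr_deriv
      (show _ = -marginal ν W (fstDeriv W) t by
        simp [marginal, fstDeriv, integral_neg]))
    (hasDerivAt_marginal hK hν hW1 hW') (hasDerivAt_marginal hK hν hW1 hf)
    (continuous_marginal hK hν cW (by fun_prop)) (continuous_marginal hK hν cW (by fun_prop))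
    (continuous_marginal hK hν cW (g := fun z => f z ^ 2) (cf.pow 2))
    (continuous_marginal hK hν cW hq)
    (hBL.two_mul_marginal_sub_le hK hν hW hf hq hmaj)
  have hIcc : volume.restrict (Icc a b) (Icc a b)ᶜ = 0 := by
    rw [Measure.restrict_apply measurableSet_Icc.compl, compl_inter_self, measure_empty]
  have fubini : ∀ g : ℝ × E → ℝ, Continuous g → _ := fun g hg =>
    integral_prod_mul_exp_neg_eq_integral_marginal isCompact_Icc hIcc hK hν cW hg
  have fubini_one := fubini (fun _ => 1) continuous_const
  simp only [one_mul] at fubini_one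
  rwa [fubini_one, fubini (fun z => f z ^ 2) (cf.pow 2), fubini f cf, fubini q hq]

end Product

theorem fderiv_fderiv_comp_clm {E E' : Type*} [NormedAddCommGroup E] [NormedSpace ℝ E]
    [NormedAddCommGroup E'] [NormedSpace ℝ E'] {W : E' → ℝ} (hW : ContDiff ℝ 2 W)
    (L : E →L[ℝ] E') (x u v : E) :
    fderiv ℝ (fderiv ℝ fun x => W (L x)) x u v = fderiv ℝ (fderiv ℝ W) (L x) (L u) (L v) := by
  have hW' : ContDiff ℝ 1 (fderiv ℝ W) := hW.fderiv_right (by norm_num)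
  have hfst : ∀ y, fderiv ℝ (fun x => W (L x)) y = (fderiv ℝ W (L y)).comp L := fun y =>
    ((hW.differentiable (by norm_num) (L y)).hasFDerivAt.comp y L.hasFDerivAt).fderiv
  have hsnd := ((ContinuousLinearMap.compL ℝ E E' ℝ).flip L).hasFDerivAt.comp x
    ((hW'.differentiable (by norm_num) (L x)).hasFDerivAt.comp x L.hasFDerivAt)
  rw [funext hfst]
  exact congr($(hsnd.fderiv) u v)

theorem BrascampLiebFor.map {E E' : Type*} [NormedAddCommGroup E] [NormedSpace ℝ E]
    [MeasurableSpace E] [BorelSpace E] [NormedAddCommGroup E'] [NormedSpace ℝ E']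
    [MeasurableSpace E'] [BorelSpace E'] {ν : Measure E} {ν' : Measure E'}
    (hν : BrascampLiebFor ν) (L : E ≃L[ℝ] E') (hL : MeasurePreserving L ν ν') :
    BrascampLiebFor ν' := by
  intro W f q hW hf hq hmaj
  have hint : ∀ g : E' → ℝ, ∫ y, g y ∂ν' = ∫ x, g (L x) ∂ν := fun g =>
    (hL.integral_comp L.toHomeomorph.measurableEmbedding g).symm
  rw [hint, hint, hint, hint]
  refine hν (fun x => W (L x)) (fun x => f (L x)) (fun x => q (L x)) (hW.comp L.contDiff)
    (hf.comp L.contDiff) (hq.comp L.continuous) fun x u => ?_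
  have hf' : fderiv ℝ (fun x => f (L x)) x u = fderiv ℝ f (L x) (L u) :=
    congr($(((hf.differentiable (by norm_num) (L x)).hasFDerivAt.comp x
      L.hasFDerivAt).fderiv) u)
  have hW' := fderiv_fderiv_comp_clm hW (L : E →L[ℝ] E') x u u
  simp only [ContinuousLinearEquiv.coe_coe] at hW'
  rw [hW', hf']
  exact hmaj (L x) (L u)

/-- The closed cube `[-R, R]ⁿ`. -/
def cube (n : ℕ) (R : ℝ) : Set (Rn n) := {x | ∀ i, x i ∈ Icc (-R) R}

theorem preimage_toLp_cube (n : ℕ) (R : ℝ) :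
    WithLp.toLp 2 ⁻¹' cube n R = univ.pi fun _ => Icc (-R) R := by
  ext z
  simp only [cube, mem_preimage, mem_ofPred_eq, mem_univ_pi]

theorem isCompact_cube (n : ℕ) (R : ℝ) : IsCompact (cube n R) := by
  rw [← (EuclideanSpace.equiv (Fin n) ℝ).symm.toHomeomorph.isCompact_preimage]
  exact preimage_toLp_cube n R ▸ isCompact_univ_pi fun _ => isCompact_Icc

theorem measurableSet_cube (n : ℕ) (R : ℝ) : MeasurableSet (cube n R) :=
  (isCompact_cube n R).isClosed.measurableSet

theorem cube_mem_nhds_zero (n : ℕ) {R : ℝ} (hR : 0 < R) : cube n R ∈ 𝓝 (0 : Rn n) := by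
  refine eventually_all.2 fun i => ?_
  have hcont : ContinuousAt (fun x : Rn n => x i) 0 := by fun_prop
  exact hcont (Icc_mem_nhds (by simpa) (by simpa))

theorem measurePreserving_consEquivL (n : ℕ) :
    MeasurePreserving (Fin.consEquivL ℝ fun _ : Fin (n + 1) => ℝ)
      ((volume : Measure ℝ).prod (volume : Measure (Fin n → ℝ))) volume := by
  have hpres := (volume_preserving_piFinSuccAbove (fun _ : Fin (n + 1) => ℝ) 0).symm
  have heq : ((MeasurableEquiv.piFinSuccAbove (fun _ : Fin (n + 1) => ℝ) 0).symm : _ → _) =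
      (Fin.consEquivL ℝ fun _ : Fin (n + 1) => ℝ) := by
    funext z
    simp [MeasurableEquiv.piFinSuccAbove, Fin.insertNthEquiv, Fin.consEquivL,
      Fin.consLinearEquiv, Fin.consEquiv]
  rwa [heq] at hpres

theorem brascampLiebFor_of_unique {E : Type*} [NormedAddCommGroup E] [NormedSpace ℝ E]
    [MeasurableSpace E] [Unique E] (ν : Measure E) : BrascampLiebFor ν := by
  intro W f q _ _ _ hmaj
  have hq : 0 ≤ q default := by simpa using hmaj default 0
  simp only [integral_unique, smul_eq_mul]
  nlinarith [mul_nonneg (mul_nonneg (sq_nonneg (ν.real univ)) hq)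
    (sq_nonneg (Real.exp (-W default)))]

theorem brascampLiebFor_pi {R : ℝ} (hR : 0 ≤ R) (n : ℕ) :
    BrascampLiebFor ((volume : Measure (Fin n → ℝ)).restrict (univ.pi fun _ => Icc (-R) R)) := by
  induction n with
  | zero => exact brascampLiebFor_of_unique _
  | succ n ih =>
    set K : Set (Fin n → ℝ) := univ.pi fun _ => Icc (-R) R
    have hK : IsCompact K := isCompact_univ_pi fun _ => isCompact_Icc
    have : IsFiniteMeasure ((volume : Measure (Fin n → ℝ)).restrict K) :=
      isFiniteMeasure_restrict.2 hK.measure_ne_top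
    have hprod := ih.prod hK (by
      rw [Measure.restrict_apply hK.isClosed.measurableSet.compl, compl_inter_self, measure_empty])
      (neg_le_self hR)
    refine hprod.map (Fin.consEquivL ℝ fun _ : Fin (n + 1) => ℝ) ?_
    rw [Measure.prod_restrict]
    convert (measurePreserving_consEquivL n).restrict_preimage_emb
      (Fin.consEquivL ℝ fun _ : Fin (n + 1) => ℝ).toHomeomorph.measurableEmbedding
      (univ.pi fun _ => Icc (-R) R) using 2
    ext z
    simp only [K, mem_prod, mem_preimage, mem_univ_pi, Fin.forall_fin_succ]
    rfl

theorem brascampLiebFor_cube (n : ℕ) {R : ℝ} (hR : 0 ≤ R) :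
    BrascampLiebFor ((volume : Measure (Rn n)).restrict (cube n R)) := by
  refine (brascampLiebFor_pi hR n).map (EuclideanSpace.equiv (Fin n) ℝ).symm ?_
  rw [← preimage_toLp_cube]
  exact (PiLp.volume_preserving_toLp (Fin n)).restrict_preimage_emb
    (EuclideanSpace.equiv (Fin n) ℝ).symm.toHomeomorph.measurableEmbedding (cube n R)

theorem BrascampLiebFor.exists_lintegral_sq_sub_le {E : Type*} [NormedAddCommGroup E]
    [NormedSpace ℝ E] [MeasurableSpace E] [BorelSpace E] {ν : Measure E} [IsFiniteMeasure ν]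
    [NeZero ν] {K : Set E} (hK : IsCompact K) (hν : ν Kᶜ = 0) (hBL : BrascampLiebFor ν)
    {W f q : E → ℝ} (hW : ContDiff ℝ 2 W) (hf : ContDiff ℝ 1 f) (hq : Continuous q)
    (hmaj : ∀ x u, 2 * fderiv ℝ f x u - fderiv ℝ (fderiv ℝ W) x u u ≤ q x) :
    ∃ c : ℝ, ∫⁻ x, ENNReal.ofReal ((f x - c) ^ 2 * Real.exp (-W x)) ∂ν ≤
      ∫⁻ x, ENNReal.ofReal (q x * Real.exp (-W x)) ∂ν := by
  have cW : Continuous W := hW.continuous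
  have cf : Continuous f := hf.continuous
  have integ : ∀ u : E → ℝ, Continuous u → Integrable u ν := fun u hu =>
    integrable_of_continuous_of_compact hK hν hu
  have q0 : ∀ x, 0 ≤ q x := fun x => by simpa using hmaj x 0
  set Z := ∫ x, Real.exp (-W x) ∂ν
  set F := ∫ x, f x * Real.exp (-W x) ∂ν
  have hZ : 0 < Z := integral_exp_pos (integ _ (by fun_prop))
  refine ⟨F / Z, ?_⟩
  rw [← ofReal_integral_eq_lintegral_ofReal (integ _ (by fun_prop))
      (.of_forall fun x => by positivity),
    ← ofReal_integral_eq_lintegral_ofReal (integ _ (by fun_prop))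
      (.of_forall fun x => mul_nonneg (q0 x) (Real.exp_pos _).le)]
  refine ENNReal.ofReal_le_ofReal ?_
  calc ∫ x, (f x - F / Z) ^ 2 * Real.exp (-W x) ∂ν
      = (∫ x, f x ^ 2 * Real.exp (-W x) ∂ν) - 2 * (F / Z) * F + (F / Z) ^ 2 * Z :=
        integral_sq_sub_mul_eq (integ _ (by fun_prop)) (integ _ (by fun_prop))
          (integ _ (by fun_prop)) _
    _ = (Z * (∫ x, f x ^ 2 * Real.exp (-W x) ∂ν) - F ^ 2) / Z := by field_simp; ring
    _ ≤ ∫ x, q x * Real.exp (-W x) ∂ν := (div_le_iff₀ hZ).2 (hBL W f q hW hf hq hmaj)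

section Exhaustion

variable {α : Type*} [MeasurableSpace α] {ν : Measure α} {g : α → ℝ}

theorem ofReal_sq_mul_measure_le (hg : Measurable g) (S : Set α) (m : ℝ) :
    ENNReal.ofReal (m ^ 2) * ν S ≤ 2 * ∫⁻ x in S, ENNReal.ofReal ((g x - m) ^ 2) ∂ν +
      2 * ∫⁻ x in S, ENNReal.ofReal (g x ^ 2) ∂ν := by
  rw [← setLIntegral_const, ← mul_add, ← lintegral_add_left (by fun_prop),
    ← lintegral_const_mul _ (by fun_prop)]
  refine lintegral_mono fun x => ?_
  rw [show (2 : ℝ≥0∞) = ENNReal.ofReal 2 by simp,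
    ← ENNReal.ofReal_add (sq_nonneg _) (sq_nonneg _), ← ENNReal.ofReal_mul (by norm_num)]
  exact ENNReal.ofReal_le_ofReal (by nlinarith [sq_nonneg (2 * g x - m)])

theorem exists_lintegral_sq_sub_le_of_iUnion_eq_univ {S : ℕ → Set α} (hmono : Monotone S)
    (hS : ∀ k, MeasurableSet (S k)) (hSU : ⋃ k, S k = univ) (hS0 : ν (S 0) ≠ 0)
    (hg : Measurable g) (hg2 : ∫⁻ x in S 0, ENNReal.ofReal (g x ^ 2) ∂ν ≠ ∞) {C : ℝ≥0∞}
    (h : ∀ k, ∃ m : ℝ, ∫⁻ x in S k, ENNReal.ofReal ((g x - m) ^ 2) ∂ν ≤ C) :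
    ∃ c : ℝ, ∫⁻ x, ENNReal.ofReal ((g x - c) ^ 2) ∂ν ≤ C := by
  rcases eq_or_ne C ∞ with rfl | hC
  · exact ⟨0, le_top⟩
  choose m hm using h
  set B := (2 * C + 2 * ∫⁻ x in S 0, ENNReal.ofReal (g x ^ 2) ∂ν) / ν (S 0)
  have hB : 2 * C + 2 * ∫⁻ x in S 0, ENNReal.ofReal (g x ^ 2) ∂ν ≠ ∞ := by finiteness
  have hbdd : ∀ k, m k ∈ Metric.closedBall (0 : ℝ) (Real.sqrt B.toReal) := by
    intro k
    have hk : ENNReal.ofReal (m k ^ 2) ≤ B := by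
      refine (ENNReal.le_div_iff_mul_le (.inl hS0) (.inr hB)).2
        ((ofReal_sq_mul_measure_le hg (S 0) (m k)).trans ?_)
      gcongr
      exact (lintegral_mono_set (hmono (Nat.zero_le k))).trans (hm k)
    rw [mem_closedBall_zero_iff, Real.norm_eq_abs]
    exact Real.abs_le_sqrt
      ((ENNReal.ofReal_le_iff_le_toReal (ENNReal.div_ne_top hB hS0)).1 hk)
  obtain ⟨c, -, φ, hφ, hc⟩ := tendsto_subseq_of_bounded Metric.isBounded_closedBall hbdd
  refine ⟨c, ?_⟩
  set F : ℕ → α → ℝ≥0∞ := fun k => (S (φ k)).indicator fun x =>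
    ENNReal.ofReal ((g x - m (φ k)) ^ 2)
  have hlim : ∀ x, Tendsto (fun k => F k x) atTop (𝓝 (ENNReal.ofReal ((g x - c) ^ 2))) := by
    intro x
    obtain ⟨N, hN⟩ := mem_iUnion.1 (hSU ▸ mem_univ x)
    refine (ENNReal.tendsto_ofReal ((tendsto_const_nhds.sub hc).pow 2)).congr' ?_
    filter_upwards [eventually_ge_atTop N] with k hk
    exact (indicator_of_mem (hmono (hk.trans (hφ.id_le k)) hN)
      fun x => ENNReal.ofReal ((g x - m (φ k)) ^ 2)).symm
  calc ∫⁻ x, ENNReal.ofReal ((g x - c) ^ 2) ∂ν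
      = ∫⁻ x, liminf (fun k => F k x) atTop ∂ν :=
        lintegral_congr fun x => (hlim x).liminf_eq.symm
    _ ≤ liminf (fun k => ∫⁻ x, F k x ∂ν) atTop :=
        lintegral_liminf_le fun k => Measurable.indicator (by fun_prop) (hS _)
    _ ≤ C := by
        refine liminf_le_of_le (by isBoundedDefault) fun b hb => ?_
        obtain ⟨k, hk⟩ := hb.exists
        exact hk.trans ((lintegral_indicator (hS _) _).trans_le (hm _))

end Exhaustion

/-! ### Sign changes and quadratic forms -/

/-- The isometry of `ℝⁿ` that changes the signs of the coordinates marked by `s`. -/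
def flip {n : ℕ} (s : Fin n → Bool) : Rn n ≃ₗᵢ[ℝ] Rn n :=
  LinearIsometryEquiv.piLpCongrRight 2 fun i =>
    if s i then LinearIsometryEquiv.neg ℝ else LinearIsometryEquiv.refl ℝ ℝ

theorem flip_apply {n : ℕ} (s : Fin n → Bool) (x : Rn n) (i : Fin n) :
    flip s x i = if s i then -x i else x i := by
  simp only [flip, LinearIsometryEquiv.piLpCongrRight_apply]
  split_ifs <;> simp

theorem flip_flip {n : ℕ} (s : Fin n → Bool) (x : Rn n) : flip s (flip s x) = x := by
  ext i
  simp only [flip_apply]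
  split_ifs <;> simp

theorem IsUnconditional.apply_flip {n : ℕ} {f : Rn n → ℝ} (hf : IsUnconditional f)
    (s : Fin n → Bool) (x : Rn n) : f (flip s x) = f x := by
  rw [← hf (fun i => if s i then -1 else 1) (fun i => by split_ifs <;> simp) x]
  congr 1
  ext i
  simp only [flip_apply]
  split_ifs <;> simp

/-- The open orthant `{x | xᵢ > 0 for all i}`. -/
def posOrthant (n : ℕ) : Set (Rn n) := {x | ∀ i, 0 < x i}

theorem isOpen_posOrthant (n : ℕ) : IsOpen (posOrthant n) := by
  have : posOrthant n = ⋂ i, {x : Rn n | 0 < x i} := by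
    ext x
    simp [posOrthant]
  rw [this]
  exact isOpen_iInter_of_finite fun i => isOpen_lt continuous_const (by fun_prop)

theorem measurableSet_posOrthant (n : ℕ) : MeasurableSet (posOrthant n) :=
  (isOpen_posOrthant n).measurableSet

theorem ae_forall_coord_ne_zero (n : ℕ) : ∀ᵐ x : Rn n, ∀ i, x i ≠ 0 := by
  refine ae_all_iff.2 fun i => ?_
  have hker : LinearMap.ker (EuclideanSpace.proj i : Rn n →L[ℝ] ℝ).toLinearMap ≠ ⊤ := fun h => by
    have hmem : EuclideanSpace.single i (1 : ℝ) ∈ (⊤ : Submodule ℝ (Rn n)) := trivial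
    simp [← h] at hmem
  simp only [ae_iff, not_not]
  exact Measure.addHaar_submodule (volume : Measure (Rn n)) _ hker

theorem iUnion_preimage_flip_posOrthant_ae_eq_univ (n : ℕ) :
    (⋃ s : Fin n → Bool, flip s ⁻¹' posOrthant n) =ᵐ[volume] univ := by
  filter_upwards [ae_forall_coord_ne_zero n] with x hx
  refine propext ⟨fun _ => trivial, fun _ => ?_⟩
  refine mem_iUnion.2 ⟨fun i => decide (x i < 0), fun i => ?_⟩
  rw [flip_apply]
  rcases (hx i).lt_or_gt with hi | hi
  · simp [hi]
  · simpa [hi.not_gt] using hi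

theorem pairwise_disjoint_preimage_flip_posOrthant (n : ℕ) :
    Pairwise (Function.onFun Disjoint fun s : Fin n → Bool => flip s ⁻¹' posOrthant n) := by
  refine fun s t hst => Set.disjoint_left.2 fun x hx hx' => hst (funext fun i => ?_)
  have hsi := hx i
  have hti := hx' i
  rw [flip_apply] at hsi hti
  rcases hs : s i <;> rcases ht : t i <;> simp [hs, ht] at hsi hti ⊢ <;> linarith

theorem lintegral_eq_setLIntegral_posOrthant {n : ℕ} (g : Rn n → ℝ≥0∞)
    (hg : ∀ s x, g (flip s x) = g x) :
    ∫⁻ x, g x = 2 ^ n * ∫⁻ x in posOrthant n, g x := by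
  have horthant : ∀ s : Fin n → Bool, ∫⁻ x in flip s ⁻¹' posOrthant n, g x =
      ∫⁻ x in posOrthant n, g x := fun s => by
    rw [← (flip s).measurePreserving.setLIntegral_comp_preimage_emb
      (flip s).toHomeomorph.measurableEmbedding g (posOrthant n)]
    exact lintegral_congr fun x => (hg s x).symm
  rw [← setLIntegral_univ g, ← setLIntegral_congr (iUnion_preimage_flip_posOrthant_ae_eq_univ n),
    lintegral_iUnion (fun s => (flip s).continuous.measurable (measurableSet_posOrthant n))
      (pairwise_disjoint_preimage_flip_posOrthant n), tsum_fintype]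
  simp [horthant]

section Gradient

variable {F : Type*} [NormedAddCommGroup F] [InnerProductSpace ℝ F] [CompleteSpace F]

theorem contDiffAt_gradient {U : F → ℝ} {x : F} (hU : ContDiffAt ℝ 2 U x) :
    ContDiffAt ℝ 1 (gradient U) x :=
  (InnerProductSpace.toDual ℝ F).symm.contDiff.contDiffAt.comp x (hU.fderiv_right (by norm_num))

theorem continuous_gradient {f : F → ℝ} (hf : ContDiff ℝ 1 f) : Continuous (gradient f) :=
  (InnerProductSpace.toDual ℝ F).symm.continuous.comp (hf.continuous_fderiv (by norm_num))

theorem gradient_comp_isometry (L : F ≃ₗᵢ[ℝ] F) (f : F → ℝ) (x : F) :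
    gradient (fun y => f (L y)) x = L.symm (gradient f (L x)) := by
  refine ext_inner_right ℝ fun v => ?_
  rw [inner_gradient_left, ← L.inner_map_map, L.apply_symm_apply, inner_gradient_left]
  exact DFunLike.congr_fun (L.toContinuousLinearEquiv.comp_right_fderiv (f := f) (x := x)) v

end Gradient

theorem inner_hess {n : ℕ} {U : Rn n → ℝ} {x : Rn n} (hU : ContDiffAt ℝ 2 U x) (u v : Rn n) :
    ⟪hess U x u, v⟫ = fderiv ℝ (fderiv ℝ U) x u v := by
  have hfderiv : DifferentiableAt ℝ (fderiv ℝ U) x :=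
    (hU.fderiv_right (m := 1) (by norm_num)).differentiableAt (by norm_num)
  have hgrad : DifferentiableAt ℝ (gradient U) x :=
    (contDiffAt_gradient hU).differentiableAt (by norm_num)
  rw [← fderiv_fderiv_apply hfderiv,
    show (fun y => fderiv ℝ U y v) = fun y => ⟪gradient U y, v⟫ from
      funext fun y => inner_gradient_left.symm,
    fderiv_inner_apply ℝ hgrad (differentiableAt_const v)]
  simp [hess]

theorem inner_hess_comm {n : ℕ} {U : Rn n → ℝ} {x : Rn n} (hU : ContDiffAt ℝ 2 U x)
    (u v : Rn n) : ⟪hess U x u, v⟫ = ⟪hess U x v, u⟫ := by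
  rw [inner_hess hU, inner_hess hU]
  exact hU.isSymmSndFDerivAt (by simp) u v

theorem continuousAt_hess {n : ℕ} {U : Rn n → ℝ} {x : Rn n} (hU : ContDiffAt ℝ 2 U x) :
    ContinuousAt (hess U) x :=
  ((contDiffAt_gradient hU).fderiv_right (m := 0) (by norm_num)).continuousAt

theorem hess_comp_isometry {n : ℕ} (L : Rn n ≃ₗᵢ[ℝ] Rn n) {V : Rn n → ℝ}
    (hV : ∀ x, V (L x) = V x) (x u : Rn n) : hess V (L x) (L u) = L (hess V x u) := by
  have hgrad : gradient V = L.symm.toContinuousLinearEquiv ∘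
      (gradient V ∘ L.toContinuousLinearEquiv) := by
    funext y
    conv_lhs => rw [show V = fun y => V (L y) from funext fun y => (hV y).symm]
    exact gradient_comp_isometry L V y
  have hfderiv : fderiv ℝ (gradient V) x =
      (L.symm.toContinuousLinearEquiv : Rn n →L[ℝ] Rn n).comp
        ((fderiv ℝ (gradient V) (L x)).comp (L.toContinuousLinearEquiv : Rn n →L[ℝ] Rn n)) := by
    conv_lhs => rw [hgrad]
    rw [L.symm.toContinuousLinearEquiv.comp_fderiv, L.toContinuousLinearEquiv.comp_right_fderiv]
    rfl
  rw [hess, hess, hfderiv]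
  simp

theorem invForm_comp_isometry {n : ℕ} (L : Rn n ≃ₗᵢ[ℝ] Rn n) {V : Rn n → ℝ}
    (hV : ∀ x, V (L x) = V x) (f : Rn n → ℝ) (x : Rn n) :
    invForm (hess V (L x)) (gradient f (L x)) =
      invForm (hess V x) (gradient (fun y => f (L y)) x) := by
  rw [gradient_comp_isometry]
  apply le_antisymm
  · refine le_iInf₂ fun η hη => (iInf₂_le (L η) ?_).trans_eq ?_
    · rw [hess_comp_isometry L hV, hη, L.apply_symm_apply]
    · rw [← L.inner_map_map η, L.apply_symm_apply]
  · refine le_iInf₂ fun η hη => (iInf₂_le (L.symm η) ?_).trans_eq ?_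
    · apply L.injective
      rw [← hess_comp_isometry L hV, L.apply_symm_apply, L.apply_symm_apply, hη]
    · rw [L.symm.inner_map_map]

section IsPosDef

variable {F : Type*} [NormedAddCommGroup F] [InnerProductSpace ℝ F]

/-- Positive definiteness of an operator that is not assumed to be symmetric. -/
def IsPosDef (A : F →L[ℝ] F) : Prop := ∀ u, u ≠ 0 → 0 < ⟪A u, u⟫

theorem IsPosDef.inner_nonneg {A : F →L[ℝ] F} (hA : IsPosDef A) (u : F) : 0 ≤ ⟪A u, u⟫ := by
  rcases eq_or_ne u 0 with rfl | hu
  · simp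
  · exact (hA u hu).le

variable [FiniteDimensional ℝ F]

theorem IsPosDef.exists_equiv {A : F →L[ℝ] F} (hA : IsPosDef A) :
    ∃ e : F ≃L[ℝ] F, (e : F →L[ℝ] F) = A := by
  have hinj : Function.Injective A.toLinearMap := by
    rw [← LinearMap.ker_eq_bot, LinearMap.ker_eq_bot']
    intro u hu
    by_contra hne
    have hpos := hA u hne
    rw [show A u = 0 from hu, inner_zero_left] at hpos
    exact hpos.false
  refine ⟨(LinearEquiv.ofInjectiveEndo A.toLinearMap hinj).toContinuousLinearEquiv, ?_⟩
  ext u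
  simp

theorem IsPosDef.apply_inverse {A : F →L[ℝ] F} (hA : IsPosDef A) (ξ : F) :
    A (A.inverse ξ) = ξ := by
  obtain ⟨e, rfl⟩ := hA.exists_equiv
  simp

theorem IsPosDef.inverse {A : F →L[ℝ] F} (hA : IsPosDef A) : IsPosDef A.inverse := by
  intro ξ hξ
  have hne : A.inverse ξ ≠ 0 := fun h => hξ <| by rw [← hA.apply_inverse ξ, h, map_zero]
  have hpos := hA _ hne
  rwa [hA.apply_inverse, real_inner_comm] at hpos

theorem IsPosDef.continuousAt_inverse {X : Type*} [TopologicalSpace X] {A : X → F →L[ℝ] F}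
    {x : X} (hA : IsPosDef (A x)) (hc : ContinuousAt A x) :
    ContinuousAt (fun y => (A y).inverse) x := by
  obtain ⟨e, he⟩ := hA.exists_equiv
  have hinv := (contDiffAt_map_inverse (𝕜 := ℝ) (n := 0) e).continuousAt
  rw [he] at hinv
  exact hinv.comp hc

theorem IsPosDef.two_mul_inner_sub_le {A : F →L[ℝ] F} (hA : IsPosDef A)
    (hsymm : ∀ u v, ⟪A u, v⟫ = ⟪A v, u⟫) (ξ u : F) :
    2 * ⟪ξ, u⟫ - ⟪A u, u⟫ ≤ ⟪A.inverse ξ, ξ⟫ := by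
  have hsq := hA.inner_nonneg (A.inverse ξ - u)
  rw [map_sub, inner_sub_left, inner_sub_right, inner_sub_right, hsymm u, hA.apply_inverse] at hsq
  linarith [real_inner_comm ξ (A.inverse ξ)]

end IsPosDef

theorem IsPosDef.invForm_eq {n : ℕ} {A : Rn n →L[ℝ] Rn n} (hA : IsPosDef A) (ξ : Rn n) :
    invForm A ξ = ENNReal.ofReal ⟪A.inverse ξ, ξ⟫ := by
  obtain ⟨e, rfl⟩ := hA.exists_equiv
  rw [invForm_of_equiv, ContinuousLinearMap.inverse_equiv]
  rfl

theorem evariance_le_lintegral_sq_sub {α : Type*} [MeasurableSpace α] {μ : Measure α}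
    [IsProbabilityMeasure μ] {f : α → ℝ} (hf : AEStronglyMeasurable f μ) (c : ℝ) :
    evariance f μ ≤ ∫⁻ x, ENNReal.ofReal ((f x - c) ^ 2) ∂μ := by
  have hfc : AEStronglyMeasurable (fun x => f x - c) μ := hf.sub aestronglyMeasurable_const
  by_cases h : MemLp (fun x => f x - c) 2 μ
  · have hf2 : MemLp f 2 μ := by simpa [Pi.add_def] using h.add (memLp_const c)
    rw [← ofReal_variance hf2, ← variance_sub_const hf c,
      ← ofReal_integral_eq_lintegral_ofReal h.integrable_sq (.of_forall fun x => sq_nonneg _)]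
    exact ENNReal.ofReal_le_ofReal (variance_le_expectation_sq hfc)
  · refine le_top.trans_eq (Eq.symm ?_)
    by_contra htop
    refine h ((memLp_two_iff_integrable_sq hfc).2 ⟨hfc.pow 2, ?_⟩)
    rw [hasFiniteIntegral_iff_ofReal (.of_forall fun x => sq_nonneg _)]
    exact lt_top_iff_ne_top.2 htop

theorem iUnion_cube_eq_univ (n : ℕ) : ⋃ k : ℕ, cube n (k + 1) = univ := by
  refine eq_univ_of_forall fun x => ?_
  obtain ⟨k, hk⟩ := exists_nat_gt ‖x‖
  refine mem_iUnion.2 ⟨k, fun i => abs_le.1 ?_⟩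
  have hi : |x i| ≤ ‖x‖ := PiLp.norm_apply_le x i
  linarith

theorem cube_subset_cube (n : ℕ) {R R' : ℝ} (h : R ≤ R') : cube n R ⊆ cube n R' := fun _ hx i =>
  Icc_subset_Icc (neg_le_neg h) h (hx i)

theorem exists_setLIntegral_cube_sq_sub_mul_exp_neg_le {n : ℕ} {W f : Rn n → ℝ}
    (hW : ContDiff ℝ 2 W) (hf : ContDiff ℝ 1 f) (hpos : ∀ x, IsPosDef (hess W x)) {R : ℝ}
    (hR : 0 < R) :
    ∃ c : ℝ, ∫⁻ x in cube n R, ENNReal.ofReal ((f x - c) ^ 2 * Real.exp (-W x)) ≤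
      ∫⁻ x, ENNReal.ofReal (Real.exp (-W x)) * invForm (hess W x) (gradient f x) := by
  have cgrad : Continuous (gradient f) := continuous_gradient hf
  have cinv : Continuous fun x => (hess W x).inverse := continuous_iff_continuousAt.2 fun x =>
    (hpos x).continuousAt_inverse (continuousAt_hess hW.contDiffAt)
  have hmaj : ∀ x u, 2 * fderiv ℝ f x u - fderiv ℝ (fderiv ℝ W) x u u ≤
      ⟪(hess W x).inverse (gradient f x), gradient f x⟫ := fun x u => by
    rw [← inner_hess hW.contDiffAt, ← inner_gradient_left]
    exact (hpos x).two_mul_inner_sub_le (inner_hess_comm hW.contDiffAt) _ u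
  have : IsFiniteMeasure ((volume : Measure (Rn n)).restrict (cube n R)) :=
    isFiniteMeasure_restrict.2 (isCompact_cube n R).measure_ne_top
  have : NeZero ((volume : Measure (Rn n)).restrict (cube n R)) := ⟨fun h =>
    (Measure.measure_pos_of_mem_nhds volume (cube_mem_nhds_zero n hR)).ne'
      (Measure.restrict_eq_zero.1 h)⟩
  obtain ⟨c, hc⟩ := (brascampLiebFor_cube n hR.le).exists_lintegral_sq_sub_le
    (isCompact_cube n R)
    (by rw [Measure.restrict_apply (measurableSet_cube n R).compl, compl_inter_self, measure_empty])
    hW hf ((cinv.clm_apply cgrad).inner cgrad) hmaj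
  refine ⟨c, hc.trans ((setLIntegral_le_lintegral _ _).trans_eq (lintegral_congr fun x => ?_))⟩
  rw [(hpos x).invForm_eq, mul_comm, ENNReal.ofReal_mul (Real.exp_pos _).le]

/-- The variance is written with an arbitrary constant in place of the mean, so that nothing has to
be integrable. -/
theorem exists_lintegral_sq_sub_mul_exp_neg_le {n : ℕ} {W f : Rn n → ℝ} (hW : ContDiff ℝ 2 W)
    (hf : ContDiff ℝ 1 f) (hpos : ∀ x, IsPosDef (hess W x)) :
    ∃ c : ℝ, ∫⁻ x, ENNReal.ofReal (Real.exp (-W x)) * ENNReal.ofReal ((f x - c) ^ 2) ≤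
      ∫⁻ x, ENNReal.ofReal (Real.exp (-W x)) * invForm (hess W x) (gradient f x) := by
  have cf : Continuous f := hf.continuous
  have cW : Continuous W := hW.continuous
  set ν : Measure (Rn n) := volume.withDensity fun x => ENNReal.ofReal (Real.exp (-W x)) with hν
  have hvol : (volume : Measure (Rn n)) ≪ ν := withDensity_absolutelyContinuous' (by fun_prop)
    (.of_forall fun x => (ENNReal.ofReal_pos.2 (Real.exp_pos _)).ne')
  have setLIntegral_ν : ∀ (g : Rn n → ℝ) (R : ℝ), Continuous g →
      ∫⁻ x in cube n R, ENNReal.ofReal (g x) ∂ν =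
        ∫⁻ x in cube n R, ENNReal.ofReal (g x * Real.exp (-W x)) := fun g R hg => by
    rw [hν, setLIntegral_withDensity_eq_setLIntegral_mul _ (by fun_prop) (by fun_prop)
      (measurableSet_cube n R)]
    exact lintegral_congr fun x => by
      rw [Pi.mul_apply, ← ENNReal.ofReal_mul (Real.exp_pos _).le, mul_comm]
  have lintegral_ν : ∀ c : ℝ, ∫⁻ x, ENNReal.ofReal ((f x - c) ^ 2) ∂ν =
      ∫⁻ x, ENNReal.ofReal (Real.exp (-W x)) * ENNReal.ofReal ((f x - c) ^ 2) := fun c =>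
    lintegral_withDensity_eq_lintegral_mul _ (by fun_prop) (by fun_prop)
  simp_rw [← lintegral_ν]
  refine exists_lintegral_sq_sub_le_of_iUnion_eq_univ (S := fun k => cube n (k + 1))
    (fun k l hkl => cube_subset_cube n (by gcongr)) (fun k => measurableSet_cube n _)
    (iUnion_cube_eq_univ n) (fun h => ?_) cf.measurable ?_ fun k => ?_
  · exact (Measure.measure_pos_of_mem_nhds volume (cube_mem_nhds_zero n (by positivity))).ne'
      (hvol h)
  · rw [setLIntegral_ν _ _ (by fun_prop)]
    exact (Continuous.continuousOn (by fun_prop)).integrableOn_compact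
      (isCompact_cube n _) |>.lintegral_lt_top.ne
  · obtain ⟨c, hc⟩ := exists_setLIntegral_cube_sq_sub_mul_exp_neg_le hW hf hpos
      (R := k + 1) (by positivity)
    exact ⟨c, by rwa [setLIntegral_ν (fun x => (f x - c) ^ 2) _ (by fun_prop)]⟩

/-! ### Homogeneous potentials -/

section LineRestriction

variable {F : Type*} [NormedAddCommGroup F] [InnerProductSpace ℝ F] {U : F → ℝ} {x y : F}

theorem hasDerivAt_add_smul (x v : F) (s : ℝ) : HasDerivAt (fun s : ℝ => x + s • v) v s := by
  simpa using ((hasDerivAt_id s).smul_const v).const_add x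

theorem convexOn_comp_add_smul {S : Set F} (hU : ConvexOn ℝ S U) (x v : F) :
    ConvexOn ℝ ((fun s : ℝ => x + s • v) ⁻¹' S) fun s => U (x + s • v) := by
  have hline : ⇑(AffineMap.lineMap x (x + v) : ℝ →ᵃ[ℝ] F) = fun s => x + s • v := by
    funext s
    simp [AffineMap.lineMap_apply, add_comm]
  simpa only [hline, Function.comp_def] using hU.comp_affineMap (AffineMap.lineMap x (x + v))

theorem nonneg_of_convexOn_of_hasDerivAt {S : Set ℝ} {t c : ℝ} {g g' : ℝ → ℝ}
    (hg : ConvexOn ℝ S g) (hS : S ∈ 𝓝 t) (hg' : ∀ᶠ s in 𝓝 t, HasDerivAt g (g' s) s)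
    (hc : HasDerivAt g' c t) : 0 ≤ c := by
  obtain ⟨ε, hε, hball⟩ := Metric.mem_nhds_iff.1 (inter_mem hS hg')
  have hmono : MonotoneOn g' (Metric.ball t ε) := by
    have hderiv := (hg.subset (fun s hs => (hball hs).1) (convex_ball t ε)).monotoneOn_deriv
      fun s hs => (hball hs).2.differentiableAt
    exact hderiv.congr fun s hs => (hball hs).2.deriv
  exact hc.hasDerivWithinAt.nonneg_of_monotoneOn
    (Metric.isOpen_ball.uniqueDiffWithinAt (𝕜 := ℝ) (Metric.mem_ball_self hε)).accPt hmono

variable [CompleteSpace F]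

theorem hasDerivAt_comp_add_smul {v : F} {s : ℝ} (hU : DifferentiableAt ℝ U (x + s • v)) :
    HasDerivAt (fun s : ℝ => U (x + s • v)) ⟪gradient U (x + s • v), v⟫ s := by
  rw [inner_gradient_left]
  exact hU.hasFDerivAt.comp_hasDerivAt s (hasDerivAt_add_smul x v s)

theorem add_inner_gradient_le_of_convexOn (hU : ConvexOn ℝ univ U) (hx : DifferentiableAt ℝ U x)
    (y : F) : U x + ⟪gradient U x, y - x⟫ ≤ U y := by
  have hderiv := hasDerivAt_comp_add_smul (x := x) (v := y - x) (s := 0) (by simpa using hx)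
  have hslope := (convexOn_comp_add_smul hU x (y - x)).le_slope_of_hasDerivAt (mem_univ 0)
    (mem_univ 1) one_pos hderiv
  rw [slope_def_field, zero_smul, one_smul, add_zero, add_sub_cancel] at hslope
  linarith

theorem add_inner_gradient_lt_of_strictConvexOn (hU : StrictConvexOn ℝ univ U)
    (hx : DifferentiableAt ℝ U x) (hxy : x ≠ y) : U x + ⟪gradient U x, y - x⟫ < U y := by
  have hmid := hU.2 (mem_univ x) (mem_univ y) hxy one_half_pos one_half_pos (add_halves 1)
  have htangent := add_inner_gradient_le_of_convexOn hU.convexOn hx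
    ((1 / 2 : ℝ) • x + (1 / 2 : ℝ) • y)
  rw [show (1 / 2 : ℝ) • x + (1 / 2 : ℝ) • y - x = (1 / 2 : ℝ) • (y - x) by module,
    inner_smul_right] at htangent
  simp only [smul_eq_mul] at hmid
  linarith

end LineRestriction

section Hessian

variable {n : ℕ} {U : Rn n → ℝ} {x : Rn n}

theorem hasDerivAt_gradient_comp_add_smul {v : Rn n} {s : ℝ}
    (hU : ContDiffAt ℝ 2 U (x + s • v)) :
    HasDerivAt (fun s : ℝ => gradient U (x + s • v)) (hess U (x + s • v) v) s := by
  have hgrad := ((contDiffAt_gradient hU).differentiableAt one_ne_zero).hasFDerivAt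
  exact hgrad.comp_hasDerivAt s (hasDerivAt_add_smul x v s)

theorem inner_hess_nonneg_of_convexOn (hconv : ConvexOn ℝ univ U) (hU : ContDiffAt ℝ 2 U x)
    (v : Rn n) : 0 ≤ ⟪hess U x v, v⟫ := by
  have hline : Tendsto (fun s : ℝ => x + s • v) (𝓝 0) (𝓝 x) := by
    simpa using (hasDerivAt_add_smul x v 0).continuousAt.tendsto
  have hfirst : ∀ᶠ s in 𝓝 (0 : ℝ),
      HasDerivAt (fun s : ℝ => U (x + s • v)) ⟪gradient U (x + s • v), v⟫ s :=
    (hline.eventually (hU.eventually (by simp))).mono fun s hs =>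
      hasDerivAt_comp_add_smul (hs.differentiableAt two_ne_zero)
  have hsecond := (hasDerivAt_gradient_comp_add_smul (x := x) (v := v) (s := 0)
    (by simpa using hU)).inner ℝ (hasDerivAt_const (0 : ℝ) v)
  refine nonneg_of_convexOn_of_hasDerivAt (convexOn_comp_add_smul hconv x v) univ_mem hfirst ?_
  simpa using hsecond

theorem IsHomogeneousOfDegree.inner_gradient_self {p : ℝ} (hU : IsHomogeneousOfDegree p U)
    (hx : DifferentiableAt ℝ U x) : ⟪gradient U x, x⟫ = p * U x := by
  have hray : HasDerivAt (fun s : ℝ => U (x + s • x)) ⟪gradient U (x + (0 : ℝ) • x), x⟫ 0 :=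
    hasDerivAt_comp_add_smul (by simpa using hx)
  have hpow : HasDerivAt (fun s : ℝ => (1 + s) ^ p * U x) (p * U x) 0 := by
    simpa using (((hasDerivAt_id (0 : ℝ)).const_add 1).rpow_const (p := p)
      (Or.inl (by norm_num))).mul_const (U x)
  have heq : (fun s : ℝ => U (x + s • x)) =ᶠ[𝓝 0] fun s : ℝ => (1 + s) ^ p * U x := by
    filter_upwards [lt_mem_nhds neg_one_lt_zero] with s hs
    rw [← hU (1 + s) (by linarith) x, add_smul, one_smul]
  simpa using hray.unique (hpow.congr_of_eventuallyEq heq)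

theorem IsUnconditional.gradient_flip (hU : IsUnconditional U) (s : Fin n → Bool) (x : Rn n) :
    gradient U (flip s x) = flip s (gradient U x) := by
  have hcomp := gradient_comp_isometry (flip s) U x
  rw [funext fun y => hU.apply_flip s y] at hcomp
  rw [hcomp, LinearIsometryEquiv.apply_symm_apply]

theorem IsUnconditional.gradient_apply_eq_zero (hU : IsUnconditional U) {i : Fin n}
    (hi : x i = 0) : gradient U x i = 0 := by
  have hfix : flip (fun j => decide (j = i)) x = x := by
    ext j
    by_cases h : j = i <;> simp [flip_apply, h, hi]
  have hgrad := congrArg (fun z : Rn n => z i) (hU.gradient_flip (fun j => decide (j = i)) x)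
  simp only [hfix, flip_apply, decide_true, if_true] at hgrad
  linarith

theorem IsUnconditional.mul_gradient_apply_pos (hU : IsUnconditional U)
    (hconv : StrictConvexOn ℝ univ U) (hx : DifferentiableAt ℝ U x) {i : Fin n} (hi : x i ≠ 0) :
    0 < x i * gradient U x i := by
  set y := flip (fun j => decide (j = i)) x with hy
  have hyx : y - x = (-2 * x i) • EuclideanSpace.single i (1 : ℝ) := by
    ext j
    rcases eq_or_ne j i with rfl | h
    · simp [hy, flip_apply]
      ring
    · simp [hy, flip_apply, h]
  have hne : x ≠ y := by
    rintro h
    have hzero := congrArg (fun z : Rn n => z i) hyx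
    simp [← h, hi] at hzero
  have hlt := add_inner_gradient_lt_of_strictConvexOn hconv hx hne
  rw [hU.apply_flip, hyx, inner_smul_right, EuclideanSpace.inner_single_right] at hlt
  simp only [one_mul, conj_trivial] at hlt
  linarith

end Hessian

theorem lintegral_gibbs {n : ℕ} {V : Rn n → ℝ} (hV : Measurable V) (g : Rn n → ℝ≥0∞) :
    ∫⁻ x, g x ∂(gibbs V) = (∫⁻ x : Rn n, ENNReal.ofReal (Real.exp (-V x)))⁻¹ *
      ∫⁻ x, ENNReal.ofReal (Real.exp (-V x)) * g x := by
  rw [gibbs, lintegral_smul_measure, lintegral_withDensity_eq_lintegral_mul_non_measurable _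
    (by fun_prop) (Eventually.of_forall fun x => ENNReal.ofReal_lt_top)]
  rfl

/-- A strictly convex `p`-homogeneous potential with `p > 1`, of class `C²` away from the
origin. -/
structure IsHomogeneousPotential {n : ℕ} (p : ℝ) (V : Rn n → ℝ) : Prop where
  one_lt : 1 < p
  strictConvexOn : StrictConvexOn ℝ univ V
  homogeneous : IsHomogeneousOfDegree p V
  contDiffOn : ContDiffOn ℝ 2 V {0}ᶜ

namespace IsHomogeneousPotential

variable {n : ℕ} {p : ℝ} {V : Rn n → ℝ} (hV : IsHomogeneousPotential p V)

include hV

theorem map_zero : V 0 = 0 := by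
  have hscale := hV.homogeneous 2 two_pos 0
  rw [smul_zero] at hscale
  have htwo : (1 : ℝ) < 2 ^ p := Real.one_lt_rpow one_lt_two (by linarith [hV.one_lt])
  nlinarith

theorem pos {x : Rn n} (hx : x ≠ 0) : 0 < V x := by
  have hmid := hV.strictConvexOn.2 (mem_univ x) (mem_univ 0) hx one_half_pos one_half_pos
    (add_halves 1)
  rw [smul_zero, add_zero, hV.homogeneous _ one_half_pos, hV.map_zero, smul_zero, add_zero,
    smul_eq_mul] at hmid
  have hhalf : (1 / 2 : ℝ) ^ p < 1 / 2 := by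
    simpa using Real.rpow_lt_rpow_of_exponent_gt (x := 1 / 2) (by norm_num) (by norm_num)
      hV.one_lt
  nlinarith

theorem continuous : Continuous V := by
  simpa [continuousOn_univ] using hV.strictConvexOn.convexOn.continuousOn_interior

theorem contDiffAt {x : Rn n} (hx : x ≠ 0) : ContDiffAt ℝ 2 V x :=
  hV.contDiffOn.contDiffAt (isOpen_compl_singleton.mem_nhds hx)

theorem differentiableAt {x : Rn n} (hx : x ≠ 0) : DifferentiableAt ℝ V x :=
  (hV.contDiffAt hx).differentiableAt two_ne_zero

theorem inner_hess_nonneg {x : Rn n} (hx : x ≠ 0) (v : Rn n) : 0 ≤ ⟪hess V x v, v⟫ :=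
  inner_hess_nonneg_of_convexOn hV.strictConvexOn.convexOn (hV.contDiffAt hx) v

theorem exists_mul_norm_rpow_le : ∃ m : ℝ, 0 < m ∧ ∀ x, m * ‖x‖ ^ p ≤ V x := by
  have hp : p ≠ 0 := by linarith [hV.one_lt]
  rcases subsingleton_or_nontrivial (Rn n) with hn | hn
  · refine ⟨1, one_pos, fun x => ?_⟩
    rw [Subsingleton.elim x 0, norm_zero, Real.zero_rpow hp, hV.map_zero, mul_zero]
  obtain ⟨y, hy, hmin⟩ := (isCompact_sphere (0 : Rn n) 1).exists_isMinOn
    (NormedSpace.sphere_nonempty.2 zero_le_one) hV.continuous.continuousOn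
  refine ⟨V y, hV.pos (ne_zero_of_mem_unit_sphere (⟨y, hy⟩ : Metric.sphere (0 : Rn n) 1)),
    fun x => ?_⟩
  rcases eq_or_ne x 0 with rfl | hx
  · rw [norm_zero, Real.zero_rpow hp, hV.map_zero, mul_zero]
  have hx' : 0 < ‖x‖ := norm_pos_iff.2 hx
  have hsphere : (‖x‖⁻¹ • x) ∈ Metric.sphere (0 : Rn n) 1 := by
    simp [norm_smul, norm_ne_zero_iff.2 hx]
  calc V y * ‖x‖ ^ p ≤ V (‖x‖⁻¹ • x) * ‖x‖ ^ p := by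
        gcongr
        exact hmin hsphere
    _ = V x := by
        rw [mul_comm, ← hV.homogeneous _ hx', smul_inv_smul₀ hx'.ne']

theorem lintegral_exp_neg_lt_top : ∫⁻ x, ENNReal.ofReal (Real.exp (-V x)) < ∞ := by
  obtain ⟨m, hm, hgrowth⟩ := hV.exists_mul_norm_rpow_le
  have hint : Integrable fun x : Rn n => Real.exp (-m * ‖x‖ ^ p) := by
    rcases subsingleton_or_nontrivial (Rn n) with hn | hn
    · exact Integrable.of_finite
    refine (integrable_fun_norm_addHaar volume (f := fun r => Real.exp (-m * r ^ p))).2 ?_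
    refine (integrableOn_rpow_mul_exp_neg_mul_rpow (p := p)
      (s := (Module.finrank ℝ (Rn n) - 1 : ℕ))
      (by linarith [Nat.cast_nonneg (α := ℝ) (Module.finrank ℝ (Rn n) - 1)])
      (by linarith [hV.one_lt]) hm).congr_fun (fun r _ => ?_) measurableSet_Ioi
    simp only [Real.rpow_natCast, smul_eq_mul]
  refine (lintegral_mono fun x => ENNReal.ofReal_le_ofReal (Real.exp_le_exp.2 ?_)).trans_lt
    hint.lintegral_lt_top
  linarith [hgrowth x]

theorem lintegral_exp_neg_ne_zero : ∫⁻ x, ENNReal.ofReal (Real.exp (-V x)) ≠ 0 := by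
  have hcont := hV.continuous
  have hsupport : (Function.support fun x => ENNReal.ofReal (Real.exp (-V x))) = univ :=
    eq_univ_of_forall fun x => by simp [Real.exp_pos]
  rw [← pos_iff_ne_zero, lintegral_pos_iff_support (by fun_prop), hsupport]
  exact isOpen_univ.measure_pos volume univ_nonempty

theorem isProbabilityMeasure_gibbs : IsProbabilityMeasure (gibbs V) := by
  constructor
  rw [← lintegral_one, lintegral_gibbs hV.continuous.measurable]
  simp only [mul_one]
  exact ENNReal.inv_mul_cancel hV.lintegral_exp_neg_ne_zero hV.lintegral_exp_neg_lt_top.ne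

end IsHomogeneousPotential

/-! ### Unconditional functions -/

section Curves

variable {n : ℕ} {V : Rn n → ℝ} {p : ℝ} {x : Rn n}

theorem hasDerivAt_toLp {c : Fin n → ℝ → ℝ} {c' : Fin n → ℝ} {s : ℝ}
    (h : ∀ i, HasDerivAt (c i) (c' i) s) :
    HasDerivAt (fun s => (WithLp.toLp 2 fun i => c i s : Rn n)) (WithLp.toLp 2 c') s :=
  ((EuclideanSpace.equiv (Fin n) ℝ).symm : (Fin n → ℝ) →L[ℝ] Rn n).hasFDerivAt.comp_hasDerivAt
    s (hasDerivAt_pi.2 h : HasDerivAt (fun s i => c i s) c' s)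

theorem inner_eq_sum (x y : Rn n) : ⟪x, y⟫ = ∑ i, x i * y i := by
  rw [PiLp.inner_apply]
  exact Finset.sum_congr rfl fun i _ => by simp [mul_comm]

theorem hasDerivAt_comp_curve {c : ℝ → Rn n} {c' : Rn n} {s : ℝ}
    (hV : DifferentiableAt ℝ V (c s)) (hc : HasDerivAt c c' s) :
    HasDerivAt (fun s => V (c s)) ⟪gradient V (c s), c'⟫ s := by
  rw [inner_gradient_left]
  exact hV.hasFDerivAt.comp_hasDerivAt s hc

theorem hasDerivAt_inner_gradient_comp_curve {c c' : ℝ → Rn n} {c'' : Rn n} {s : ℝ}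
    (hV : ContDiffAt ℝ 2 V (c s)) (hc : HasDerivAt c (c' s) s) (hc' : HasDerivAt c' c'' s) :
    HasDerivAt (fun s => ⟪gradient V (c s), c' s⟫)
      (⟪hess V (c s) (c' s), c' s⟫ + ⟪gradient V (c s), c''⟫) s := by
  have hgrad := ((contDiffAt_gradient hV).differentiableAt one_ne_zero).hasFDerivAt
  rw [add_comm]
  exact (hgrad.comp_hasDerivAt s hc).inner ℝ hc'

theorem hasDerivAt_mul_rpow_one_add {a b v q s : ℝ} (hs : 0 < 1 + s * b) (hv : a * b * q = v) :
    HasDerivAt (fun s => a * (1 + s * b) ^ q) (v * (1 + s * b) ^ (q - 1)) s := by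
  have hlin : HasDerivAt (fun s : ℝ => 1 + s * b) b s := by
    simpa using ((hasDerivAt_id s).mul_const b).const_add 1
  refine ((hlin.rpow_const (p := q) (.inl hs.ne')).const_mul a).congr_deriv ?_
  rw [← hv]
  ring

/-- The curve through `x` with velocity `v` whose coordinatewise `p`-th power is affine. -/
def powCurve (p : ℝ) (x v : Rn n) (s : ℝ) : Rn n :=
  WithLp.toLp 2 fun i => x i * (1 + s * (p * v i / x i)) ^ (1 / p)

/-- The set of parameters for which `powCurve` stays in the open orthant. -/
def powCurveDomain (p : ℝ) (x v : Rn n) : Set ℝ := {s | ∀ i, 0 < 1 + s * (p * v i / x i)}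

theorem powCurveDomain_mem_nhds (p : ℝ) (x v : Rn n) : powCurveDomain p x v ∈ 𝓝 0 := by
  refine eventually_all.2 fun i => ?_
  have hcont : Continuous fun s : ℝ => 1 + s * (p * v i / x i) := by fun_prop
  exact hcont.continuousAt.eventually (lt_mem_nhds (by simp))

theorem powCurve_zero (p : ℝ) (x v : Rn n) : powCurve p x v 0 = x := by
  ext i
  simp [powCurve]

theorem powCurve_eq_coordPow (hp : p ≠ 0) (hx : x ∈ posOrthant n) {v : Rn n} {s : ℝ}
    (hs : s ∈ powCurveDomain p x v) :
    powCurve p x v s = coordPow (1 / p)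
      (coordPow p x + s • WithLp.toLp 2 fun i => x i ^ p * (p * v i / x i)) := by
  ext i
  have hxi := hx i
  have hfactor : x i ^ p + s * (x i ^ p * (p * v i / x i)) =
      x i ^ p * (1 + s * (p * v i / x i)) := by ring
  simp only [powCurve, coordPow, PiLp.add_apply, PiLp.smul_apply, smul_eq_mul]
  rw [hfactor, Real.mul_rpow (by positivity) (hs i).le, ← Real.rpow_mul hxi.le,
    mul_one_div_cancel hp, Real.rpow_one]

theorem convexOn_neg_comp_powCurve (hp : p ≠ 0)
    (hV : ConcaveOn ℝ (orthant n) fun x => V (coordPow (1 / p) x)) (hx : x ∈ posOrthant n)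
    (v : Rn n) : ConvexOn ℝ (powCurveDomain p x v) fun s => -V (powCurve p x v s) := by
  have hconv : Convex ℝ (powCurveDomain p x v) := by
    refine fun s hs t ht a b ha hb hab i => ?_
    have hcomb : 1 + (a • s + b • t) * (p * v i / x i) =
        a • (1 + s * (p * v i / x i)) + b • (1 + t * (p * v i / x i)) := by
      obtain rfl : b = 1 - a := by linarith
      simp only [smul_eq_mul]
      ring
    rw [hcomb]
    exact convex_Ioi (0 : ℝ) (Set.mem_Ioi.2 (hs i)) (Set.mem_Ioi.2 (ht i)) ha hb hab
  have hline := convexOn_comp_add_smul hV.neg (coordPow p x)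
    (WithLp.toLp 2 fun i => x i ^ p * (p * v i / x i))
  refine (hline.subset (fun s hs i => ?_) hconv).congr fun s hs => ?_
  · have hxi := hx i
    have hsi := hs i
    have hfactor : x i ^ p + s * (x i ^ p * (p * v i / x i)) =
      x i ^ p * (1 + s * (p * v i / x i)) := by ring
    simp only [coordPow, PiLp.add_apply, PiLp.smul_apply, smul_eq_mul, hfactor]
    positivity
  · simp only [Pi.neg_apply, powCurve_eq_coordPow hp hx hs]

/-- `V` is concave along `powCurve`, whose acceleration at `x` is `(1 - p) vᵢ² / xᵢ`. -/
theorem inner_hess_le_of_concaveOn (hp : p ≠ 0)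
    (hconc : ConcaveOn ℝ (orthant n) fun x => V (coordPow (1 / p) x)) (hx : x ∈ posOrthant n)
    (hV : ContDiffAt ℝ 2 V x) (v : Rn n) :
    ⟪hess V x v, v⟫ ≤ (p - 1) * ∑ i, gradient V x i * v i ^ 2 / x i := by
  set c' : ℝ → Rn n := fun s =>
    WithLp.toLp 2 fun i => v i * (1 + s * (p * v i / x i)) ^ (1 / p - 1) with hc'
  have hcurve : ∀ s ∈ powCurveDomain p x v, HasDerivAt (powCurve p x v) (c' s) s :=
    fun s hs => hasDerivAt_toLp fun i =>
      hasDerivAt_mul_rpow_one_add (hs i) (by have := (hx i).ne'; field_simp)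
  have hdom := powCurveDomain_mem_nhds p x v
  have haccel : HasDerivAt c' (WithLp.toLp 2 fun i => (1 - p) * v i ^ 2 / x i) 0 := by
    refine hasDerivAt_toLp fun i => ?_
    have hxi := (hx i).ne'
    simpa using hasDerivAt_mul_rpow_one_add (s := 0) (a := v i) (b := p * v i / x i)
      (q := 1 / p - 1) (v := (1 - p) * v i ^ 2 / x i) (by simp) (by field_simp)
  have hc'0 : c' 0 = v := by
    ext i
    simp [hc']
  have hcurve0 := hcurve 0 (mem_of_mem_nhds hdom)
  have hlim : Tendsto (powCurve p x v) (𝓝 0) (𝓝 x) := by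
    simpa only [powCurve_zero] using hcurve0.continuousAt.tendsto
  have hfirst : ∀ᶠ s in 𝓝 0, HasDerivAt (fun s => -V (powCurve p x v s))
      (-⟪gradient V (powCurve p x v s), c' s⟫) s := by
    filter_upwards [hdom, hlim.eventually (hV.eventually (by simp))] with s hs hVs
    exact (hasDerivAt_comp_curve (hVs.differentiableAt two_ne_zero) (hcurve s hs)).neg
  have hsecond := (hasDerivAt_inner_gradient_comp_curve (by rwa [powCurve_zero]) hcurve0
    haccel).neg
  have hnonneg := nonneg_of_convexOn_of_hasDerivAt (convexOn_neg_comp_powCurve hp hconc hx v)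
    hdom hfirst hsecond
  rw [powCurve_zero, hc'0, inner_eq_sum (gradient V x)] at hnonneg
  have hsum : ∑ i, gradient V x i * ((1 - p) * v i ^ 2 / x i) =
      -((p - 1) * ∑ i, gradient V x i * v i ^ 2 / x i) := by
    rw [Finset.mul_sum, ← Finset.sum_neg_distrib]
    exact Finset.sum_congr rfl fun i _ => by ring
  linarith

end Curves

section LogCoordinates

variable {n : ℕ}

/-- The linear map multiplying the coordinates by those of `a`. -/
def diagL (a : Rn n) : Rn n →L[ℝ] Rn n :=
  LinearMap.toContinuousLinearMap
    { toFun := fun u => WithLp.toLp 2 fun i => a i * u i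
      map_add' := fun u v => by ext i; simp [mul_add]
      map_smul' := fun c u => by ext i; simp; ring }

@[simp]
theorem diagL_apply (a u : Rn n) (i : Fin n) : diagL a u i = a i * u i := rfl

theorem det_diagL (a : Rn n) : (diagL a).det = ∏ i, a i := by
  rw [ContinuousLinearMap.det,
    ← LinearMap.det_toMatrix (EuclideanSpace.basisFun (Fin n) ℝ).toBasis,
    show LinearMap.toMatrix (EuclideanSpace.basisFun (Fin n) ℝ).toBasis
      (EuclideanSpace.basisFun (Fin n) ℝ).toBasis (diagL a).toLinearMap =
      Matrix.diagonal fun i => a i from ?_, Matrix.det_diagonal]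
  ext i j
  rw [LinearMap.toMatrix_apply]
  by_cases h : i = j <;> simp [h]

/-- The map `t ↦ (e^{t₁}, …, e^{tₙ})`, which parametrizes the open orthant. -/
def expMap (t : Rn n) : Rn n := WithLp.toLp 2 fun i => Real.exp (t i)

@[simp]
theorem expMap_apply (t : Rn n) (i : Fin n) : expMap t i = Real.exp (t i) := rfl

theorem contDiff_expMap {k : WithTop ℕ∞} : ContDiff ℝ k (expMap (n := n)) :=
  contDiff_euclidean.2 fun i => by simp only [expMap_apply]; fun_prop

theorem hasFDerivAt_expMap (t : Rn n) : HasFDerivAt expMap (diagL (expMap t)) t := by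
  rw [← hasFDerivWithinAt_univ, hasFDerivWithinAt_euclidean]
  intro i
  rw [hasFDerivWithinAt_univ]
  refine ((EuclideanSpace.proj i : Rn n →L[ℝ] ℝ).hasFDerivAt.exp).congr_fderiv ?_
  ext u
  simp

theorem injective_expMap : Function.Injective (expMap (n := n)) := by
  intro s t h
  ext i
  simpa using congrArg (fun x : Rn n => x i) h

theorem expMap_mem_posOrthant (t : Rn n) : expMap t ∈ posOrthant n := fun i => Real.exp_pos (t i)

theorem range_expMap : range (expMap (n := n)) = posOrthant n := by
  refine Subset.antisymm (range_subset_iff.2 expMap_mem_posOrthant) fun x hx => ?_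
  refine ⟨WithLp.toLp 2 fun i => Real.log (x i), ?_⟩
  ext i
  simp [Real.exp_log (hx i)]

theorem setLIntegral_posOrthant (g : Rn n → ℝ≥0∞) :
    ∫⁻ x in posOrthant n, g x =
      ∫⁻ t, ENNReal.ofReal (Real.exp (∑ i, t i)) * g (expMap t) := by
  have hchange := lintegral_image_eq_lintegral_abs_det_fderiv_mul (volume : Measure (Rn n))
    MeasurableSet.univ (fun t _ => (hasFDerivAt_expMap t).hasFDerivWithinAt)
    injective_expMap.injOn g
  rw [image_univ, range_expMap, Measure.restrict_univ] at hchange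
  rw [hchange]
  refine lintegral_congr fun t => ?_
  simp only [det_diagL, expMap_apply, Real.exp_sum,
    abs_of_pos (Finset.prod_pos fun i _ => Real.exp_pos (t i))]

variable {V : Rn n → ℝ}

/-- The potential `t ↦ V (e^t) - ∑ tᵢ` of the measure `e^{-V(x)} dx` on the open orthant in the
coordinates `x = e^t`. -/
def logPotential (V : Rn n → ℝ) (t : Rn n) : ℝ := V (expMap t) - ∑ i, t i

theorem contDiff_logPotential (hV : ∀ x ∈ posOrthant n, ContDiffAt ℝ 2 V x) :
    ContDiff ℝ 2 (logPotential V) := by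
  refine ContDiff.sub (contDiff_iff_contDiffAt.2 fun t => ?_) (by fun_prop)
  exact (hV _ (expMap_mem_posOrthant t)).comp t contDiff_expMap.contDiffAt

theorem inner_hess_logPotential (hV : ∀ x ∈ posOrthant n, ContDiffAt ℝ 2 V x) (t u : Rn n) :
    ⟪hess (logPotential V) t u, u⟫ =
      ⟪hess V (expMap t) (diagL (expMap t) u), diagL (expMap t) u⟫ +
        ∑ i, gradient V (expMap t) i * diagL (expMap t) u i ^ 2 / expMap t i := by
  have hW : ContDiff ℝ 2 (logPotential V) := contDiff_logPotential hV
  have hVt : ∀ t, ContDiffAt ℝ 2 V (expMap t) := fun t => hV _ (expMap_mem_posOrthant t)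
  set c : ℝ → Rn n := fun s => expMap (t + s • u) with hc
  have hvelocity : ∀ s, HasDerivAt c (diagL (c s) u) s := fun s =>
    (hasFDerivAt_expMap _).comp_hasDerivAt s (hasDerivAt_add_smul t u s)
  have hcoord : ∀ s i, HasDerivAt (fun s : ℝ => t i + s * u i) (u i) s := fun s i => by
    simpa using hasDerivAt_add_smul (t i) (u i) s
  have haccel : HasDerivAt (fun s => diagL (c s) u)
      (WithLp.toLp 2 fun i => Real.exp (t i) * u i * u i) 0 :=
    hasDerivAt_toLp fun i => by simpa [hc] using (hcoord 0 i).exp.mul_const (u i)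
  have hfirst : (fun s : ℝ => ⟪gradient (logPotential V) (t + s • u), u⟫) =
      fun s => ⟪gradient V (c s), diagL (c s) u⟫ - ∑ i, u i := by
    funext s
    refine (hasDerivAt_comp_add_smul (hW.differentiable two_ne_zero _)).unique ?_
    exact (hasDerivAt_comp_curve ((hVt _).differentiableAt two_ne_zero) (hvelocity s)).sub
      (HasDerivAt.fun_sum fun i _ => hcoord s i)
  have hsecond := hasDerivAt_inner_gradient_comp_curve (c := fun s => t + s • u)
    (c' := fun _ => u) hW.contDiffAt (hasDerivAt_add_smul t u 0) (hasDerivAt_const 0 u)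
  have hsecond' := (hasDerivAt_inner_gradient_comp_curve (c := c) (hVt _) (hvelocity 0)
    haccel).sub_const (∑ i, u i)
  rw [← hfirst] at hsecond'
  have huniq := hsecond.unique hsecond'
  simp only [hc, zero_smul, add_zero, inner_zero_right] at huniq
  rw [huniq, inner_eq_sum (gradient V (expMap t))]
  congr 1
  refine Finset.sum_congr rfl fun i _ => ?_
  simp only [diagL_apply, expMap_apply]
  field_simp

theorem lintegral_exp_neg_mul_eq_logPotential (hV : IsUnconditional V) {g : Rn n → ℝ≥0∞}
    (hg : ∀ s x, g (flip s x) = g x) :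
    ∫⁻ x, ENNReal.ofReal (Real.exp (-V x)) * g x =
      2 ^ n * ∫⁻ t, ENNReal.ofReal (Real.exp (-logPotential V t)) * g (expMap t) := by
  rw [lintegral_eq_setLIntegral_posOrthant _ fun s x => by rw [hV.apply_flip, hg],
    setLIntegral_posOrthant]
  congr 1
  refine lintegral_congr fun t => ?_
  rw [← mul_assoc, ← ENNReal.ofReal_mul (Real.exp_pos _).le, ← Real.exp_add, logPotential]
  ring_nf

end LogCoordinates

section Unconditional

variable {n : ℕ} {V f : Rn n → ℝ} {p : ℝ}

theorem gradient_comp {g : Rn n → Rn n} {g' : Rn n →L[ℝ] Rn n} {t : Rn n}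
    (hf : DifferentiableAt ℝ f (g t)) (hg : HasFDerivAt g g' t) :
    gradient (f ∘ g) t = g'.adjoint (gradient f (g t)) := by
  refine ext_inner_right ℝ fun u => ?_
  rw [ContinuousLinearMap.adjoint_inner_left, inner_gradient_left, inner_gradient_left,
    (hf.hasFDerivAt.comp t hg).fderiv]
  rfl

theorem IsPosDef.invForm_adjoint_le {A B L : Rn n →L[ℝ] Rn n} {κ : ℝ} (hκ : 0 < κ)
    (hA : ∀ u, 0 ≤ ⟪A u, u⟫) (hsymm : ∀ u v, ⟪A u, v⟫ = ⟪A v, u⟫) (hB : IsPosDef B)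
    (hAB : ∀ u, ⟪A (L u), L u⟫ ≤ κ * ⟪B u, u⟫) (ξ : Rn n) :
    invForm B (L.adjoint ξ) ≤ ENNReal.ofReal κ * invForm A ξ := by
  rw [hB.invForm_eq, mul_comm, ← ENNReal.div_le_iff_le_mul (.inl (ENNReal.ofReal_pos.2 hκ).ne')
    (.inl ENNReal.ofReal_ne_top), ← ENNReal.ofReal_div_of_pos hκ]
  refine le_iInf₂ fun η hη => ENNReal.ofReal_le_ofReal ?_
  set u := B.inverse (L.adjoint ξ)
  have huB : B u = L.adjoint ξ := hB.apply_inverse _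
  have hbound := hAB u
  have hsq := hA (η - κ⁻¹ • L u)
  have hcross : ⟪A (L u), η⟫ = ⟪ξ, L u⟫ := by rw [hsymm, hη]
  rw [huB, ContinuousLinearMap.adjoint_inner_left] at hbound
  simp only [map_sub, map_smul, hη, inner_sub_left, inner_sub_right, inner_smul_left,
    inner_smul_right, hcross, conj_trivial] at hsq
  rw [real_inner_comm, ContinuousLinearMap.adjoint_inner_left, div_eq_inv_mul,
    real_inner_comm ξ η]
  have hscaled : κ⁻¹ * (κ⁻¹ * ⟪A (L u), L u⟫) ≤ κ⁻¹ * ⟪ξ, L u⟫ := by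
    refine mul_le_mul_of_nonneg_left ?_ (inv_pos.2 hκ).le
    rwa [inv_mul_le_iff₀ hκ]
  linarith

/-- The variance bound with constant `κ`, before normalization of the measure `e^{-V} dx`; by
minimality of the mean, any constant `c` may replace the mean of `f`. -/
def VarianceBound (κ : ℝ) (V f : Rn n → ℝ) : Prop :=
  ∃ c : ℝ, ∫⁻ x, ENNReal.ofReal (Real.exp (-V x)) * ENNReal.ofReal ((f x - c) ^ 2) ≤
    ENNReal.ofReal κ *
      ∫⁻ x, ENNReal.ofReal (Real.exp (-V x)) * invForm (hess V x) (gradient f x)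

namespace IsHomogeneousPotential

variable (hV : IsHomogeneousPotential p V)

include hV

theorem strongBrascampLieb (hf : Continuous f) (h : VarianceBound (1 - 1 / p) V f) :
    StrongBrascampLieb p V f := by
  obtain ⟨c, hc⟩ := h
  have := hV.isProbabilityMeasure_gibbs
  refine (evariance_le_lintegral_sq_sub hf.aestronglyMeasurable c).trans ?_
  rw [lintegral_gibbs hV.continuous.measurable, lintegral_gibbs hV.continuous.measurable,
    mul_left_comm]
  gcongr

theorem contDiffAt_of_mem_posOrthant {x : Rn n} (hx : x ∈ posOrthant n) :
    ContDiffAt ℝ 2 V x := by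
  rcases isEmpty_or_nonempty (Fin n) with hn | ⟨⟨i⟩⟩
  · rw [show V = fun _ => V 0 from funext fun y => congrArg V (Subsingleton.elim y 0)]
    exact contDiffAt_const
  · exact hV.contDiffAt fun h => (hx i).ne' (by rw [h]; rfl)

variable (hu : IsUnconditional V)

include hu

theorem gradient_mem_posOrthant {x : Rn n} (hx : x ∈ posOrthant n) :
    gradient V x ∈ posOrthant n := fun i =>
  pos_of_mul_pos_right (hu.mul_gradient_apply_pos hV.strictConvexOn
    ((hV.contDiffAt_of_mem_posOrthant hx).differentiableAt two_ne_zero) (hx i).ne') (hx i).le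

theorem isPosDef_hess_logPotential (t : Rn n) : IsPosDef (hess (logPotential V) t) := by
  intro u hne
  have hmem := expMap_mem_posOrthant t
  have hVt := hV.contDiffAt_of_mem_posOrthant hmem
  obtain ⟨i, hi⟩ : ∃ i, u i ≠ 0 := by
    by_contra! h
    exact hne (by ext i; simpa using h i)
  have hgrad : ∀ j, 0 < gradient V (expMap t) j := hV.gradient_mem_posOrthant hu hmem
  rw [inner_hess_logPotential fun x hx => hV.contDiffAt_of_mem_posOrthant hx]
  refine add_pos_of_nonneg_of_pos
    (inner_hess_nonneg_of_convexOn hV.strictConvexOn.convexOn hVt _)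
    (Finset.sum_pos' (fun j _ => ?_) ⟨i, Finset.mem_univ _, ?_⟩)
  · have := hgrad j
    have := hmem j
    positivity
  · have := hgrad i
    rw [diagL_apply]
    have := hmem i
    positivity

variable (hconc : ConcaveOn ℝ (orthant n) fun x => V (coordPow (1 / p) x))

include hconc

theorem invForm_hess_logPotential_le (hf : Differentiable ℝ f) (t : Rn n) :
    invForm (hess (logPotential V) t) (gradient (f ∘ expMap) t) ≤
      ENNReal.ofReal (1 - 1 / p) * invForm (hess V (expMap t)) (gradient f (expMap t)) := by
  have hp : 0 < p := by linarith [hV.one_lt]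
  have hκ : 0 < 1 - 1 / p := by
    rw [sub_pos, div_lt_one hp]
    exact hV.one_lt
  have hmem := expMap_mem_posOrthant t
  have hVt := hV.contDiffAt_of_mem_posOrthant hmem
  rw [gradient_comp (hf _) (hasFDerivAt_expMap t)]
  refine IsPosDef.invForm_adjoint_le hκ
    (inner_hess_nonneg_of_convexOn hV.strictConvexOn.convexOn hVt) (inner_hess_comm hVt)
    (hV.isPosDef_hess_logPotential hu t) (fun u => ?_) _
  rw [inner_hess_logPotential fun x hx => hV.contDiffAt_of_mem_posOrthant hx]
  have hle := inner_hess_le_of_concaveOn hp.ne' hconc hmem hVt (diagL (expMap t) u)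
  rw [one_sub_div hp.ne', div_mul_eq_mul_div, le_div_iff₀ hp]
  linarith

theorem varianceBound_of_isUnconditional (hf : ContDiff ℝ 1 f) (hfu : IsUnconditional f) :
    VarianceBound (1 - 1 / p) V f := by
  obtain ⟨c, hc⟩ := exists_lintegral_sq_sub_mul_exp_neg_le
    (contDiff_logPotential fun x hx => hV.contDiffAt_of_mem_posOrthant hx)
    (hf.comp contDiff_expMap) (hV.isPosDef_hess_logPotential hu)
  have henergy : ∀ s x, invForm (hess V (flip s x)) (gradient f (flip s x)) =
      invForm (hess V x) (gradient f x) := fun s x => by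
    rw [invForm_comp_isometry (flip s) (hu.apply_flip s)]
    simp only [hfu.apply_flip]
  refine ⟨c, ?_⟩
  rw [lintegral_exp_neg_mul_eq_logPotential hu fun s x => by rw [hfu.apply_flip],
    lintegral_exp_neg_mul_eq_logPotential hu henergy, mul_left_comm]
  gcongr
  refine hc.trans ?_
  rw [← lintegral_const_mul' _ _ ENNReal.ofReal_ne_top]
  refine lintegral_mono fun t => ?_
  rw [mul_left_comm]
  gcongr
  exact hV.invForm_hess_logPotential_le hu hconc (hf.differentiable one_ne_zero) t

end IsHomogeneousPotential

end Unconditional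

/-! ### Legendre duality -/

theorem exists_ne_zero_apply_eq_zero_of_not_isPosDef {F : Type*} [NormedAddCommGroup F]
    [InnerProductSpace ℝ F] {A : F →L[ℝ] F} (hsymm : ∀ u v, ⟪A u, v⟫ = ⟪A v, u⟫)
    (hA : ∀ u, 0 ≤ ⟪A u, u⟫) (hnot : ¬ IsPosDef A) : ∃ u, u ≠ 0 ∧ A u = 0 := by
  simp only [IsPosDef, not_forall, not_lt] at hnot
  obtain ⟨u, hu, hle⟩ := hnot
  refine ⟨u, hu, ?_⟩
  have huu : ⟪A u, u⟫ = 0 := le_antisymm hle (hA u)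
  -- `s ↦ ⟨A (u + s • A u), u + s • A u⟩` is nonnegative and vanishes at `0`
  have hdiscrim := discrim_le_zero (a := ⟪A (A u), A u⟫) (b := 2 * ⟪A u, A u⟫) (c := 0)
    fun s => by
      have hs := hA (u + s • A u)
      simp only [map_add, map_smul, inner_add_left, inner_add_right, inner_smul_left,
        inner_smul_right, conj_trivial, huu, hsymm (A u) u] at hs
      linarith
  rw [discrim] at hdiscrim
  have hzero : ⟪A u, A u⟫ = 0 := by nlinarith [sq_nonneg (⟪A u, A u⟫ : ℝ)]
  exact inner_self_eq_zero.1 hzero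

theorem ne_zero_of_mem_posOrthant {n : ℕ} (hn : n ≠ 0) {x : Rn n} (hx : x ∈ posOrthant n) :
    x ≠ 0 := by
  rintro rfl
  simpa using hx ⟨0, Nat.pos_of_ne_zero hn⟩

theorem rpow_eq_rpow_sub_one_mul {r : ℝ} (hr : 0 < r) (p : ℝ) : r ^ p = r ^ (p - 1) * r := by
  rw [← Real.rpow_add_one hr.ne', sub_add_cancel]

namespace IsHomogeneousPotential

variable {n : ℕ} {p : ℝ} {V : Rn n → ℝ} (hV : IsHomogeneousPotential p V)

include hV

theorem exists_norm_le_of_le_inner (B : ℝ) :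
    ∃ R : ℝ, 0 < R ∧ ∀ z y : Rn n, ‖z‖ ≤ B → V y ≤ ⟪y, z⟫ → ‖y‖ ≤ R := by
  obtain ⟨m, hm, hgrowth⟩ := hV.exists_mul_norm_rpow_le
  have hp : 0 < p - 1 := by linarith [hV.one_lt]
  obtain ⟨R, hR, hR0⟩ := (((tendsto_rpow_atTop hp).eventually_gt_atTop (B / m)).and
    (eventually_gt_atTop 0)).exists
  refine ⟨R, hR0, fun z y hz hy => ?_⟩
  by_contra! hlt
  have hy0 : 0 < ‖y‖ := hR0.trans hlt
  have hbound : m * ‖y‖ ^ (p - 1) * ‖y‖ ≤ B * ‖y‖ := calc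
    m * ‖y‖ ^ (p - 1) * ‖y‖ = m * ‖y‖ ^ p := by
      rw [rpow_eq_rpow_sub_one_mul hy0 p, mul_assoc]
    _ ≤ ⟪y, z⟫ := (hgrowth y).trans hy
    _ ≤ ‖y‖ * ‖z‖ := real_inner_le_norm y z
    _ ≤ B * ‖y‖ := by rw [mul_comm]; gcongr
  have hmono : R ^ (p - 1) ≤ ‖y‖ ^ (p - 1) := Real.rpow_le_rpow hR0.le hlt.le hp.le
  rw [div_lt_iff₀' hm] at hR
  exact (hR.trans_le (by gcongr)).not_ge (le_of_mul_le_mul_right hbound hy0)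

theorem exists_forall_inner_sub_le (z : Rn n) :
    ∃ x : Rn n, ∀ y, ⟪y, z⟫ - V y ≤ ⟪x, z⟫ - V x := by
  obtain ⟨R, hR0, hR⟩ := hV.exists_norm_le_of_le_inner ‖z‖
  have hcont : Continuous fun y : Rn n => ⟪y, z⟫ - V y := by
    have := hV.continuous
    fun_prop
  obtain ⟨x, -, hx⟩ := (isCompact_closedBall (0 : Rn n) R).exists_isMaxOn
    ⟨0, Metric.mem_closedBall_self hR0.le⟩ hcont.continuousOn
  refine ⟨x, fun y => ?_⟩
  by_cases hy : ‖y‖ ≤ R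
  · exact hx (mem_closedBall_zero_iff.2 hy)
  · have hneg : ⟪y, z⟫ < V y := lt_of_not_ge fun h => hy (hR z y le_rfl h)
    have hzero : ⟪(0 : Rn n), z⟫ - V 0 ≤ ⟪x, z⟫ - V x := hx (Metric.mem_closedBall_self hR0.le)
    rw [inner_zero_left, hV.map_zero] at hzero
    linarith

theorem eq_of_forall_inner_sub_le {z x x' : Rn n} (hx : ∀ y, ⟪y, z⟫ - V y ≤ ⟪x, z⟫ - V x)
    (hx' : ∀ y, ⟪y, z⟫ - V y ≤ ⟪x', z⟫ - V x') : x = x' := by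
  by_contra hne
  have hmid := hV.strictConvexOn.2 (mem_univ x) (mem_univ x') hne one_half_pos one_half_pos
    (add_halves 1)
  have hle := hx ((1 / 2 : ℝ) • x + (1 / 2 : ℝ) • x')
  rw [inner_add_left, real_inner_smul_left, real_inner_smul_left] at hle
  simp only [smul_eq_mul] at hmid
  linarith [hx x', hx' x]

end IsHomogeneousPotential

open Classical in
/-- The point at which the supremum defining the Legendre transform `V* z` is attained, that is
`∇V*(z)`. It is `0` if the supremum is not attained. -/
def dualPoint {n : ℕ} (V : Rn n → ℝ) (z : Rn n) : Rn n :=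
  if h : ∃ x : Rn n, ∀ y, ⟪y, z⟫ - V y ≤ ⟪x, z⟫ - V x then h.choose else 0

namespace IsHomogeneousPotential

variable {n : ℕ} {p : ℝ} {V : Rn n → ℝ} (hV : IsHomogeneousPotential p V)

include hV

theorem inner_sub_le_dualPoint (z y : Rn n) :
    ⟪y, z⟫ - V y ≤ ⟪dualPoint V z, z⟫ - V (dualPoint V z) := by
  have h := hV.exists_forall_inner_sub_le z
  rw [dualPoint, dif_pos h]
  exact h.choose_spec y

theorem dualPoint_eq {z x : Rn n} (hx : ∀ y, ⟪y, z⟫ - V y ≤ ⟪x, z⟫ - V x) :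
    dualPoint V z = x :=
  hV.eq_of_forall_inner_sub_le (hV.inner_sub_le_dualPoint z) hx

theorem legendre_eq (z : Rn n) : legendre V z = ⟪dualPoint V z, z⟫ - V (dualPoint V z) :=
  le_antisymm (ciSup_le (hV.inner_sub_le_dualPoint z))
    (le_ciSup (f := fun x : Rn n => ⟪x, z⟫ - V x)
      ⟨_, forall_mem_range.2 (hV.inner_sub_le_dualPoint z)⟩ (dualPoint V z))

theorem continuous_dualPoint : Continuous (dualPoint V) := by
  refine continuous_iff_continuousAt.2 fun z => ?_
  obtain ⟨R, -, hR⟩ := hV.exists_norm_le_of_le_inner (‖z‖ + 1)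
  refine (isCompact_closedBall (0 : Rn n) R).tendsto_nhds_of_unique_mapClusterPt ?_ ?_
  · filter_upwards [Metric.ball_mem_nhds z one_pos] with w hw
    refine mem_closedBall_zero_iff.2 (hR w _ ?_ ?_)
    · rw [mem_ball_iff_norm] at hw
      linarith [norm_le_norm_add_norm_sub' w z]
    · have hzero := hV.inner_sub_le_dualPoint w 0
      rw [inner_zero_left, hV.map_zero] at hzero
      linarith
  · intro x _ hx
    obtain ⟨𝒰, h𝒰, hlim⟩ := mapClusterPt_iff_ultrafilter.1 hx
    have hid : Tendsto (fun w : Rn n => w) 𝒰 (𝓝 z) := h𝒰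
    refine (hV.dualPoint_eq fun y => ?_).symm
    exact le_of_tendsto_of_tendsto' ((tendsto_const_nhds.inner hid).sub_const (V y))
      ((hlim.inner hid).sub ((hV.continuous.tendsto x).comp hlim))
      fun w => hV.inner_sub_le_dualPoint w y

theorem hasGradientAt_legendre (z : Rn n) :
    HasGradientAt (legendre V) (dualPoint V z) z := by
  rw [hasGradientAt_iff_isLittleO, Asymptotics.isLittleO_iff]
  intro ε hε
  filter_upwards [Metric.tendsto_nhds.1 (hV.continuous_dualPoint.tendsto z) ε hε] with w hw
  have hnonneg : 0 ≤ legendre V w - legendre V z - ⟪dualPoint V z, w - z⟫ := by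
    have hw' := hV.inner_sub_le_dualPoint w (dualPoint V z)
    rw [hV.legendre_eq, hV.legendre_eq, inner_sub_right]
    linarith
  rw [Real.norm_of_nonneg hnonneg]
  calc legendre V w - legendre V z - ⟪dualPoint V z, w - z⟫
      ≤ ⟪dualPoint V w - dualPoint V z, w - z⟫ := by
        have hz := hV.inner_sub_le_dualPoint z (dualPoint V w)
        rw [hV.legendre_eq, hV.legendre_eq, inner_sub_left]
        simp only [inner_sub_right]
        linarith
    _ ≤ ‖dualPoint V w - dualPoint V z‖ * ‖w - z‖ := real_inner_le_norm _ _
    _ ≤ ε * ‖w - z‖ := by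
        rw [dist_eq_norm] at hw
        gcongr

theorem gradient_legendre : gradient (legendre V) = dualPoint V :=
  gradient_eq hV.hasGradientAt_legendre

theorem dualPoint_gradient {x : Rn n} (hx : x ≠ 0) : dualPoint V (gradient V x) = x := by
  refine hV.dualPoint_eq fun y => ?_
  rcases eq_or_ne x y with rfl | hxy
  · exact le_rfl
  · have hlt := add_inner_gradient_lt_of_strictConvexOn hV.strictConvexOn
      (hV.differentiableAt hx) hxy
    rw [inner_sub_right, real_inner_comm y, real_inner_comm x] at hlt
    linarith

theorem gradient_dualPoint_of_ne_zero {z : Rn n} (hz : dualPoint V z ≠ 0) :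
    gradient V (dualPoint V z) = z := by
  have hmax : IsLocalMax (fun y : Rn n => ⟪z, y⟫ - V y) (dualPoint V z) :=
    Eventually.of_forall fun y => by
      simpa only [real_inner_comm _ z] using hV.inner_sub_le_dualPoint z y
  have hderiv : HasFDerivAt (fun y : Rn n => ⟪z, y⟫ - V y)
      (innerSL ℝ z - fderiv ℝ V (dualPoint V z)) (dualPoint V z) :=
    (innerSL ℝ z).hasFDerivAt.sub (hV.differentiableAt hz).hasFDerivAt
  refine ext_inner_right ℝ fun v => ?_
  have hzero := DFunLike.congr_fun (hmax.hasFDerivAt_eq_zero hderiv) v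
  rw [inner_gradient_left]
  simp only [sub_apply, innerSL_apply_apply, zero_apply] at hzero
  linarith

theorem dualPoint_ne_zero {z : Rn n} (hz : z ≠ 0) : dualPoint V z ≠ 0 := by
  intro hdual
  -- testing the maximality of the origin at `r • z` and letting `r → 0`
  have hsq_le : ∀ r : ℝ, 0 < r → ‖z‖ ^ 2 ≤ r ^ (p - 1) * V z := fun r hr => by
    have hmax := hV.inner_sub_le_dualPoint z (r • z)
    rw [hdual, inner_zero_left, hV.map_zero, hV.homogeneous r hr, real_inner_smul_left,
      real_inner_self_eq_norm_sq, rpow_eq_rpow_sub_one_mul hr] at hmax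
    have hmul : r * ‖z‖ ^ 2 ≤ r * (r ^ (p - 1) * V z) := by linarith
    exact le_of_mul_le_mul_left hmul hr
  have hp : 0 < p - 1 := by linarith [hV.one_lt]
  have hlim : Tendsto (fun r : ℝ => r ^ (p - 1) * V z) (𝓝[>] 0) (𝓝 0) := by
    have hcont := (Real.continuousAt_rpow_const 0 (p - 1) (Or.inr hp.le)).tendsto.mul_const (V z)
    rw [Real.zero_rpow hp.ne', zero_mul] at hcont
    exact hcont.mono_left nhdsWithin_le_nhds
  have hsq : ‖z‖ ^ 2 ≤ 0 := ge_of_tendsto hlim (eventually_mem_nhdsWithin.mono hsq_le)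
  exact hsq.not_gt (pow_pos (norm_pos_iff.2 hz) 2)

theorem gradient_dualPoint {z : Rn n} (hz : z ≠ 0) : gradient V (dualPoint V z) = z :=
  hV.gradient_dualPoint_of_ne_zero (hV.dualPoint_ne_zero hz)

theorem injOn_dualPoint : InjOn (dualPoint V) {0}ᶜ :=
  LeftInvOn.injOn fun _ hz => hV.gradient_dualPoint hz

theorem legendre_eq_sub_one_mul {z : Rn n} (hz : z ≠ 0) :
    legendre V z = (p - 1) * V (dualPoint V z) := by
  have heuler := hV.homogeneous.inner_gradient_self
    (hV.differentiableAt (hV.dualPoint_ne_zero hz))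
  rw [hV.gradient_dualPoint hz, real_inner_comm] at heuler
  rw [hV.legendre_eq, heuler]
  ring

theorem dualPoint_apply_pos (hu : IsUnconditional V) {z : Rn n} {i : Fin n} (hi : 0 < z i) :
    0 < dualPoint V z i := by
  have hz : z ≠ 0 := by
    rintro rfl
    exact lt_irrefl (0 : ℝ) hi
  have hne : dualPoint V z i ≠ 0 := fun h => by
    have hgrad := hu.gradient_apply_eq_zero h
    rw [hV.gradient_dualPoint hz] at hgrad
    exact hi.ne' hgrad
  have hmul := hu.mul_gradient_apply_pos hV.strictConvexOn
    (hV.differentiableAt (hV.dualPoint_ne_zero hz)) hne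
  rw [hV.gradient_dualPoint hz] at hmul
  exact pos_of_mul_pos_left hmul hi.le

theorem dualPoint_apply_eq_zero (hu : IsUnconditional V) {z : Rn n} {i : Fin n} (hi : z i = 0) :
    dualPoint V z i = 0 := by
  by_contra hne
  have hdual : dualPoint V z ≠ 0 := fun h => hne (by rw [h]; rfl)
  have hmul := hu.mul_gradient_apply_pos hV.strictConvexOn (hV.differentiableAt hdual) hne
  rw [hV.gradient_dualPoint_of_ne_zero hdual, hi, mul_zero] at hmul
  exact hmul.false

theorem dualPoint_mem_posOrthant (hu : IsUnconditional V) {z : Rn n} (hz : z ∈ posOrthant n) :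
    dualPoint V z ∈ posOrthant n := fun i => hV.dualPoint_apply_pos hu (hz i)

theorem image_dualPoint_posOrthant (hu : IsUnconditional V) (hn : n ≠ 0) :
    dualPoint V '' posOrthant n = posOrthant n :=
  Subset.antisymm (image_subset_iff.2 fun _z hz => hV.dualPoint_mem_posOrthant hu hz) fun x hx =>
    ⟨gradient V x, hV.gradient_mem_posOrthant hu hx,
      hV.dualPoint_gradient (ne_zero_of_mem_posOrthant hn hx)⟩

theorem hasFDerivAt_gradient {x : Rn n} (hx : x ≠ 0) :
    HasFDerivAt (gradient V) (hess V x) x :=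
  ((contDiffAt_gradient (hV.contDiffAt hx)).differentiableAt one_ne_zero).hasFDerivAt

theorem eventually_gradient_dualPoint {z : Rn n} (hz : z ≠ 0) :
    ∀ᶠ w in 𝓝 z, gradient V (dualPoint V w) = w := by
  filter_upwards [isOpen_ne.mem_nhds hz] with w hw using hV.gradient_dualPoint hw

theorem hasFDerivAt_dualPoint {z : Rn n} (hz : z ≠ 0)
    (hpos : IsPosDef (hess V (dualPoint V z))) :
    HasFDerivAt (dualPoint V) (hess V (dualPoint V z)).inverse z := by
  obtain ⟨e, he⟩ := hpos.exists_equiv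
  have hgrad := hV.hasFDerivAt_gradient (hV.dualPoint_ne_zero hz)
  rw [← he] at hgrad ⊢
  rw [ContinuousLinearMap.inverse_equiv]
  exact hgrad.of_local_left_inverse hV.continuous_dualPoint.continuousAt
    (hV.eventually_gradient_dualPoint hz)

theorem exists_hess_apply_eq_zero_of_not_isPosDef {x : Rn n} (hx : x ≠ 0)
    (hnot : ¬ IsPosDef (hess V x)) : ∃ u, u ≠ 0 ∧ hess V x u = 0 :=
  exists_ne_zero_apply_eq_zero_of_not_isPosDef (inner_hess_comm (hV.contDiffAt hx))
    (hV.inner_hess_nonneg hx) hnot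

theorem differentiableAt_dualPoint_iff {z : Rn n} (hz : z ≠ 0) :
    DifferentiableAt ℝ (dualPoint V) z ↔ IsPosDef (hess V (dualPoint V z)) := by
  refine ⟨fun hdiff => ?_, fun hpos => (hV.hasFDerivAt_dualPoint hz hpos).differentiableAt⟩
  by_contra hnot
  have hdual := hV.dualPoint_ne_zero hz
  obtain ⟨u, hu, hker⟩ := hV.exists_hess_apply_eq_zero_of_not_isPosDef hdual hnot
  have hcomp := (((hV.hasFDerivAt_gradient hdual).comp z hdiff.hasFDerivAt).congr_of_eventuallyEq
    (EventuallyEq.symm (hV.eventually_gradient_dualPoint hz))).unique (hasFDerivAt_id z)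
  have hright : hess V (dualPoint V z) (fderiv ℝ (dualPoint V) z u) = u :=
    DFunLike.congr_fun hcomp u
  have hself : ⟪u, u⟫ = 0 := by
    nth_rw 1 [← hright]
    rw [inner_hess_comm (hV.contDiffAt hdual), hker, inner_zero_left]
  exact hu (inner_self_eq_zero.1 hself)

theorem detHess_legendre_eq_top_iff {z : Rn n} (hz : z ≠ 0) :
    detHess (legendre V) z = ⊤ ↔ ¬ IsPosDef (hess V (dualPoint V z)) := by
  rw [detHess, hV.gradient_legendre, hV.differentiableAt_dualPoint_iff hz]
  simp

end IsHomogeneousPotential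

/-! ### Lines parallel to a coordinate axis -/

section CoordinateLines

variable {n : ℕ}

/-- The identification of `ℝ × ℝᵐ` with `ℝᵐ⁺¹` that puts the first component at the coordinate
`i`. It exhibits the lines parallel to the `i`-th axis as the fibres of a product. -/
def insertCoord (i : Fin (n + 1)) : ℝ × (Fin n → ℝ) ≃ᵐ Rn (n + 1) :=
  (MeasurableEquiv.piFinSuccAbove (fun _ => ℝ) i).symm.trans
    (MeasurableEquiv.toLp 2 (Fin (n + 1) → ℝ))

theorem measurePreserving_insertCoord (i : Fin (n + 1)) :
    MeasurePreserving (insertCoord i) (volume.prod volume) volume :=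
  (volume_preserving_piFinSuccAbove (fun _ => ℝ) i).symm.trans
    (PiLp.volume_preserving_toLp (Fin (n + 1)))

theorem insertCoord_apply_self (i : Fin (n + 1)) (t : ℝ) (y : Fin n → ℝ) :
    insertCoord i (t, y) i = t :=
  Fin.insertNth_apply_same (α := fun _ => ℝ) i t y

theorem insertCoord_apply_succAbove (i : Fin (n + 1)) (t : ℝ) (y : Fin n → ℝ) (k : Fin n) :
    insertCoord i (t, y) (i.succAbove k) = y k :=
  Fin.insertNth_apply_succAbove (α := fun _ => ℝ) i t y k

theorem insertCoord_eq_add_smul (i : Fin (n + 1)) (t : ℝ) (y : Fin n → ℝ) :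
    insertCoord i (t, y) = insertCoord i (0, y) + t • EuclideanSpace.single i (1 : ℝ) := by
  ext k
  rcases Fin.eq_self_or_eq_succAbove i k with rfl | ⟨k, rfl⟩
  · simp [insertCoord_apply_self]
  · simp [insertCoord_apply_succAbove, Fin.succAbove_ne]

theorem insertCoord_mem_posOrthant_iff (i : Fin (n + 1)) (t : ℝ) (y : Fin n → ℝ) :
    insertCoord i (t, y) ∈ posOrthant (n + 1) ↔ 0 < t ∧ ∀ k, 0 < y k := by
  simp only [posOrthant, mem_ofPred_eq, Fin.forall_iff_succAbove i, insertCoord_apply_self,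
    insertCoord_apply_succAbove]

theorem setLIntegral_posOrthant_eq_lintegral_line (i : Fin (n + 1)) {F : Rn (n + 1) → ℝ≥0∞}
    (hF : AEMeasurable F (volume.restrict (posOrthant (n + 1)))) :
    ∫⁻ x in posOrthant (n + 1), F x = ∫⁻ y in {y : Fin n → ℝ | ∀ k, 0 < y k},
      ∫⁻ t in Ioi (0 : ℝ), F (insertCoord i (0, y) + t • EuclideanSpace.single i (1 : ℝ)) := by
  have hpre : insertCoord i ⁻¹' posOrthant (n + 1) = Ioi 0 ×ˢ {y : Fin n → ℝ | ∀ k, 0 < y k} := by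
    ext ⟨t, y⟩
    exact insertCoord_mem_posOrthant_iff i t y
  have hmp := (measurePreserving_insertCoord i).restrict_preimage_emb
    (insertCoord i).measurableEmbedding (posOrthant (n + 1))
  rw [hpre, ← Measure.prod_restrict] at hmp
  rw [← hmp.lintegral_comp_emb (insertCoord i).measurableEmbedding,
    lintegral_prod_symm (fun a => F (insertCoord i a))
      (hF.comp_quasiMeasurePreserving hmp.quasiMeasurePreserving)]
  simp_rw [← insertCoord_eq_add_smul]

theorem setLIntegral_posOrthant_le_of_forall_line (i : Fin n) {F₁ F₂ : Rn n → ℝ≥0∞}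
    (hF₁ : AEMeasurable F₁ (volume.restrict (posOrthant n)))
    (hF₂ : AEMeasurable F₂ (volume.restrict (posOrthant n)))
    (h : ∀ x : Rn n, x i = 0 → (∀ k, k ≠ i → 0 < x k) →
      ∫⁻ t in Ioi (0 : ℝ), F₁ (x + t • EuclideanSpace.single i (1 : ℝ)) ≤
        ∫⁻ t in Ioi (0 : ℝ), F₂ (x + t • EuclideanSpace.single i (1 : ℝ))) :
    ∫⁻ x in posOrthant n, F₁ x ≤ ∫⁻ x in posOrthant n, F₂ x := by
  obtain ⟨m, rfl⟩ := Nat.exists_eq_succ_of_ne_zero i.pos.ne'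
  have hmeas : MeasurableSet {y : Fin m → ℝ | ∀ k, 0 < y k} := by measurability
  rw [setLIntegral_posOrthant_eq_lintegral_line i hF₁,
    setLIntegral_posOrthant_eq_lintegral_line i hF₂]
  refine setLIntegral_mono' hmeas fun y hy => h _ (insertCoord_apply_self i 0 y) fun k hk => ?_
  obtain ⟨k, rfl⟩ := Fin.exists_succAbove_eq hk
  rw [insertCoord_apply_succAbove]
  exact hy k

theorem add_smul_single_mem_posOrthant {i : Fin n} {x : Rn n} (hxi : x i = 0)
    (hx : ∀ k, k ≠ i → 0 < x k) {t : ℝ} (ht : 0 < t) :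
    x + t • EuclideanSpace.single i (1 : ℝ) ∈ posOrthant n := by
  intro k
  rcases eq_or_ne k i with rfl | hk
  · simp [hxi, ht]
  · simpa [hk] using hx k hk

theorem hasDerivAt_of_hasLineDerivAt {E F : Type*} [NormedAddCommGroup E] [NormedSpace ℝ E]
    [NormedAddCommGroup F] [NormedSpace ℝ F] {g : E → F} {g' : F} {x v : E} {t : ℝ}
    (hg : HasLineDerivAt ℝ g g' (x + t • v) v) :
    HasDerivAt (fun s : ℝ => g (x + s • v)) g' t := by
  have hshift : HasDerivAt (fun s : ℝ => g (x + t • v + s • v)) g' (t - t) := by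
    rw [sub_self]
    exact hg
  refine (hshift.comp_sub_const t t).congr_of_eventuallyEq (.of_forall fun s => ?_)
  simp only
  congr 1
  module

theorem brascampLieb_posOrthant_of_antitoneOn (i : Fin n) {h h' ψ ψ' ψ'' r : Rn n → ℝ}
    (ch : Continuous h) (h0 : ∀ x, x i = 0 → h x = 0)
    (hh : ∀ x ∈ posOrthant n, HasLineDerivAt ℝ h (h' x) x (EuclideanSpace.single i 1))
    (hψ : ∀ x ∈ posOrthant n, HasLineDerivAt ℝ ψ (ψ' x) x (EuclideanSpace.single i 1))
    (hψ' : ∀ x ∈ posOrthant n, HasLineDerivAt ℝ ψ' (ψ'' x) x (EuclideanSpace.single i 1))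
    (ch' : ContinuousOn h' (posOrthant n)) (cψ : ContinuousOn ψ (posOrthant n))
    (cψ'' : ContinuousOn ψ'' (posOrthant n)) (cr : ContinuousOn r (posOrthant n))
    (hmono : ∀ x ∈ posOrthant n, 0 ≤ ψ' x) (hconv : ∀ x ∈ posOrthant n, 0 < ψ'' x)
    (hr : ∀ x : Rn n, x i = 0 → (∀ k, k ≠ i → 0 < x k) →
      AntitoneOn (fun t : ℝ => r (x + t • EuclideanSpace.single i (1 : ℝ))) (Ioi 0))
    (hr0 : ∀ x ∈ posOrthant n, 0 ≤ r x) :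
    ∫⁻ x in posOrthant n, ENNReal.ofReal (h x ^ 2 * Real.exp (-ψ x)) * ENNReal.ofReal (r x) ≤
      ∫⁻ x in posOrthant n,
        ENNReal.ofReal (h' x ^ 2 / ψ'' x * Real.exp (-ψ x)) * ENNReal.ofReal (r x) := by
  have cexp : ContinuousOn (fun x => Real.exp (-ψ x)) (posOrthant n) :=
    Real.continuous_exp.comp_continuousOn cψ.neg
  have cq : ContinuousOn (fun x => h' x ^ 2 / ψ'' x) (posOrthant n) :=
    (ch'.pow 2).div cψ'' fun x hx => (hconv x hx).ne'
  have meas : ∀ {g : Rn n → ℝ}, ContinuousOn g (posOrthant n) →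
      AEMeasurable (fun x => ENNReal.ofReal (g x)) (volume.restrict (posOrthant n)) :=
    fun hg => (hg.aemeasurable (measurableSet_posOrthant n)).ennreal_ofReal
  refine setLIntegral_posOrthant_le_of_forall_line i
    ((meas ((ch.pow 2).continuousOn.mul cexp)).mul (meas cr)) ((meas (cq.mul cexp)).mul (meas cr))
    fun x hxi hx => ?_
  have hmem : ∀ t ∈ Ioi (0 : ℝ), x + t • EuclideanSpace.single i (1 : ℝ) ∈ posOrthant n :=
    fun t ht => add_smul_single_mem_posOrthant hxi hx ht
  have cline : Continuous fun t : ℝ => x + t • EuclideanSpace.single i (1 : ℝ) := by fun_prop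
  have hlim : Tendsto (fun t : ℝ => h (x + t • EuclideanSpace.single i (1 : ℝ))) (𝓝[>] 0)
      (𝓝 0) := by
    have hcont := (ch.comp cline).tendsto 0
    simp only [Function.comp_apply, zero_smul, add_zero, h0 x hxi] at hcont
    exact hcont.mono_left nhdsWithin_le_nhds
  exact brascampLieb_Ioi_of_antitoneOn hlim
    (fun t ht => hasDerivAt_of_hasLineDerivAt (hh _ (hmem t ht)))
    (fun t ht => hasDerivAt_of_hasLineDerivAt (hψ _ (hmem t ht)))
    (fun t ht => hasDerivAt_of_hasLineDerivAt (hψ' _ (hmem t ht)))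
    (ch'.comp cline.continuousOn hmem) (cψ''.comp cline.continuousOn hmem)
    (fun t ht => hmono _ (hmem t ht)) (fun t ht => hconv _ (hmem t ht)) (hr x hxi hx)
    fun t ht => hr0 _ (hmem t ht)

theorem le_of_antitoneOn_lines {β : Type*} [Preorder β] {G : Rn n → β}
    (hG : ∀ (i : Fin n) (x : Rn n), x i = 0 →
      AntitoneOn (fun t : ℝ => G (x + t • EuclideanSpace.single i (1 : ℝ))) (Ici 0))
    {z w : Rn n} (hw : ∀ i, 0 ≤ w i) (hwz : ∀ i, w i ≤ z i) : G z ≤ G w := by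
  have hupdate : ∀ (y : Fin n → ℝ) (i : Fin n) {s t : ℝ}, 0 ≤ s → s ≤ t →
      G (WithLp.toLp 2 (Function.update y i t)) ≤ G (WithLp.toLp 2 (Function.update y i s)) := by
    intro y i s t hs hst
    have hline : ∀ t : ℝ, WithLp.toLp 2 (Function.update y i t) =
        WithLp.toLp 2 (Function.update y i 0) + t • EuclideanSpace.single i (1 : ℝ) := fun t => by
      ext k
      rcases eq_or_ne k i with rfl | hk
      · simp
      · simp [hk]
    rw [hline t, hline s]
    exact hG i _ (by simp) hs (hs.trans hst) hst
  have hpiecewise : ∀ T : Finset (Fin n), G z ≤ G (WithLp.toLp 2 (T.piecewise w.ofLp z.ofLp)) := by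
    intro T
    induction T using Finset.induction_on with
    | empty => simp
    | insert i T hi ih =>
      rw [Finset.piecewise_insert]
      refine ih.trans ?_
      have hz := hupdate (T.piecewise w.ofLp z.ofLp) i (hw i) (hwz i)
      rwa [← Finset.piecewise_eq_of_notMem T w.ofLp z.ofLp hi, Function.update_eq_self] at hz
  simpa using hpiecewise Finset.univ

end CoordinateLines

/-! ### Functions odd in two coordinates -/

/-- The monotonicity assumption on `det D²V*`, along the lines orthogonal to the coordinate
hyperplanes; the value `⊤` of `detHess` where `V*` is not twice differentiable takes part in it. -/
def HasAntitoneDualDet {n : ℕ} (V : Rn n → ℝ) : Prop :=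
  ∀ (i : Fin n) (x' : Rn n), x' i = 0 →
    AntitoneOn (fun t : ℝ => detHess (legendre V) (x' + t • EuclideanSpace.single i (1 : ℝ)))
      (Ici 0)

section QuadraticForms

variable {F : Type*} [NormedAddCommGroup F] [InnerProductSpace ℝ F] [FiniteDimensional ℝ F]

theorem det_nonneg_of_inner_nonneg {A : F →L[ℝ] F} (hsymm : ∀ u v, ⟪A u, v⟫ = ⟪A v, u⟫)
    (hA : ∀ u, 0 ≤ ⟪A u, u⟫) : 0 ≤ A.det := by
  have hpos : A.toLinearMap.IsPositive := by
    refine ⟨fun u v => ?_, fun u => by simpa using hA u⟩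
    rw [ContinuousLinearMap.coe_coe, hsymm, real_inner_comm]
  have hdet := ((LinearMap.posSemidef_toMatrix_iff (stdOrthonormalBasis ℝ F)).2 hpos).det_nonneg
  rwa [LinearMap.det_toMatrix] at hdet

theorem IsPosDef.inner_inverse_comm {A : F →L[ℝ] F} (hA : IsPosDef A)
    (hsymm : ∀ u v, ⟪A u, v⟫ = ⟪A v, u⟫) (ξ η : F) : ⟪A.inverse ξ, η⟫ = ⟪A.inverse η, ξ⟫ := by
  conv_lhs => rw [← hA.apply_inverse η, real_inner_comm, hsymm, hA.apply_inverse, real_inner_comm]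

-- The vectors `d` and `A⁻¹ e` are orthogonal for the scalar product of `A`, so this is Bessel's
-- inequality for `A⁻¹ ξ`.
theorem IsPosDef.sq_div_add_sq_div_le {A : F →L[ℝ] F} (hA : IsPosDef A)
    (hsymm : ∀ u v, ⟪A u, v⟫ = ⟪A v, u⟫) {d e : F} (hd : d ≠ 0) (he : e ≠ 0) (hde : ⟪d, e⟫ = 0)
    (ξ : F) :
    ⟪ξ, d⟫ ^ 2 / ⟪A d, d⟫ + ⟪ξ, A.inverse e⟫ ^ 2 / ⟪A.inverse e, e⟫ ≤ ⟪A.inverse ξ, ξ⟫ := by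
  have hdd := hA d hd
  have hee := hA.inverse e he
  have hproj := hA.two_mul_inner_sub_le hsymm ξ
    ((⟪ξ, d⟫ / ⟪A d, d⟫) • d + (⟪ξ, A.inverse e⟫ / ⟪A.inverse e, e⟫) • A.inverse e)
  have hcross : ⟪A d, A.inverse e⟫ = 0 := by rw [hsymm, hA.apply_inverse, real_inner_comm, hde]
  simp only [map_add, map_smul, inner_add_left, inner_add_right, real_inner_smul_left,
    real_inner_smul_right, hcross, hA.apply_inverse, real_inner_comm d e, hde,
    real_inner_comm (A.inverse e) e] at hproj
  refine le_trans (le_of_eq ?_) hproj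
  field_simp
  ring

end QuadraticForms

namespace IsHomogeneousPotential

variable {n : ℕ} {p : ℝ} {V : Rn n → ℝ} (hV : IsHomogeneousPotential p V)

include hV

-- By Sard's lemma, applied to the map `∇V`.
theorem ae_isPosDef_hess_dualPoint :
    ∀ᵐ z : Rn n, z ≠ 0 → IsPosDef (hess V (dualPoint V z)) := by
  have hnull : volume (gradient V '' {y | y ≠ 0 ∧ (hess V y).det = 0}) = 0 :=
    addHaar_image_eq_zero_of_det_fderivWithin_eq_zero volume
      (fun y hy => (hV.hasFDerivAt_gradient hy.1).hasFDerivWithinAt) fun y hy => hy.2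
  refine measure_mono_null (fun z hz => ?_) hnull
  obtain ⟨hz0, hnot⟩ := Classical.not_imp.1 hz
  have hdual := hV.dualPoint_ne_zero hz0
  obtain ⟨u, hu, hker⟩ := hV.exists_hess_apply_eq_zero_of_not_isPosDef hdual hnot
  refine ⟨dualPoint V z, ⟨hdual, ?_⟩, hV.gradient_dualPoint hz0⟩
  by_contra hdet
  exact hu ((LinearMap.equivOfDetNeZero _ hdet).injective (by simpa using hker))

theorem isPosDef_hess_of_mem_posOrthant (hu : IsUnconditional V) (hdet : HasAntitoneDualDet V)
    {x : Rn n} (hx : x ∈ posOrthant n) : IsPosDef (hess V x) := by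
  rcases eq_or_ne n 0 with rfl | hn
  · exact fun u hu0 => absurd (Subsingleton.elim u 0) hu0
  by_contra hnot
  set z := gradient V x
  have hz : z ∈ posOrthant n := hV.gradient_mem_posOrthant hu hx
  have htop : detHess (legendre V) z = ⊤ := by
    rwa [hV.detHess_legendre_eq_top_iff (ne_zero_of_mem_posOrthant hn hz),
      hV.dualPoint_gradient (ne_zero_of_mem_posOrthant hn hx)]
  -- the infinite value at `z` propagates to the whole box between `0` and `z`
  have hopen : IsOpen (posOrthant n ∩ (fun w => z - w) ⁻¹' posOrthant n) :=
    (isOpen_posOrthant n).inter ((isOpen_posOrthant n).preimage (by fun_prop))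
  have hmem : (1 / 2 : ℝ) • z ∈ posOrthant n := fun i => by simpa using hz i
  have hmem' : z - (1 / 2 : ℝ) • z ∈ posOrthant n := by
    convert hmem using 1
    module
  have hdense := Measure.dense_of_ae hV.ae_isPosDef_hess_dualPoint
  obtain ⟨w, ⟨hw, hzw⟩, hpos⟩ := hdense.inter_open_nonempty _ hopen ⟨_, hmem, hmem'⟩
  have hw0 := ne_zero_of_mem_posOrthant hn hw
  refine (hV.detHess_legendre_eq_top_iff hw0).1 (top_le_iff.1 ?_) (hpos hw0)
  rw [← htop]
  exact le_of_antitoneOn_lines hdet (fun i => (hw i).le) fun i => (sub_pos.1 (hzw i)).le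

theorem continuousOn_inverse_hess (hn : n ≠ 0) (hpos : ∀ x ∈ posOrthant n, IsPosDef (hess V x)) :
    ContinuousOn (fun x => (hess V x).inverse) (posOrthant n) := fun x hx =>
  ((hpos x hx).continuousAt_inverse (continuousAt_hess
    (hV.contDiffAt (ne_zero_of_mem_posOrthant hn hx)))).continuousWithinAt

theorem det_inverse_hess_nonneg {x : Rn n} (hx : x ≠ 0) (hpos : IsPosDef (hess V x)) :
    0 ≤ (hess V x).inverse.det :=
  det_nonneg_of_inner_nonneg (hpos.inner_inverse_comm (inner_hess_comm (hV.contDiffAt hx)))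
    hpos.inverse.inner_nonneg

theorem detHess_legendre {z : Rn n} (hz : z ≠ 0) (hpos : IsPosDef (hess V (dualPoint V z))) :
    detHess (legendre V) z = ENNReal.ofReal (hess V (dualPoint V z)).inverse.det := by
  have hderiv := hV.hasFDerivAt_dualPoint hz hpos
  rw [detHess, hess, hV.gradient_legendre, if_pos hderiv.differentiableAt, hderiv.fderiv]

theorem antitoneOn_det_inverse_hess_dualPoint (hu : IsUnconditional V)
    (hdet : HasAntitoneDualDet V) {i : Fin n} {x : Rn n} (hxi : x i = 0)
    (hx : ∀ k, k ≠ i → 0 < x k) :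
    AntitoneOn (fun t : ℝ =>
      (hess V (dualPoint V (x + t • EuclideanSpace.single i (1 : ℝ)))).inverse.det) (Ioi 0) := by
  intro s hs t ht hst
  have hle := hdet i x hxi (mem_Ici_of_Ioi hs) (mem_Ici_of_Ioi ht) hst
  have hline : ∀ t ∈ Ioi (0 : ℝ), x + t • EuclideanSpace.single i (1 : ℝ) ≠ 0 ∧
      IsPosDef (hess V (dualPoint V (x + t • EuclideanSpace.single i (1 : ℝ)))) := fun t ht => by
    have hmem := add_smul_single_mem_posOrthant hxi hx ht
    exact ⟨ne_zero_of_mem_posOrthant i.pos.ne' hmem,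
      hV.isPosDef_hess_of_mem_posOrthant hu hdet (hV.dualPoint_mem_posOrthant hu hmem)⟩
  obtain ⟨hs0, hspos⟩ := hline s hs
  obtain ⟨ht0, htpos⟩ := hline t ht
  simp only [hV.detHess_legendre hs0 hspos, hV.detHess_legendre ht0 htpos] at hle
  exact (ENNReal.ofReal_le_ofReal_iff
    (hV.det_inverse_hess_nonneg (hV.dualPoint_ne_zero hs0) hspos)).1 hle

theorem setLIntegral_posOrthant_eq_comp_dualPoint (hn : n ≠ 0) (hu : IsUnconditional V)
    (hpos : ∀ x ∈ posOrthant n, IsPosDef (hess V x)) (g : Rn n → ℝ≥0∞) :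
    ∫⁻ x in posOrthant n, g x = ∫⁻ z in posOrthant n,
      g (dualPoint V z) * ENNReal.ofReal (hess V (dualPoint V z)).inverse.det := by
  have hne : ∀ {z}, z ∈ posOrthant n → z ≠ 0 := fun hz => ne_zero_of_mem_posOrthant hn hz
  have hdual : ∀ {z}, z ∈ posOrthant n → dualPoint V z ∈ posOrthant n := fun hz =>
    hV.dualPoint_mem_posOrthant hu hz
  conv_lhs => rw [← hV.image_dualPoint_posOrthant hu hn]
  rw [lintegral_image_eq_lintegral_abs_det_fderiv_mul volume (measurableSet_posOrthant n)
    (fun z hz => (hV.hasFDerivAt_dualPoint (hne hz) (hpos _ (hdual hz))).hasFDerivWithinAt)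
    (hV.injOn_dualPoint.mono fun z hz => hne hz)]
  refine setLIntegral_congr_fun (measurableSet_posOrthant n) fun z hz => ?_
  rw [abs_of_nonneg (hV.det_inverse_hess_nonneg (hne (hdual hz)) (hpos _ (hdual hz))), mul_comm]

theorem hasGradientAt_comp_dualPoint {z : Rn n} (hz : z ≠ 0) :
    HasGradientAt (fun w => V (dualPoint V w)) ((p - 1)⁻¹ • dualPoint V z) z := by
  have hp : p - 1 ≠ 0 := (sub_pos.2 hV.one_lt).ne'
  have hlegendre := (hasGradientAt_iff_hasFDerivAt.1 (hV.hasGradientAt_legendre z)).const_mul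
    (p - 1)⁻¹
  rw [hasGradientAt_iff_hasFDerivAt, map_smul]
  refine hlegendre.congr_of_eventuallyEq ?_
  filter_upwards [isOpen_ne.mem_nhds hz] with w hw
  rw [hV.legendre_eq_sub_one_mul hw, inv_mul_cancel_left₀ hp]

theorem setLIntegral_sq_comp_dualPoint_le (hu : IsUnconditional V) (hdet : HasAntitoneDualDet V)
    {f : Rn n → ℝ} (hf : ContDiff ℝ 1 f) {i : Fin n} (hi : ∀ x : Rn n, x i = 0 → f x = 0) :
    ∫⁻ z in posOrthant n, ENNReal.ofReal (f (dualPoint V z) ^ 2 * Real.exp (-V (dualPoint V z))) *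
        ENNReal.ofReal (hess V (dualPoint V z)).inverse.det ≤
      ∫⁻ z in posOrthant n, ENNReal.ofReal
          (⟪gradient f (dualPoint V z),
              (hess V (dualPoint V z)).inverse (EuclideanSpace.single i 1)⟫ ^ 2 /
            ((p - 1)⁻¹ * ⟪(hess V (dualPoint V z)).inverse (EuclideanSpace.single i 1),
              EuclideanSpace.single i 1⟫) * Real.exp (-V (dualPoint V z))) *
        ENNReal.ofReal (hess V (dualPoint V z)).inverse.det := by
  have hp : 0 < (p - 1)⁻¹ := inv_pos.2 (sub_pos.2 hV.one_lt)
  have hne : ∀ {z}, z ∈ posOrthant n → z ≠ 0 := fun hz => ne_zero_of_mem_posOrthant i.pos.ne' hz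
  have hdual : ∀ {z}, z ∈ posOrthant n → dualPoint V z ∈ posOrthant n := fun hz =>
    hV.dualPoint_mem_posOrthant hu hz
  have hpos : ∀ x ∈ posOrthant n, IsPosDef (hess V x) := fun x hx =>
    hV.isPosDef_hess_of_mem_posOrthant hu hdet hx
  have cD := hV.continuous_dualPoint
  have cV := hV.continuous
  have cgrad := continuous_gradient hf
  have cinv : ContinuousOn (fun z => (hess V (dualPoint V z)).inverse) (posOrthant n) :=
    (hV.continuousOn_inverse_hess i.pos.ne' hpos).comp cD.continuousOn fun z hz => hdual hz
  have hD : ∀ z ∈ posOrthant n, HasFDerivAt (dualPoint V) (hess V (dualPoint V z)).inverse z :=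
    fun z hz => hV.hasFDerivAt_dualPoint (hne hz) (hpos _ (hdual hz))
  refine brascampLieb_posOrthant_of_antitoneOn i
    (ψ' := fun z => (p - 1)⁻¹ * ⟪dualPoint V z, EuclideanSpace.single i 1⟫)
    (hf.continuous.comp cD) (fun z hz => hi _ (hV.dualPoint_apply_eq_zero hu hz))
    (fun z hz => ?_) (fun z hz => ?_) (fun z hz => ?_)
    ((cgrad.comp cD).continuousOn.inner (cinv.clm_apply continuousOn_const)) (by fun_prop)
    (continuousOn_const.mul ((cinv.clm_apply continuousOn_const).inner continuousOn_const))
    (ContinuousLinearMap.continuous_det.comp_continuousOn cinv) (fun z hz => ?_)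
    (fun z hz => mul_pos hp ((hpos _ (hdual hz)).inverse _ (by simp)))
    (fun x hxi hx => hV.antitoneOn_det_inverse_hess_dualPoint hu hdet hxi hx)
    fun z hz => hV.det_inverse_hess_nonneg (hne (hdual hz)) (hpos _ (hdual hz))
  · rw [inner_gradient_left]
    exact ((hf.differentiable one_ne_zero _).hasFDerivAt.comp z (hD z hz)).hasLineDerivAt _
  · have hψ := (hasGradientAt_iff_hasFDerivAt.1
      (hV.hasGradientAt_comp_dualPoint (hne hz))).hasLineDerivAt (EuclideanSpace.single i 1)
    rwa [InnerProductSpace.toDual_apply_apply, real_inner_smul_left] at hψ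
  · have hinner := (hD z hz).inner ℝ (hasFDerivAt_const (EuclideanSpace.single i (1 : ℝ)) z)
    simpa using (hinner.const_mul (p - 1)⁻¹).hasLineDerivAt (EuclideanSpace.single i 1)
  · have hzi := hdual hz i
    rw [EuclideanSpace.inner_single_right, conj_trivial, one_mul]
    positivity

theorem setLIntegral_sq_le_dual (hu : IsUnconditional V) (hdet : HasAntitoneDualDet V)
    {f : Rn n → ℝ} (hf : ContDiff ℝ 1 f) {i : Fin n} (hi : ∀ x : Rn n, x i = 0 → f x = 0) :
    ∫⁻ x in posOrthant n, ENNReal.ofReal (f x ^ 2 * Real.exp (-V x)) ≤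
      ENNReal.ofReal (p - 1) * ∫⁻ x in posOrthant n, ENNReal.ofReal
        (⟪gradient f x, (hess V x).inverse (EuclideanSpace.single i 1)⟫ ^ 2 /
          ⟪(hess V x).inverse (EuclideanSpace.single i 1), EuclideanSpace.single i 1⟫ *
            Real.exp (-V x)) := by
  have hp : 0 < p - 1 := sub_pos.2 hV.one_lt
  have hchange := hV.setLIntegral_posOrthant_eq_comp_dualPoint i.pos.ne' hu fun x hx =>
    hV.isPosDef_hess_of_mem_posOrthant hu hdet hx
  rw [hchange, ← lintegral_const_mul' _ _ ENNReal.ofReal_ne_top,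
    hchange fun x => ENNReal.ofReal (p - 1) * _]
  refine (hV.setLIntegral_sq_comp_dualPoint_le hu hdet hf hi).trans_eq ?_
  congr! 3 with z
  rw [← ENNReal.ofReal_mul hp.le]
  congr 1
  field_simp

theorem setLIntegral_sq_le_primal (hu : IsUnconditional V)
    (hpos : ∀ x ∈ posOrthant n, IsPosDef (hess V x)) {f : Rn n → ℝ} (hf : ContDiff ℝ 1 f)
    {j : Fin n} (hj : ∀ x : Rn n, x j = 0 → f x = 0) :
    ∫⁻ x in posOrthant n, ENNReal.ofReal (f x ^ 2 * Real.exp (-V x)) ≤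
      ∫⁻ x in posOrthant n, ENNReal.ofReal
        (⟪gradient f x, EuclideanSpace.single j 1⟫ ^ 2 /
          ⟪hess V x (EuclideanSpace.single j 1), EuclideanSpace.single j 1⟫ *
            Real.exp (-V x)) := by
  have hne : ∀ {x}, x ∈ posOrthant n → x ≠ 0 := fun hx => ne_zero_of_mem_posOrthant j.pos.ne' hx
  have chess : ContinuousOn (hess V) (posOrthant n) := fun x hx =>
    (continuousAt_hess (hV.contDiffAt (hne hx))).continuousWithinAt
  have hline := brascampLieb_posOrthant_of_antitoneOn j (r := fun _ => 1)
    (h' := fun x => ⟪gradient f x, EuclideanSpace.single j 1⟫) (ψ := V)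
    (ψ' := fun x => ⟪gradient V x, EuclideanSpace.single j 1⟫)
    (ψ'' := fun x => ⟪hess V x (EuclideanSpace.single j 1), EuclideanSpace.single j 1⟫)
    hf.continuous hj (fun x _ => ?_) (fun x hx => ?_) (fun x hx => ?_)
    ((continuous_gradient hf).continuousOn.inner continuousOn_const) hV.continuous.continuousOn
    ((chess.clm_apply continuousOn_const).inner continuousOn_const) continuousOn_const
    (fun x hx => ?_) (fun x hx => hpos x hx _ (by simp)) (fun _ _ _ => antitoneOn_const)
    fun _ _ => zero_le_one
  · simpa only [ENNReal.ofReal_one, mul_one] using hline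
  · rw [inner_gradient_left]
    exact (hf.differentiable one_ne_zero x).hasFDerivAt.hasLineDerivAt _
  · rw [inner_gradient_left]
    exact (hV.differentiableAt (hne hx)).hasFDerivAt.hasLineDerivAt _
  · simpa using ((hV.hasFDerivAt_gradient (hne hx)).inner ℝ
      (hasFDerivAt_const (EuclideanSpace.single j (1 : ℝ)) x)).hasLineDerivAt
        (EuclideanSpace.single j 1)
  · rw [EuclideanSpace.inner_single_right, conj_trivial, one_mul]
    exact (hV.gradient_mem_posOrthant hu hx j).le

theorem setLIntegral_primal_add_dual_le (hpos : ∀ x ∈ posOrthant n, IsPosDef (hess V x))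
    {i j : Fin n} (hij : i ≠ j) (f : Rn n → ℝ) :
    (∫⁻ x in posOrthant n, ENNReal.ofReal
        (⟪gradient f x, EuclideanSpace.single j 1⟫ ^ 2 /
          ⟪hess V x (EuclideanSpace.single j 1), EuclideanSpace.single j 1⟫ *
            Real.exp (-V x))) +
      (∫⁻ x in posOrthant n, ENNReal.ofReal
        (⟪gradient f x, (hess V x).inverse (EuclideanSpace.single i 1)⟫ ^ 2 /
          ⟪(hess V x).inverse (EuclideanSpace.single i 1), EuclideanSpace.single i 1⟫ *
            Real.exp (-V x))) ≤
      ∫⁻ x in posOrthant n,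
        ENNReal.ofReal (Real.exp (-V x)) * invForm (hess V x) (gradient f x) := by
  refine (le_lintegral_add _ _).trans ?_
  refine setLIntegral_mono' (measurableSet_posOrthant n) fun x hx => ?_
  have hx0 := ne_zero_of_mem_posOrthant i.pos.ne' hx
  have hej : (EuclideanSpace.single j 1 : Rn n) ≠ 0 := by simp
  have hei : (EuclideanSpace.single i 1 : Rn n) ≠ 0 := by simp
  have hort : ⟪(EuclideanSpace.single j 1 : Rn n), EuclideanSpace.single i 1⟫ = 0 := by
    simp [EuclideanSpace.inner_single_right, hij]
  have hjj := hpos x hx _ hej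
  have hii := (hpos x hx).inverse _ hei
  rw [(hpos x hx).invForm_eq, ← ENNReal.ofReal_add (by positivity) (by positivity),
    ← ENNReal.ofReal_mul (Real.exp_pos _).le, ← add_mul, mul_comm]
  gcongr
  exact (hpos x hx).sq_div_add_sq_div_le (inner_hess_comm (hV.contDiffAt hx0)) hej hei hort _

theorem setLIntegral_sq_le_of_apply_eq_zero (hu : IsUnconditional V) (hdet : HasAntitoneDualDet V)
    {f : Rn n → ℝ} (hf : ContDiff ℝ 1 f) {i j : Fin n} (hij : i ≠ j)
    (hi : ∀ x : Rn n, x i = 0 → f x = 0) (hj : ∀ x : Rn n, x j = 0 → f x = 0) :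
    ∫⁻ x in posOrthant n, ENNReal.ofReal (f x ^ 2 * Real.exp (-V x)) ≤
      ENNReal.ofReal (1 - 1 / p) * ∫⁻ x in posOrthant n,
        ENNReal.ofReal (Real.exp (-V x)) * invForm (hess V x) (gradient f x) := by
  have hp : 0 < p := one_pos.trans hV.one_lt
  have hp' : 0 ≤ 1 - 1 / p := sub_nonneg.2 ((div_le_one hp).2 hV.one_lt.le)
  have hpos : ∀ x ∈ posOrthant n, IsPosDef (hess V x) := fun x hx =>
    hV.isPosDef_hess_of_mem_posOrthant hu hdet hx
  have hprimal := hV.setLIntegral_sq_le_primal hu hpos hf hj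
  have hdual := hV.setLIntegral_sq_le_dual hu hdet hf hi
  have hsum := hV.setLIntegral_primal_add_dual_le hpos hij f
  set I := ∫⁻ x in posOrthant n, ENNReal.ofReal (f x ^ 2 * Real.exp (-V x))
  set X := ∫⁻ x in posOrthant n, ENNReal.ofReal
    (⟪gradient f x, EuclideanSpace.single j 1⟫ ^ 2 /
      ⟪hess V x (EuclideanSpace.single j 1), EuclideanSpace.single j 1⟫ * Real.exp (-V x))
  set Y := ∫⁻ x in posOrthant n, ENNReal.ofReal
    (⟪gradient f x, (hess V x).inverse (EuclideanSpace.single i 1)⟫ ^ 2 /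
      ⟪(hess V x).inverse (EuclideanSpace.single i 1), EuclideanSpace.single i 1⟫ *
        Real.exp (-V x))
  calc I = ENNReal.ofReal (1 - 1 / p) * I + ENNReal.ofReal (1 / p) * I := by
        rw [← add_mul, ← ENNReal.ofReal_add hp' (by positivity), sub_add_cancel,
          ENNReal.ofReal_one, one_mul]
    _ ≤ ENNReal.ofReal (1 - 1 / p) * X + ENNReal.ofReal (1 / p) *
          (ENNReal.ofReal (p - 1) * Y) := by gcongr
    _ = ENNReal.ofReal (1 - 1 / p) * (X + Y) := by
        rw [mul_add, ← mul_assoc (ENNReal.ofReal (1 / p)), ← ENNReal.ofReal_mul (by positivity)]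
        congr 3
        field_simp
    _ ≤ _ := by gcongr

end IsHomogeneousPotential

/-! ### Parity decomposition -/

section Parity

variable {α : Type*} {T S : α → α} {ε δ : ℤˣ} {f : α → ℝ}

/-- `f` is even (for `ε = 1`) or odd (for `ε = -1`) with respect to `T`, which is in practice an
involution. -/
def HasParity (T : α → α) (ε : ℤˣ) (f : α → ℝ) : Prop := ∀ x, f (T x) = ε • f x

/-- The part of `f` that has parity `ε` with respect to an involution `T`. -/
def parityPart (T : α → α) (ε : ℤˣ) (f : α → ℝ) (x : α) : ℝ := 1 / 2 * (f x + ε • f (T x))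

theorem HasParity.apply_eq_zero_of_isFixedPt (hf : HasParity T (-1) f) {x : α}
    (hx : Function.IsFixedPt T x) : f x = 0 := by
  have h := hf x
  rw [hx, Units.neg_smul, one_smul] at h
  linarith

theorem hasParity_parityPart (hT : Function.Involutive T) (ε : ℤˣ) (f : α → ℝ) :
    HasParity T ε (parityPart T ε f) := fun x => by
  rcases Int.units_eq_one_or ε with rfl | rfl <;>
    simp only [parityPart, hT x, Units.neg_smul, one_smul] <;> ring

theorem HasParity.parityPart (hf : HasParity S ε f) (hTS : Function.Commute T S) (δ : ℤˣ) :
    HasParity S ε (parityPart T δ f) := fun x => by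
  rw [StrongBL.parityPart, StrongBL.parityPart, hTS x, hf, hf, smul_comm δ, ← smul_add,
    mul_smul_comm]

theorem parityPart_one_add_parityPart_neg_one (T : α → α) (f : α → ℝ) (x : α) :
    parityPart T 1 f x + parityPart T (-1) f x = f x := by
  simp only [parityPart, Units.neg_smul, one_smul]
  ring

theorem parityPart_one_sub_parityPart_neg_one (T : α → α) (f : α → ℝ) (x : α) :
    parityPart T 1 f x - parityPart T (-1) f x = f (T x) := by
  simp only [parityPart, Units.neg_smul, one_smul]
  ring

theorem contDiff_parityPart {E : Type*} [NormedAddCommGroup E] [NormedSpace ℝ E] {m : WithTop ℕ∞}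
    {T : E → E} (hT : ContDiff ℝ m T) (ε : ℤˣ) {f : E → ℝ} (hf : ContDiff ℝ m f) :
    ContDiff ℝ m (parityPart T ε f) :=
  contDiff_const.mul (hf.add ((hf.comp hT).const_smul ε))

end Parity

section Reflection

variable {n : ℕ}

/-- The reflection in the `k`-th coordinate hyperplane. -/
def reflect (k : Fin n) : Rn n ≃ₗᵢ[ℝ] Rn n := flip fun i => decide (i = k)

theorem reflect_apply (k : Fin n) (x : Rn n) (i : Fin n) :
    reflect k x i = if i = k then -x i else x i := by
  simp [reflect, flip_apply]

theorem involutive_reflect (k : Fin n) : Function.Involutive (reflect k) := flip_flip _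

theorem commute_reflect (k l : Fin n) : Function.Commute (reflect k) (reflect l) := fun x => by
  ext i
  simp only [reflect_apply]
  split_ifs <;> rfl

theorem isFixedPt_reflect {k : Fin n} {x : Rn n} (hx : x k = 0) :
    Function.IsFixedPt (reflect k) x := by
  ext i
  rw [reflect_apply]
  split_ifs with h
  · rw [h, hx, neg_zero]
  · rfl

theorem apply_flip_of_forall_apply_reflect {β : Type*} {g : Rn n → β} {s : Fin n → Bool}
    (hg : ∀ k, s k → ∀ x, g (reflect k x) = g x) (x : Rn n) : g (flip s x) = g x := by
  suffices hfinset : ∀ S : Finset (Fin n), (∀ k ∈ S, s k) →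
      g (flip (fun i => decide (i ∈ S)) x) = g x by
    have hs : s = fun i => decide (i ∈ Finset.univ.filter fun i => s i) := by
      ext i
      simp
    rw [hs]
    exact hfinset _ fun k hk => (Finset.mem_filter.1 hk).2
  intro S
  induction S using Finset.induction_on with
  | empty =>
    intro _
    congr 1
  | insert a S ha ih =>
    intro hS
    rw [← ih fun k hk => hS k (Finset.mem_insert_of_mem hk),
      ← hg a (hS a (Finset.mem_insert_self a S))]
    congr 1
    ext i
    simp only [flip_apply, reflect_apply, Finset.mem_insert, decide_eq_true_eq]
    by_cases hi : i = a
    · simp [hi, ha]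
    · simp [hi]

theorem isUnconditional_of_forall_apply_reflect {f : Rn n → ℝ}
    (hf : ∀ k x, f (reflect k x) = f x) : IsUnconditional f := fun s hs x => by
  rw [← apply_flip_of_forall_apply_reflect (s := fun i => decide (s i = -1)) (fun k _ => hf k) x]
  congr 1
  ext i
  rw [flip_apply]
  rcases hs i with h | h <;> norm_num [h]

theorem eq_zero_of_hasParity_reflect {f : Rn n → ℝ} (heven : ∀ x, f (-x) = f x) {i : Fin n}
    (hi : HasParity (reflect i) (-1) f) (hf : ∀ k, k ≠ i → HasParity (reflect k) 1 f) (x : Rn n) :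
    f x = 0 := by
  have hneg : flip (fun k => decide (k ≠ i)) (reflect i x) = -x := by
    ext k
    rw [flip_apply, reflect_apply]
    by_cases hk : k = i <;> simp [hk]
  have hflip := apply_flip_of_forall_apply_reflect (g := f) (s := fun k => decide (k ≠ i))
    (fun k hk y => by rw [hf k (of_decide_eq_true hk), one_smul]) (reflect i x)
  rw [hneg, heven, hi, Units.neg_smul, one_smul] at hflip
  linarith

end Reflection

theorem lintegral_mono_of_add_comp_le {α : Type*} [MeasurableSpace α] {μ : Measure α} {T : α → α}
    (hT : MeasurePreserving T μ μ) (hT' : MeasurableEmbedding T) {F G : α → ℝ≥0∞}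
    (hG : AEMeasurable G μ) (h : ∀ᵐ x ∂μ, F x + F (T x) ≤ G x + G (T x)) :
    ∫⁻ x, F x ∂μ ≤ ∫⁻ x, G x ∂μ := by
  rw [← ENNReal.mul_le_mul_iff_right two_ne_zero ENNReal.ofNat_ne_top, two_mul, two_mul]
  calc (∫⁻ x, F x ∂μ) + ∫⁻ x, F x ∂μ = (∫⁻ x, F x ∂μ) + ∫⁻ x, F (T x) ∂μ := by
        rw [hT.lintegral_comp_emb hT']
    _ ≤ ∫⁻ x, F x + F (T x) ∂μ := le_lintegral_add _ _
    _ ≤ ∫⁻ x, G x + G (T x) ∂μ := lintegral_mono_ae h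
    _ = (∫⁻ x, G x ∂μ) + ∫⁻ x, G x ∂μ := by
        rw [lintegral_add_left' hG, hT.lintegral_comp_emb hT']

section InvForm

variable {n : ℕ} {A : Rn n →L[ℝ] Rn n}

theorem gradient_neg {F : Type*} [NormedAddCommGroup F] [InnerProductSpace ℝ F] [CompleteSpace F]
    (f : F → ℝ) (x : F) : gradient (fun y => -f y) x = -gradient f x := by
  rw [gradient, gradient, fderiv_fun_neg, map_neg]

theorem invForm_neg (A : Rn n →L[ℝ] Rn n) (ξ : Rn n) : invForm A (-ξ) = invForm A ξ := by
  have hle : ∀ ξ, invForm A (-ξ) ≤ invForm A ξ := fun ξ =>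
    le_iInf₂ fun η hη => (iInf₂_le (-η) (by rw [map_neg, hη])).trans_eq (by rw [inner_neg_neg])
  refine le_antisymm (hle ξ) ?_
  simpa only [neg_neg] using hle (-ξ)

theorem IsPosDef.invForm_add_add_invForm_sub (hA : IsPosDef A) (ξ η : Rn n) :
    invForm A (ξ + η) + invForm A (ξ - η) = 2 * (invForm A ξ + invForm A η) := by
  have hnonneg := hA.inverse.inner_nonneg
  simp only [hA.invForm_eq, two_mul, ← ENNReal.ofReal_add, hnonneg, add_nonneg]
  congr 1
  simp only [map_add, map_sub, inner_add_left, inner_add_right, inner_sub_left, inner_sub_right]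
  ring

theorem HasParity.invForm_gradient {L : Rn n ≃ₗᵢ[ℝ] Rn n} {V : Rn n → ℝ}
    (hV : ∀ x, V (L x) = V x) {ε : ℤˣ} {f : Rn n → ℝ} (hf : HasParity L ε f) (x : Rn n) :
    invForm (hess V (L x)) (gradient f (L x)) = invForm (hess V x) (gradient f x) := by
  rw [invForm_comp_isometry L hV, show (fun y => f (L y)) = fun y => ε • f y from funext hf]
  rcases Int.units_eq_one_or ε with rfl | rfl
  · simp only [one_smul]
  · simp only [Units.neg_smul, one_smul, gradient_neg, invForm_neg]

theorem invForm_gradient_parityPart_add {L : Rn n ≃ₗᵢ[ℝ] Rn n} {V : Rn n → ℝ}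
    (hV : ∀ x, V (L x) = V x) {f : Rn n → ℝ} (hf : ContDiff ℝ 1 f) {x : Rn n}
    (hx : IsPosDef (hess V x)) :
    invForm (hess V x) (gradient f x) + invForm (hess V (L x)) (gradient f (L x)) =
      2 * (invForm (hess V x) (gradient (parityPart L 1 f) x) +
        invForm (hess V x) (gradient (parityPart L (-1) f) x)) := by
  have hdiff : ∀ ε : ℤˣ, DifferentiableAt ℝ (parityPart L ε f) x := fun ε =>
    (contDiff_parityPart L.contDiff ε hf).differentiable one_ne_zero x
  have hadd : gradient f x =
      gradient (parityPart L 1 f) x + gradient (parityPart L (-1) f) x := by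
    simp only [gradient, ← map_add]
    rw [← fderiv_fun_add (hdiff 1) (hdiff (-1))]
    simp only [parityPart_one_add_parityPart_neg_one]
  have hsub : gradient (fun y => f (L y)) x =
      gradient (parityPart L 1 f) x - gradient (parityPart L (-1) f) x := by
    simp only [gradient, ← map_sub]
    rw [← fderiv_fun_sub (hdiff 1) (hdiff (-1))]
    simp only [parityPart_one_sub_parityPart_neg_one]
  rw [invForm_comp_isometry L hV, hadd, hsub, hx.invForm_add_add_invForm_sub]

end InvForm

section Variance

variable {n : ℕ} {V f : Rn n → ℝ}

theorem lintegral_parityPart_neg_one_sq_le (cV : Continuous V) {L : Rn n ≃ₗᵢ[ℝ] Rn n}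
    (hL : Function.Involutive L) (hVL : ∀ x, V (L x) = V x) (cf : Continuous f) (c : ℝ) :
    ∫⁻ x, ENNReal.ofReal (Real.exp (-V x)) * ENNReal.ofReal (parityPart L (-1) f x ^ 2) ≤
      ∫⁻ x, ENNReal.ofReal (Real.exp (-V x)) *
        ENNReal.ofReal ((parityPart L (-1) f x - c) ^ 2) := by
  have cpart := (contDiff_parityPart (m := 0) L.contDiff (-1) (contDiff_zero.2 cf)).continuous
  refine lintegral_mono_of_add_comp_le L.measurePreserving L.toHomeomorph.measurableEmbedding
    (by fun_prop) (ae_of_all _ fun x => ?_)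
  rw [hVL, hasParity_parityPart hL (-1) f x, Units.neg_smul, one_smul, ← mul_add, ← mul_add,
    ← ENNReal.ofReal_add (sq_nonneg _) (sq_nonneg _),
    ← ENNReal.ofReal_add (sq_nonneg _) (sq_nonneg _)]
  gcongr _ * ENNReal.ofReal ?_
  nlinarith [sq_nonneg c]

theorem lintegral_sq_sub_le_parityPart (cV : Continuous V) {L : Rn n ≃ₗᵢ[ℝ] Rn n}
    (hL : Function.Involutive L) (hVL : ∀ x, V (L x) = V x) (cf : Continuous f) (c : ℝ) :
    ∫⁻ x, ENNReal.ofReal (Real.exp (-V x)) * ENNReal.ofReal ((f x - c) ^ 2) ≤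
      (∫⁻ x, ENNReal.ofReal (Real.exp (-V x)) *
        ENNReal.ofReal ((parityPart L 1 f x - c) ^ 2)) +
      ∫⁻ x, ENNReal.ofReal (Real.exp (-V x)) * ENNReal.ofReal (parityPart L (-1) f x ^ 2) := by
  have cpart := fun ε =>
    (contDiff_parityPart (m := 0) L.contDiff ε (contDiff_zero.2 cf)).continuous
  rw [← lintegral_add_left (by fun_prop)]
  refine lintegral_mono_of_add_comp_le L.measurePreserving L.toHomeomorph.measurableEmbedding
    (by fun_prop) (ae_of_all _ fun x => ?_)
  rw [hVL, hasParity_parityPart hL 1 f x, hasParity_parityPart hL (-1) f x,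
    ← parityPart_one_sub_parityPart_neg_one L f, ← parityPart_one_add_parityPart_neg_one L f x,
    Units.neg_smul, one_smul, one_smul]
  simp only [← mul_add, ← ENNReal.ofReal_add, sq_nonneg, add_nonneg]
  gcongr _ * ENNReal.ofReal ?_
  exact le_of_eq (by ring)

end Variance

namespace IsHomogeneousPotential

variable {n : ℕ} {p : ℝ} {V f : Rn n → ℝ} (hV : IsHomogeneousPotential p V)

include hV

theorem isPosDef_hess_of_forall_ne_zero (hu : IsUnconditional V) (hdet : HasAntitoneDualDet V)
    {x : Rn n} (hx : ∀ i, x i ≠ 0) : IsPosDef (hess V x) := by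
  set s : Fin n → Bool := fun i => decide (x i < 0) with hs
  have hmem : flip s x ∈ posOrthant n := fun i => by
    rw [flip_apply]
    rcases (hx i).lt_or_gt with h | h <;> simp [hs, h, h.not_gt]
  intro u hu0
  have hpos := hV.isPosDef_hess_of_mem_posOrthant hu hdet hmem (flip s u) (by simpa using hu0)
  rwa [hess_comp_isometry (flip s) (hu.apply_flip s), (flip s).inner_map_map] at hpos

theorem aemeasurable_energy (hn : n ≠ 0) (hpos : ∀ x : Rn n, (∀ i, x i ≠ 0) → IsPosDef (hess V x))
    (hf : ContDiff ℝ 1 f) :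
    AEMeasurable fun x => ENNReal.ofReal (Real.exp (-V x)) *
      invForm (hess V x) (gradient f x) := by
  have hopen : IsOpen {x : Rn n | ∀ i, x i ≠ 0} := by
    simp only [ofPred_forall]
    exact isOpen_iInter_of_finite fun i => isOpen_ne_fun (by fun_prop) continuous_const
  have cgrad := (continuous_gradient hf).continuousOn (s := {x : Rn n | ∀ i, x i ≠ 0})
  have cinv : ContinuousOn (fun x => (hess V x).inverse) {x : Rn n | ∀ i, x i ≠ 0} := by
    refine fun x hx => ((hpos x hx).continuousAt_inverse (continuousAt_hess
      (hV.contDiffAt ?_))).continuousWithinAt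
    rintro rfl
    exact hx ⟨0, Nat.pos_of_ne_zero hn⟩ rfl
  have henergy : AEMeasurable (fun x => ENNReal.ofReal
      ⟪(hess V x).inverse (gradient f x), gradient f x⟫) := by
    rw [← Measure.restrict_eq_self_of_ae_mem (ae_forall_coord_ne_zero n)]
    exact (((cinv.clm_apply cgrad).inner cgrad).aemeasurable hopen.measurableSet).ennreal_ofReal
  have cV := hV.continuous
  refine AEMeasurable.mul (by fun_prop) (henergy.congr ?_)
  filter_upwards [ae_forall_coord_ne_zero n] with x hx
  rw [(hpos x hx).invForm_eq]

theorem lintegral_energy_parityPart_add_le (hn : n ≠ 0)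
    (hpos : ∀ x : Rn n, (∀ i, x i ≠ 0) → IsPosDef (hess V x)) {L : Rn n ≃ₗᵢ[ℝ] Rn n}
    (hL : Function.Involutive L) (hVL : ∀ x, V (L x) = V x) (hf : ContDiff ℝ 1 f) :
    (∫⁻ x, ENNReal.ofReal (Real.exp (-V x)) *
        invForm (hess V x) (gradient (parityPart L 1 f) x)) +
      (∫⁻ x, ENNReal.ofReal (Real.exp (-V x)) *
        invForm (hess V x) (gradient (parityPart L (-1) f) x)) ≤
      ∫⁻ x, ENNReal.ofReal (Real.exp (-V x)) * invForm (hess V x) (gradient f x) := by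
  refine (le_lintegral_add _ _).trans (lintegral_mono_of_add_comp_le L.measurePreserving
    L.toHomeomorph.measurableEmbedding (hV.aemeasurable_energy hn hpos hf) ?_)
  filter_upwards [ae_forall_coord_ne_zero n] with x hx
  rw [hVL, (hasParity_parityPart hL 1 f).invForm_gradient hVL,
    (hasParity_parityPart hL (-1) f).invForm_gradient hVL, ← mul_add _ (invForm _ _) (invForm _ _),
    ← mul_add _ (invForm _ _) (invForm _ _), invForm_gradient_parityPart_add hVL hf (hpos x hx),
    ← two_mul, mul_left_comm]

theorem varianceBound_of_parityPart (hn : n ≠ 0)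
    (hpos : ∀ x : Rn n, (∀ i, x i ≠ 0) → IsPosDef (hess V x)) {L : Rn n ≃ₗᵢ[ℝ] Rn n}
    (hL : Function.Involutive L) (hVL : ∀ x, V (L x) = V x) (hf : ContDiff ℝ 1 f) {κ : ℝ}
    (heven : VarianceBound κ V (parityPart L 1 f))
    (hodd : VarianceBound κ V (parityPart L (-1) f)) : VarianceBound κ V f := by
  obtain ⟨c, hc⟩ := heven
  obtain ⟨c', hc'⟩ := hodd
  have hsq := lintegral_parityPart_neg_one_sq_le hV.continuous hL hVL hf.continuous c'
  refine ⟨c, (lintegral_sq_sub_le_parityPart hV.continuous hL hVL hf.continuous c).trans ?_⟩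
  refine (add_le_add hc (hsq.trans hc')).trans ?_
  rw [← mul_add]
  gcongr
  exact hV.lintegral_energy_parityPart_add_le hn hpos hL hVL hf

theorem varianceBound_of_hasParity_neg_one (hu : IsUnconditional V) (hdet : HasAntitoneDualDet V)
    (hf : ContDiff ℝ 1 f) {ε : Fin n → ℤˣ} (hfε : ∀ k, HasParity (reflect k) (ε k) f)
    {i j : Fin n} (hij : i ≠ j) (hi : ε i = -1) (hj : ε j = -1) :
    VarianceBound (1 - 1 / p) V f := by
  have hzero : ∀ k, ε k = -1 → ∀ x : Rn n, x k = 0 → f x = 0 := fun k hk x hx =>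
    HasParity.apply_eq_zero_of_isFixedPt (hk ▸ hfε k) (isFixedPt_reflect hx)
  have hVflip : ∀ s x, V (flip s x) = V x := hu.apply_flip
  have hsq : ∀ s x, f (flip s x) ^ 2 = f x ^ 2 := fun s =>
    apply_flip_of_forall_apply_reflect (g := fun x => f x ^ 2) fun k _ x => by
      rcases Int.units_eq_one_or (ε k) with h | h <;> simp [hfε k x, h]
  have henergy : ∀ s x, invForm (hess V (flip s x)) (gradient f (flip s x)) =
      invForm (hess V x) (gradient f x) := fun s =>
    apply_flip_of_forall_apply_reflect (g := fun x => invForm (hess V x) (gradient f x))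
      fun k _ => (hfε k).invForm_gradient (hVflip _)
  refine ⟨0, ?_⟩
  simp only [sub_zero]
  rw [lintegral_eq_setLIntegral_posOrthant _ fun s x => by rw [hVflip, hsq],
    lintegral_eq_setLIntegral_posOrthant (fun x => _ * invForm _ _) fun s x => by
      rw [hVflip, henergy], mul_left_comm]
  gcongr
  refine le_of_eq_of_le ?_
    (hV.setLIntegral_sq_le_of_apply_eq_zero hu hdet hf hij (hzero i hi) (hzero j hj))
  simp only [ENNReal.ofReal_mul (sq_nonneg _), mul_comm]

theorem varianceBound_of_hasParity (hu : IsUnconditional V)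
    (hconc : ConcaveOn ℝ (orthant n) fun x => V (coordPow (1 / p) x))
    (hdet : HasAntitoneDualDet V) (hf : ContDiff ℝ 1 f) (heven : ∀ x, f (-x) = f x)
    {ε : Fin n → ℤˣ} (hfε : ∀ k, HasParity (reflect k) (ε k) f) :
    VarianceBound (1 - 1 / p) V f := by
  by_cases hall : ∀ k, ε k = 1
  · refine hV.varianceBound_of_isUnconditional hu hconc hf
      (isUnconditional_of_forall_apply_reflect fun k x => ?_)
    rw [hfε k, hall, one_smul]
  push Not at hall
  obtain ⟨i, hi⟩ := hall
  replace hi := (Int.units_eq_one_or (ε i)).resolve_left hi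
  by_cases hother : ∃ j, j ≠ i ∧ ε j = -1
  · obtain ⟨j, hji, hj⟩ := hother
    exact hV.varianceBound_of_hasParity_neg_one hu hdet hf hfε hji hj hi
  -- only the coordinate `i` is odd, which forces `f = 0`
  push Not at hother
  have hzero := eq_zero_of_hasParity_reflect heven (hi ▸ hfε i) fun k hk =>
    (Int.units_eq_one_or (ε k)).resolve_right (hother k hk) ▸ hfε k
  exact hV.varianceBound_of_isUnconditional hu hconc hf fun s _ x => by rw [hzero, hzero]

theorem varianceBound_of_even (hu : IsUnconditional V)
    (hconc : ConcaveOn ℝ (orthant n) fun x => V (coordPow (1 / p) x))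
    (hdet : HasAntitoneDualDet V) (hf : ContDiff ℝ 1 f) (heven : ∀ x, f (-x) = f x) :
    VarianceBound (1 - 1 / p) V f := by
  suffices hinduction : ∀ (S : Finset (Fin n)) (f : Rn n → ℝ), ContDiff ℝ 1 f →
      (∀ x, f (-x) = f x) → (∀ k ∉ S, ∃ ε, HasParity (reflect k) ε f) →
      VarianceBound (1 - 1 / p) V f from
    hinduction Finset.univ f hf heven fun k hk => absurd (Finset.mem_univ k) hk
  intro S
  induction S using Finset.induction_on with
  | empty =>
    intro f hf heven hparity
    choose ε hε using fun k => hparity k (Finset.notMem_empty k)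
    exact hV.varianceBound_of_hasParity hu hconc hdet hf heven hε
  | insert a S _ ih =>
    intro f hf heven hparity
    have hpart : ∀ δ : ℤˣ, VarianceBound (1 - 1 / p) V (parityPart (reflect a) δ f) := by
      refine fun δ => ih _ (contDiff_parityPart (reflect a).contDiff δ hf)
        (fun x => by simp only [parityPart, map_neg, heven]) fun k hk => ?_
      rcases eq_or_ne k a with rfl | hka
      · exact ⟨δ, hasParity_parityPart (involutive_reflect k) δ f⟩
      · obtain ⟨ε, hε⟩ := hparity k (by simp [hka, hk])
        exact ⟨ε, hε.parityPart (commute_reflect a k) δ⟩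
    exact hV.varianceBound_of_parityPart a.pos.ne'
      (fun x hx => hV.isPosDef_hess_of_forall_ne_zero hu hdet hx) (involutive_reflect a)
      (hu.apply_flip _) hf (hpart 1) (hpart (-1))

end IsHomogeneousPotential

end StrongBL

end

theorem mainTheorem7 (n : ℕ) (p : ℝ) (hp : 1 < p) (V : StrongBL.Rn n → ℝ)
    (hVeven : ∀ x, V (-x) = V x)
    (hVconv : StrictConvexOn ℝ Set.univ V)
    (hVhom : StrongBL.IsHomogeneousOfDegree p V)
    (hVreg : ContDiffOn ℝ 2 V {0}ᶜ)
    (hVunc : StrongBL.IsUnconditional V)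
    (hVconc : ConcaveOn ℝ (StrongBL.orthant n) fun x => V (StrongBL.coordPow (1 / p) x)) :
    IsProbabilityMeasure (StrongBL.gibbs V) ∧
    (∀ f : StrongBL.Rn n → ℝ, ContDiff ℝ 1 f → StrongBL.IsUnconditional f →
      StrongBL.StrongBrascampLieb p V f) ∧
    ((∀ (i : Fin n) (x' : StrongBL.Rn n), x' i = 0 →
        AntitoneOn (fun t : ℝ =>
          StrongBL.detHess (StrongBL.legendre V) (x' + t • EuclideanSpace.single i (1 : ℝ)))
          (Set.Ici 0)) →
      ∀ f : StrongBL.Rn n → ℝ, ContDiff ℝ 1 f → (∀ x, f (-x) = f x) →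
        StrongBL.StrongBrascampLieb p V f) := by
  have hV : StrongBL.IsHomogeneousPotential p V := ⟨hp, hVconv, hVhom, hVreg⟩
  exact ⟨hV.isProbabilityMeasure_gibbs,
    fun f hf hfu => hV.strongBrascampLieb hf.continuous
      (hV.varianceBound_of_isUnconditional hVunc hVconc hf hfu),
    fun hdet f hf heven => hV.strongBrascampLieb hf.continuous
      (hV.varianceBound_of_even hVunc hVconc hdet hf heven)⟩
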